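/- **Setting.** Let $\mathbb L^3$ be $\mathbb R^3$ with the inner product $\langle a,b\rangle=a_1b_1+a_2b_2-a_3b_3$ and $a\times_L b:=E_3(a\times b)$, $E_3=\mathrm{diag}(1,1,-1)$. Let $I$ be an open interval and $\delta>0$. A $C^\infty$ map $f:U:=I\times(-\delta,\delta)\to\mathbb L^3$ is a *generalized cuspidal edge* along $\Gamma(s):=f(s,0)$ if $f_t(s,0)=0$ and $f_{tt}(s,0),\Gamma'(s)$ are linearly independent for all $s\in I$; put $\Sigma=I\times\{0\}$. A point $p$ is a *cuspidal edge singular point* if, in suitable smooth local coordinates of the source at $p$ and of the target at $f(p)$, the map is $(s,t)\mapsto(s,t^2,t^3)$. Put $E=\langle f_s,f_s\rangle$, $F=\langle f_s,f_t\rangle$, $G=\langle f_t,f_t\rangle$, $\Delta=EG-F^2$, $\tilde L=\det(f_s,f_t,f_{ss})$, $\tilde M=\det(f_s,f_t,f_{st})$, $\tilde N=\det(f_s,f_t,f_{tt})$. A point off $\Sigma$ is *space-like* (*time-like*) if the normal $f_s\times_L f_t$ is time-like (space-like), i.e. $\Delta>0$ ($\Delta<0$). There let $$W=\begin{pmatrix}E&F\\F&G\end{pmatrix}^{-1}\frac1{\sqrt{|\Delta|}}\begin{pmatrix}\tilde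 L&\tilde M\\\tilde M&\tilde N\end{pmatrix},\qquad H^L=\tfrac12\operatorname{trace}W,\qquad K^L=-\frac{\tilde L\tilde N-\tilde M^2}{\Delta^2}.$$ The *principal curvatures* are the two complex eigenvalues of $W$; a space-like or time-like point where they coincide is *umbilic* if $W$ is diagonal there and *quasi-umbilic* if it is not. The *order* of $f$ at $(s,0)$ is the least $k$ with $\partial_t^k\Delta(s,0)\neq0$. Suppose that $\Gamma$ is of type $L$ ($\Gamma'(s)$ is a non-zero light-like vector for every $s\in I$), that $f$ has order four at every point of $\Sigma$, and that the projection $\gamma$ of $\Gamma$ to the $xy$-plane is parametrized by arc length. Let $n(s)$ be the left-ward unit normal of $\gamma$ (as a horizontal vector), $\kappa(s)$ the curvature of $\gamma$, and $v:=\Gamma'-(\gamma',0)$, so $v=(0,0,1)$ if $\Gamma$ is future-pointing and $v=(0,0,-1)$ if it is past-pointing. $f$ is of *convex* (*concave*) type at $(s,0)$ if the Euclidean singular curvature $\kappa_s^E(s)=\Gamma''\cdot D/(\Gamma'\cdot\Gamma')$ is positive (negative), where $D$ is the Euclidean unit vector in the direction of the component of $f_{tt}(s,0)$ Euclidean-orthogonal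 to $\Gamma'(s)$. **Theorem G.** Let $p=(s_0,0)\in\Sigma$. There are a sign $\sigma\in\{1,-1\}$, a smooth function $\mu(u,w)$ near $p$ (the *$\mu$-function*) and a smooth coordinate change $\varphi$ near $p$ with $\varphi(u,0)=(u,0)$, whose $w$-derivative at each $(u,0)$ is a positive multiple of $(0,1)$, such that $$f(\varphi(u,w))=\Gamma(u)+\sigma\Big(\int_0^w r\cos\lambda(u,r)\,dr\Big)n(u)+\sigma\Big(\int_0^w r\sin\lambda(u,r)\,dr\Big)v,\qquad\lambda(u,w)=\int_0^w\mu(u,r)\,dr.$$ For any such $\sigma,\mu$ write $\mu(s,t)=\mu_0(s)+\mu_1(s)t+O(t^2)$. Then there are arbitrarily small open neighbourhoods $V\subset U$ of $p$ such that: (a) $f$ is space-like at all points of $V\setminus\Sigma$, or time-like at all points of $V\setminus\Sigma$. (b) $H^L$ is bounded on $V\setminus\Sigma$ if and only if $3\kappa\mu_1=8\mu_0\mu_0'+3\sigma\kappa'$ at every $s$ with $(s,0)\in V$. (c) $p$ is not an accumulation point of umbilics of $f$. (d) $p$ is a cuspidal edge singular point if and only if $\mu_0(s_0)\neq0$. If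 moreover $\Gamma''(s_0)\neq0$, then also: (1) If $f$ is space-like on $V\setminus\Sigma$, then $f$ is of concave type at every $(s,0)\in V$, and $K^L>0$ on $V\setminus\Sigma$. (2) If $f$ is time-like on $V\setminus\Sigma$, then $K^L>0$ (resp. $K^L<0$) on $V\setminus\Sigma$ if and only if $f$ is of convex (resp. concave) type at $p$. In particular, if moreover $p$ is not a cuspidal edge singular point, then $K^L>0$ on $V\setminus\Sigma$ and $f$ is of convex type at $p$. (3) $|K^L|\to\infty$ as $(s,t)\to p$ with $t\neq0$; $K^L$ has one and the same sign on all of $V\setminus\Sigma$; and both principal curvatures are unbounded on $V\setminus\Sigma$. If $f$ is space-like on $V\setminus\Sigma$ (so that $K^L>0$), both principal curvatures are real there. If $f$ is time-like on $V\setminus\Sigma$, both are real there when $K^L<0$, and both are non-real there when $K^L>0$. (4) $p$ is not an accumulation point of quasi-umbilics of $f$. -/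

import Mathlib

open Set Filter Topology
open scoped ContDiff Matrix

noncomputable section

namespace Minkowski

/-- The affine space `ℝ³`, underlying both `𝔼³` and `𝕃³`. It is only used as a smooth
manifold, so the norm chosen on it is irrelevant. -/
abbrev Vec3 := Fin 3 → ℝ

/-- The Lorentzian inner product of signature `(++-)`. -/
def linner (a b : Vec3) : ℝ := a 0 * b 0 + a 1 * b 1 - a 2 * b 2

/-- The Lorentzian vector product `a ×_L b = E₃ (a × b)`, with `E₃ = diag (1, 1, -1)`. -/
def lcross (a b : Vec3) : Vec3 :=
  ![(crossProduct a b) 0, (crossProduct a b) 1, -(crossProduct a b) 2]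

/-- The determinant of three vectors. -/
def det3 (a b c : Vec3) : ℝ := Matrix.det (Matrix.of ![a, b, c])

/-! ### Partial derivatives of a map of `(s, t)` -/

/-- The partial derivative with respect to the first variable `s`. -/
def dS (f : ℝ × ℝ → Vec3) (q : ℝ × ℝ) : Vec3 := fderiv ℝ f q (1, 0)

/-- The partial derivative with respect to the second variable `t`. -/
def dT (f : ℝ × ℝ → Vec3) (q : ℝ × ℝ) : Vec3 := fderiv ℝ f q (0, 1)

/-! ### Surface theory in `𝕃³` -/

/-- The normal vector `f_s ×_L f_t` (not normalized). -/
def normalL (f : ℝ × ℝ → Vec3) (q : ℝ × ℝ) : Vec3 := lcross (dS f q) (dT f q)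

/-- `f` is space-like at `q`: its normal vector is time-like. -/
def IsSpacelikeAt (f : ℝ × ℝ → Vec3) (q : ℝ × ℝ) : Prop :=
  linner (normalL f q) (normalL f q) < 0

/-- `f` is time-like at `q`: its normal vector is space-like. -/
def IsTimelikeAt (f : ℝ × ℝ → Vec3) (q : ℝ × ℝ) : Prop :=
  0 < linner (normalL f q) (normalL f q)

/-- Coefficients of the first fundamental form. -/
def coeffE (f : ℝ × ℝ → Vec3) (q : ℝ × ℝ) : ℝ := linner (dS f q) (dS f q)
def coeffF (f : ℝ × ℝ → Vec3) (q : ℝ × ℝ) : ℝ := linner (dS f q) (dT f q)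
def coeffG (f : ℝ × ℝ → Vec3) (q : ℝ × ℝ) : ℝ := linner (dT f q) (dT f q)

/-- The identifier of causality `Δ_L = E G - F²`. -/
def deltaL (f : ℝ × ℝ → Vec3) (q : ℝ × ℝ) : ℝ :=
  coeffE f q * coeffG f q - coeffF f q ^ 2

/-- The numbers `det (f_s, f_t, f_{ss})`, `det (f_s, f_t, f_{st})`, `det (f_s, f_t, f_{tt})`. -/
def tildeL (f : ℝ × ℝ → Vec3) (q : ℝ × ℝ) : ℝ := det3 (dS f q) (dT f q) (dS (dS f) q)
def tildeM (f : ℝ × ℝ → Vec3) (q : ℝ × ℝ) : ℝ := det3 (dS f q) (dT f q) (dT (dS f) q)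
def tildeN (f : ℝ × ℝ → Vec3) (q : ℝ × ℝ) : ℝ := det3 (dS f q) (dT f q) (dT (dT f) q)

/-- The Weingarten matrix: the inverse of the first fundamental matrix times the second one,
the latter being taken with respect to the unit normal vector. -/
def weingarten (f : ℝ × ℝ → Vec3) (q : ℝ × ℝ) : Matrix (Fin 2) (Fin 2) ℝ :=
  (!![coeffE f q, coeffF f q; coeffF f q, coeffG f q])⁻¹ *
    (Real.sqrt |deltaL f q|)⁻¹ • !![tildeL f q, tildeM f q; tildeM f q, tildeN f q]

/-- The Gaussian curvature `K^L` (the sectional curvature of the first fundamental form). -/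
def gaussL (f : ℝ × ℝ → Vec3) (q : ℝ × ℝ) : ℝ :=
  -(tildeL f q * tildeN f q - tildeM f q ^ 2) / deltaL f q ^ 2

/-- The mean curvature `H^L`, half the trace of the Weingarten matrix. -/
def meanL (f : ℝ × ℝ → Vec3) (q : ℝ × ℝ) : ℝ := (weingarten f q).trace / 2

/-- The two principal curvatures: the complex eigenvalues of the Weingarten matrix, with
multiplicity. -/
def principalCurvatures (f : ℝ × ℝ → Vec3) (q : ℝ × ℝ) : Multiset ℂ :=
  ((weingarten f q).map (algebraMap ℝ ℂ)).charpoly.roots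

/-- Umbilical points: space-like or time-like points at which the two principal curvatures
coincide and the Weingarten matrix is diagonal. -/
def IsUmbilic (f : ℝ × ℝ → Vec3) (q : ℝ × ℝ) : Prop :=
  (IsSpacelikeAt f q ∨ IsTimelikeAt f q) ∧
    (∃ k : ℂ, principalCurvatures f q = {k, k}) ∧ (weingarten f q).IsDiag

/-- Quasi-umbilical points: space-like or time-like points at which the two principal
curvatures coincide and the Weingarten matrix is not diagonal. -/
def IsQuasiUmbilic (f : ℝ × ℝ → Vec3) (q : ℝ × ℝ) : Prop :=
  (IsSpacelikeAt f q ∨ IsTimelikeAt f q) ∧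
    (∃ k : ℂ, principalCurvatures f q = {k, k}) ∧ ¬ (weingarten f q).IsDiag

/-! ### Generalized cuspidal edges -/

/-- The domain `I × (-δ, δ)`. -/
def edgeDomain (I : Set ℝ) (δ : ℝ) : Set (ℝ × ℝ) := I ×ˢ Ioo (-δ) δ

/-- The `s`-axis, which contains the singular set `I × {0}`. -/
def sAxis : Set (ℝ × ℝ) := {q | q.2 = 0}

/-- The curve `Γ(s) = f(s, 0)`. -/
def edgeCurve (f : ℝ × ℝ → Vec3) (s : ℝ) : Vec3 := f (s, 0)

/-- Its velocity `Γ'(s)`. -/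
def vel (f : ℝ × ℝ → Vec3) (s : ℝ) : Vec3 := deriv (edgeCurve f) s

/-- Its acceleration `Γ''(s)`. -/
def acc (f : ℝ × ℝ → Vec3) (s : ℝ) : Vec3 := deriv (vel f) s

/-- `f` is a generalized cuspidal edge on `I × (-δ, δ)`. -/
structure IsGeneralizedCuspidalEdge (I : Set ℝ) (δ : ℝ) (f : ℝ × ℝ → Vec3) : Prop where
  smooth : ContDiffOn ℝ ∞ f (edgeDomain I δ)
  dT_eq_zero : ∀ s ∈ I, dT f (s, 0) = 0
  independent : ∀ s ∈ I, LinearIndependent ℝ ![dT (dT f) (s, 0), vel f s]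

/-- `p` is a cuspidal edge singular point of `f`: in suitable smooth coordinates of the source
around `p` and of the target around `f p`, the map is `(s, t) ↦ (s, t², t³)`. -/
def IsCuspidalEdgePoint (f : ℝ × ℝ → Vec3) (p : ℝ × ℝ) : Prop :=
  ∃ (φ : OpenPartialHomeomorph (ℝ × ℝ) (ℝ × ℝ)) (Ψ : OpenPartialHomeomorph Vec3 Vec3),
    p ∈ φ.source ∧ f p ∈ Ψ.source ∧
    ContDiffOn ℝ ∞ φ φ.source ∧ ContDiffOn ℝ ∞ φ.symm φ.target ∧
    ContDiffOn ℝ ∞ Ψ Ψ.source ∧ ContDiffOn ℝ ∞ Ψ.symm Ψ.target ∧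
    φ p = (0, 0) ∧ Ψ (f p) = 0 ∧
    ∀ q ∈ φ.source, f q ∈ Ψ.source ∧ Ψ (f q) = ![(φ q).1, (φ q).2 ^ 2, (φ q).2 ^ 3]

/-- The order of `f` at `(s, 0)`: the least `k` such that the `k`-th derivative of
`t ↦ Δ_L(s, t)` at `t = 0` does not vanish (`⊤` if there is none). -/
def edgeOrder (f : ℝ × ℝ → Vec3) (s : ℝ) : ℕ∞ :=
  ⨅ (k : ℕ) (_ : iteratedDeriv k (fun t : ℝ => deltaL f (s, t)) 0 ≠ 0), (k : ℕ∞)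

/-- The curve `Γ` is of type `L` on `I`: its velocity is light-like, that is, a non-zero null
vector, everywhere. -/
def IsTypeL (I : Set ℝ) (f : ℝ × ℝ → Vec3) : Prop :=
  ∀ s ∈ I, vel f s ≠ 0 ∧ linner (vel f s) (vel f s) = 0

/-- The projection `γ = π ∘ Γ` to the `xy`-plane is parametrized by arc length on `I`. -/
def IsArcLengthProjection (I : Set ℝ) (f : ℝ × ℝ → Vec3) : Prop :=
  ∀ s ∈ I, vel f s 0 ^ 2 + vel f s 1 ^ 2 = 1

/-- `f` is a generalized cuspidal edge of order four along a curve of type `L`. -/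
structure IsOrderFourEdge (I : Set ℝ) (δ : ℝ) (f : ℝ × ℝ → Vec3) : Prop where
  edge : IsGeneralizedCuspidalEdge I δ f
  typeL : IsTypeL I f
  order_eq : ∀ s ∈ I, edgeOrder f s = 4

/-- The curvature of the plane curve `γ` (parametrized by arc length). -/
def planeCurvature (f : ℝ × ℝ → Vec3) (s : ℝ) : ℝ :=
  vel f s 0 * acc f s 1 - vel f s 1 * acc f s 0

/-- The left-ward unit normal `n(s)` of `γ`, as a vector of `𝕃³`. -/
def leftNormal (f : ℝ × ℝ → Vec3) (s : ℝ) : Vec3 := ![-(vel f s 1), vel f s 0, 0]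

/-- The vertical part `v(s) = Γ'(s) - (γ'(s), 0)` of the velocity. If `Γ` is of type `L` and `γ`
is parametrized by arc length, it is `(0, 0, 1)` if `Γ` is future-pointing and `(0, 0, -1)` if
`Γ` is past-pointing. Together with `n(s)` it spans (and orients) the plane `P_s`. -/
def verticalPart (f : ℝ × ℝ → Vec3) (s : ℝ) : Vec3 := ![0, 0, vel f s 2]

/-! ### The singular curvature -/

/-- The `𝔼³`-cuspidal direction vector: the part of `f_tt(s, 0)` orthogonal to `Γ'(s)`. -/
def cuspDir (f : ℝ × ℝ → Vec3) (s : ℝ) : Vec3 :=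
  dT (dT f) (s, 0) -
    ((dT (dT f) (s, 0) ⬝ᵥ vel f s) / (vel f s ⬝ᵥ vel f s)) • vel f s

/-- The Euclidean singular curvature `κ_s^E(s)`. -/
def singularCurvature (f : ℝ × ℝ → Vec3) (s : ℝ) : ℝ :=
  (acc f s ⬝ᵥ ((Real.sqrt (cuspDir f s ⬝ᵥ cuspDir f s))⁻¹ • cuspDir f s)) /
    (vel f s ⬝ᵥ vel f s)

/-- `f` is of convex type at `(s, 0)`. -/
def IsConvexAt (f : ℝ × ℝ → Vec3) (s : ℝ) : Prop := 0 < singularCurvature f s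

/-- `f` is of concave type at `(s, 0)`. -/
def IsConcaveAt (f : ℝ × ℝ → Vec3) (s : ℝ) : Prop := singularCurvature f s < 0

/-! ### The `μ`-function -/

/-- `λ(s, t) = ∫₀ᵗ μ(s, u) du`. -/
def cuspAngle (μ : ℝ × ℝ → ℝ) (s t : ℝ) : ℝ := ∫ u in (0 : ℝ)..t, μ (s, u)

/-- `x(s, t) = ∫₀ᵗ u cos λ(s, u) du`. -/
def cuspX (μ : ℝ × ℝ → ℝ) (s t : ℝ) : ℝ := ∫ u in (0 : ℝ)..t, u * Real.cos (cuspAngle μ s u)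

/-- `y(s, t) = ∫₀ᵗ u sin λ(s, u) du`. -/
def cuspY (μ : ℝ × ℝ → ℝ) (s t : ℝ) : ℝ := ∫ u in (0 : ℝ)..t, u * Real.sin (cuspAngle μ s u)

/-- The square box of radius `r` around `(s₀, 0)`. -/
def box (s₀ r : ℝ) : Set (ℝ × ℝ) := Ioo (s₀ - r) (s₀ + r) ×ˢ Ioo (-r) r

/-- `φ` is an admissible coordinate change on the box of radius `r` around `(s₀, 0)` which fixes
the points of the `s`-axis. (It is a local diffeomorphism at each of these points, because its
Jacobian there is positive.) -/
structure IsAdmissibleChange (s₀ r : ℝ) (φ : ℝ × ℝ → ℝ × ℝ) : Prop where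
  smooth : ContDiffOn ℝ ∞ φ (box s₀ r)
  fix_axis : ∀ u ∈ Ioo (s₀ - r) (s₀ + r), φ (u, 0) = (u, 0)
  s_v : ∀ u ∈ Ioo (s₀ - r) (s₀ + r), (fderiv ℝ φ (u, 0) (0, 1)).1 = 0
  t_v : ∀ u ∈ Ioo (s₀ - r) (s₀ + r), 0 < (fderiv ℝ φ (u, 0) (0, 1)).2

/-- `σ ∈ {1, -1}` is the sign and `μ`, a smooth function near `(s₀, 0)`, is the `μ`-function of
`f` near `(s₀, 0)`: in suitable admissible coordinates `(u, v)` near `(s₀, 0)`, for each `u` the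
curve `v ↦ f` is the section of `f` by the plane `P_u` through `Γ(u)` spanned by `n(u)` and the
vertical direction, its cuspidal direction is `σ n(u)`, and it is parametrized by the normalized
half-arc-length parameter, with `μ`-function `v ↦ μ(u, v)`. -/
def IsMuFunctionAt (I : Set ℝ) (δ : ℝ) (f : ℝ × ℝ → Vec3) (s₀ σ : ℝ) (μ : ℝ × ℝ → ℝ) : Prop :=
  (σ = 1 ∨ σ = -1) ∧ ∃ (r : ℝ) (φ : ℝ × ℝ → ℝ × ℝ), 0 < r ∧
    IsAdmissibleChange s₀ r φ ∧ MapsTo φ (box s₀ r) (edgeDomain I δ) ∧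
    ContDiffOn ℝ ∞ μ (box s₀ r) ∧
    ∀ u v : ℝ, (u, v) ∈ box s₀ r →
      f (φ (u, v)) = edgeCurve f u + (σ * cuspX μ u v) • leftNormal f u
        + (σ * cuspY μ u v) • verticalPart f u

/-- The coefficient `μ₀(s)` of `μ(s, t) = μ₀(s) + μ₁(s) t + O(t²)`. -/
def muZero (μ : ℝ × ℝ → ℝ) (s : ℝ) : ℝ := μ (s, 0)

/-- The coefficient `μ₁(s)` of `μ(s, t) = μ₀(s) + μ₁(s) t + O(t²)`. -/
def muOne (μ : ℝ × ℝ → ℝ) (s : ℝ) : ℝ := deriv (fun t : ℝ => μ (s, t)) 0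

end Minkowski

end

/-! In the frame formed by `γ'`, the normal `n` and the vertical vector `v`, which obeys the planar
Frenet equations, the theorem becomes a Taylor expansion in `w`. The normal form has `f_u = (1 -
σκx, σx_u, 1 + σy_u)` and `f_w = (0, σw cos λ, σw sin λ)`, where `x = w²/2 + O(w⁴)` and `y = μ₀w³/3
+ O(w⁴)`. Since `Γ'` is light-like, `E`, `F`, `G` start at `w²` with coefficients `-σκ`, `-σμ₀`,
`1`, and the second fundamental matrix starts at `w²` with `-σκμ₀`, `κ`, `μ₀`, up to the sign of
`v`. Hence `Δ = -w⁴(σκ + μ₀²) + O(w⁵)`, and the determinant of the second matrix is `-w⁴ σκ(σκ +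
μ₀²) + O(w⁵)`.

Order four therefore means `σκ + μ₀² ≠ 0`, and this number decides the causal type. Moreover `w⁴K^L`
tends to `σκ/(σκ + μ₀²)`, while the singular curvature is `σκ/2`; comparing signs gives (1) and (2).
In the numerator of `H^L` the `w⁴` terms cancel and the `w⁵` coefficient is `σ(8μ₀μ₀' + 3σκ' -
3κμ₁)/6`; the denominator has order `w⁶`, so boundedness is the vanishing of this coefficient. The
combination `FÑ - GM̃`, which is zero at an umbilic, starts with `-w⁴σ(σκ + μ₀²)` up to sign, whence
(c). Finally `det W` has exact order `w⁻⁴` when `κ ≠ 0` but the trace is only `O(w⁻¹)`, so the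
discriminant of the characteristic polynomial has the sign of `-det W`, and no eigenvalue stays
bounded. These computations are `NormalForm.exists_expansion`, `NormalForm.exists_invariants` and
`NormalForm.exists_curvatureData`; the transformation rules of the forms carry them back to the
original coordinates.

For (d), if `μ₀ ≠ 0`, taking the square root of `x` as parameter turns the section into `(W², W³y(u,
W))`, and Whitney's theorem on even functions absorbs `y` into a diffeomorphism of the target. If
`μ₀ = 0`, the section through `p` has no cubic term, which is impossible for the curve transverse to
a cuspidal edge.

The normal form exists because the planes spanned by `n` and `v` are transverse to `Γ'`. Order four
forces the acceleration of each section at its cusp to be horizontal, so its tangent angle is a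
smooth function vanishing on the axis; the parameter is the square root of twice the arc length, and
`μ` is the derivative of the angle. -/

noncomputable section

namespace Minkowski

/-! ### Partial derivatives, parametric averages and division by a coordinate -/

section Calculus

variable {F : Type*} [NormedAddCommGroup F] [NormedSpace ℝ F]

/-- The partial derivative with respect to the first variable. -/
def pdx (g : ℝ × ℝ → F) (q : ℝ × ℝ) : F := fderiv ℝ g q (1, 0)

/-- The partial derivative with respect to the second variable. -/
def pdy (g : ℝ × ℝ → F) (q : ℝ × ℝ) : F := fderiv ℝ g q (0, 1)

theorem contDiff_pdx {g : ℝ × ℝ → F} (hg : ContDiff ℝ ∞ g) : ContDiff ℝ ∞ (pdx g) :=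
  (hg.fderiv_right (m := ∞) (by simp)).clm_apply contDiff_const

theorem contDiff_pdy {g : ℝ × ℝ → F} (hg : ContDiff ℝ ∞ g) : ContDiff ℝ ∞ (pdy g) :=
  (hg.fderiv_right (m := ∞) (by simp)).clm_apply contDiff_const

theorem hasDerivAt_fst {g : ℝ × ℝ → F} {u w : ℝ} (hg : DifferentiableAt ℝ g (u, w)) :
    HasDerivAt (fun s => g (s, w)) (pdx g (u, w)) u := by
  have h1 : HasDerivAt (fun s : ℝ => (s, w)) ((1 : ℝ), (0 : ℝ)) u :=
    (hasDerivAt_id u).prodMk (hasDerivAt_const u w)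
  exact hg.hasFDerivAt.comp_hasDerivAt u h1

theorem hasDerivAt_snd {g : ℝ × ℝ → F} {u w : ℝ} (hg : DifferentiableAt ℝ g (u, w)) :
    HasDerivAt (fun t => g (u, t)) (pdy g (u, w)) w := by
  have h1 : HasDerivAt (fun s : ℝ => (u, s)) ((0 : ℝ), (1 : ℝ)) w :=
    (hasDerivAt_const w u).prodMk (hasDerivAt_id w)
  exact hg.hasFDerivAt.comp_hasDerivAt w h1

theorem pdx_eq {g : ℝ × ℝ → F} {u w : ℝ} {g' : F} (hg : DifferentiableAt ℝ g (u, w))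
    (h : HasDerivAt (fun s => g (s, w)) g' u) : pdx g (u, w) = g' :=
  (hasDerivAt_fst hg).unique h

theorem pdy_eq {g : ℝ × ℝ → F} {u w : ℝ} {g' : F} (hg : DifferentiableAt ℝ g (u, w))
    (h : HasDerivAt (fun t => g (u, t)) g' w) : pdy g (u, w) = g' :=
  (hasDerivAt_snd hg).unique h

theorem fderiv_apply_eq {g : ℝ × ℝ → F} (q v : ℝ × ℝ) :
    fderiv ℝ g q v = v.1 • pdx g q + v.2 • pdy g q := by
  have : v = v.1 • ((1 : ℝ), (0 : ℝ)) + v.2 • ((0 : ℝ), (1 : ℝ)) := by ext <;> simp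
  conv_lhs => rw [this]
  rw [map_add, map_smul, map_smul]; rfl

/-- The weighted average `∫₀¹ xᵏ g(u, x w) dx`. -/
def avg (k : ℕ) (g : ℝ × ℝ → ℝ) (q : ℝ × ℝ) : ℝ := ∫ x in (0 : ℝ)..1, x ^ k * g (q.1, x * q.2)

/-- Differentiation under the integral sign: the derivative in `w` produces a factor `x` and raises
the weight by one. The family of weighted averages is thus closed under differentiation. -/
theorem hasFDerivAt_avg (k : ℕ) {g : ℝ × ℝ → ℝ} (hg : ContDiff ℝ ∞ g) (q : ℝ × ℝ) :
    HasFDerivAt (avg k g) (avg k (pdx g) q • ContinuousLinearMap.fst ℝ ℝ ℝ +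
      avg (k + 1) (pdy g) q • ContinuousLinearMap.snd ℝ ℝ ℝ) q := by
  have hgx := (contDiff_pdx hg).continuous
  have hgy := (contDiff_pdy hg).continuous
  have hgc := hg.continuous
  let F' : ℝ × ℝ → ℝ → (ℝ × ℝ →L[ℝ] ℝ) := fun q x =>
    (x ^ k * pdx g (q.1, x * q.2)) • ContinuousLinearMap.fst ℝ ℝ ℝ +
      (x ^ (k + 1) * pdy g (q.1, x * q.2)) • ContinuousLinearMap.snd ℝ ℝ ℝ
  have hF'c : Continuous (fun z : (ℝ × ℝ) × ℝ => F' z.1 z.2) := by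
    dsimp only [F']; fun_prop
  -- Continuity on the compact product of a ball and `[0, 1]` supplies a constant dominating
  -- function.
  obtain ⟨C, hC⟩ := ((isCompact_closedBall q (1 : ℝ)).prod (isCompact_Icc (a := (0 : ℝ))
    (b := 1))).exists_bound_of_continuousOn hF'c.continuousOn
  have key := intervalIntegral.hasFDerivAt_integral_of_dominated_of_fderiv_le
    (μ := MeasureTheory.volume) (a := 0) (b := 1)
    (F := fun (q : ℝ × ℝ) x => x ^ k * g (q.1, x * q.2)) (F' := F') (x₀ := q)
    (s := Metric.closedBall q 1) (bound := fun _ => C) (Metric.closedBall_mem_nhds q one_pos)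
    (Eventually.of_forall fun q => (by fun_prop : Continuous
      (fun x : ℝ => x ^ k * g (q.1, x * q.2))).aestronglyMeasurable)
    ((by fun_prop : Continuous (fun x : ℝ => x ^ k * g (q.1, x * q.2))).intervalIntegrable _ _)
    ((by fun_prop : Continuous (fun x : ℝ => F' q x)).aestronglyMeasurable)
    (Eventually.of_forall fun x hx y hy => hC (y, x) ⟨hy, by
      rw [uIoc_of_le zero_le_one] at hx; exact ⟨hx.1.le, hx.2⟩⟩)
    intervalIntegrable_const
    (Eventually.of_forall fun x _ y _ => by
      have h1 : HasFDerivAt (fun y : ℝ × ℝ => (y.1, x * y.2))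
          ((ContinuousLinearMap.fst ℝ ℝ ℝ).prod (x • ContinuousLinearMap.snd ℝ ℝ ℝ)) y :=
        hasFDerivAt_fst.prodMk (hasFDerivAt_snd.const_mul x)
      have h2 := ((hg.differentiable (by simp) (y.1, x * y.2)).hasFDerivAt.comp y h1).const_mul
        (x ^ k)
      refine h2.congr_fderiv ?_
      ext
      · simp [F', fderiv_apply_eq]
      · simp [F', fderiv_apply_eq]; ring)
  refine key.congr_fderiv ?_
  have i1 : Continuous (fun x : ℝ => x ^ k * pdx g (q.1, x * q.2)) := by fun_prop
  have i2 : Continuous (fun x : ℝ => x ^ (k + 1) * pdy g (q.1, x * q.2)) := by fun_prop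
  dsimp only [F']
  rw [intervalIntegral.integral_add, intervalIntegral.integral_smul_const,
    intervalIntegral.integral_smul_const]
  · rfl
  · exact (i1.smul continuous_const).intervalIntegrable _ _
  · exact (i2.smul continuous_const).intervalIntegrable _ _

/-- Both partial derivatives are again weighted averages of smooth functions, so the induction runs
over all `k` and `g` at once. -/
theorem contDiff_avg (k : ℕ) {g : ℝ × ℝ → ℝ} (hg : ContDiff ℝ ∞ g) : ContDiff ℝ ∞ (avg k g) := by
  rw [contDiff_infty]
  intro n
  induction n generalizing k g with
  | zero =>
    exact contDiff_zero.2 (continuous_iff_continuousAt.2 fun q =>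
      (hasFDerivAt_avg k hg q).continuousAt)
  | succ n ih =>
    exact contDiff_succ_iff_hasFDerivAt.2 ⟨_, ((ih k (contDiff_pdx hg)).smul contDiff_const).add
      ((ih (k + 1) (contDiff_pdy hg)).smul contDiff_const), hasFDerivAt_avg k hg⟩

theorem pdx_avg (k : ℕ) {g : ℝ × ℝ → ℝ} (hg : ContDiff ℝ ∞ g) (q : ℝ × ℝ) :
    pdx (avg k g) q = avg k (pdx g) q := by
  simp [pdx, (hasFDerivAt_avg k hg q).fderiv]

theorem pdy_avg (k : ℕ) {g : ℝ × ℝ → ℝ} (hg : ContDiff ℝ ∞ g) (q : ℝ × ℝ) :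
    pdy (avg k g) q = avg (k + 1) (pdy g) q := by
  simp [pdy, (hasFDerivAt_avg k hg q).fderiv]

theorem avg_axis (k : ℕ) (g : ℝ × ℝ → ℝ) (u : ℝ) : avg k g (u, 0) = g (u, 0) / (k + 1) := by
  simp [avg, integral_pow]; ring

/-- Substitution: `∫₀ʷ rᵏ g(u, r) dr = wᵏ⁺¹ ∫₀¹ xᵏ g(u, x w) dx`. -/
theorem integral_eq_avg (k : ℕ) (g : ℝ × ℝ → ℝ) (u w : ℝ) :
    ∫ r in (0 : ℝ)..w, r ^ k * g (u, r) = w ^ (k + 1) * avg k g (u, w) := by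
  rcases eq_or_ne w 0 with rfl | hw
  · simp
  have := intervalIntegral.integral_comp_mul_right (a := 0) (b := 1)
    (fun r => r ^ k * g (u, r)) hw
  simp only [zero_mul, one_mul, smul_eq_mul] at this
  have h2 : w ^ k * avg k g (u, w) = ∫ x in (0 : ℝ)..1, (x * w) ^ k * g (u, x * w) := by
    rw [avg, ← intervalIntegral.integral_const_mul]
    congr 1; ext x; ring
  rw [pow_succ', mul_assoc, h2, this, mul_inv_cancel_left₀ hw]

theorem eq_axis_add_mul_avg {g : ℝ × ℝ → ℝ} (hg : ContDiff ℝ ∞ g) (u w : ℝ) :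
    g (u, w) = g (u, 0) + w * avg 0 (pdy g) (u, w) := by
  have h := intervalIntegral.integral_eq_sub_of_hasDerivAt (a := 0) (b := w)
    (f := fun t => g (u, t)) (f' := fun t => pdy g (u, t))
    (fun x _ => hasDerivAt_snd (hg.differentiable (by simp) _))
    (((contDiff_pdy hg).continuous.comp (by fun_prop :
      Continuous fun t : ℝ => (u, t))).intervalIntegrable _ _)
  have h2 := integral_eq_avg 0 (pdy g) u w
  simp only [pow_zero, one_mul, zero_add, pow_one] at h2
  rw [← h2, h]; ring

/-- **Hadamard's lemma**: the first order Taylor expansion in the second variable. -/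
theorem exists_eq_axis_add_mul {g : ℝ × ℝ → ℝ} (hg : ContDiff ℝ ∞ g) :
    ∃ g₁ : ℝ × ℝ → ℝ, ContDiff ℝ ∞ g₁ ∧ (∀ u w, g (u, w) = g (u, 0) + w * g₁ (u, w)) ∧
      ∀ u, g₁ (u, 0) = pdy g (u, 0) :=
  ⟨avg 0 (pdy g), contDiff_avg 0 (contDiff_pdy hg), eq_axis_add_mul_avg hg, fun u => by
    simp [avg_axis]⟩

end Calculus

/-! ### Smoothness near a point -/

section SmoothNear

variable {E F G : Type*} [NormedAddCommGroup E] [NormedSpace ℝ E]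
  [NormedAddCommGroup F] [NormedSpace ℝ F] [NormedAddCommGroup G] [NormedSpace ℝ G]

/-- `g` is of class `C^∞` on a neighbourhood of `p`. -/
def SmoothNear (g : E → F) (p : E) : Prop := ∀ᶠ x in 𝓝 p, ContDiffAt ℝ ∞ g x

theorem SmoothNear.contDiffAt {g : E → F} {p : E} (h : SmoothNear g p) : ContDiffAt ℝ ∞ g p :=
  h.self_of_nhds

theorem SmoothNear.continuousAt {g : E → F} {p : E} (h : SmoothNear g p) : ContinuousAt g p :=
  h.contDiffAt.continuousAt

theorem SmoothNear.differentiableAt {g : E → F} {p : E} (h : SmoothNear g p) :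
    DifferentiableAt ℝ g p := h.contDiffAt.differentiableAt (by simp)

theorem SmoothNear.eventually {g : E → F} {p : E} (h : SmoothNear g p) :
    ∀ᶠ x in 𝓝 p, SmoothNear g x := h.eventually_nhds

theorem ContDiff.smoothNear {g : E → F} (h : ContDiff ℝ ∞ g) (p : E) : SmoothNear g p :=
  Eventually.of_forall fun _ => h.contDiffAt

theorem SmoothNear.of_contDiffOn {g : E → F} {s : Set E} {p : E} (h : ContDiffOn ℝ ∞ g s)
    (hs : s ∈ 𝓝 p) : SmoothNear g p := by
  filter_upwards [eventually_mem_nhds_iff.2 hs] with x hx using h.contDiffAt hx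

theorem SmoothNear.congr {g g' : E → F} {p : E} (h : SmoothNear g p) (he : g' =ᶠ[𝓝 p] g) :
    SmoothNear g' p := by
  filter_upwards [h, he.eventually_nhds] with x h1 h2 using h1.congr_of_eventuallyEq h2

theorem SmoothNear.comp {g : F → G} {h : E → F} {p : E} (hg : SmoothNear g (h p))
    (hh : SmoothNear h p) : SmoothNear (fun x => g (h x)) p := by
  filter_upwards [hh, hh.continuousAt.eventually hg] with x h1 h2 using h2.comp x h1

theorem SmoothNear.prodMk {g : E → F} {h : E → G} {p : E} (hg : SmoothNear g p)
    (hh : SmoothNear h p) : SmoothNear (fun x => (g x, h x)) p := by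
  filter_upwards [hg, hh] with x h1 h2 using h1.prodMk h2

/-- A germ of a smooth map is the germ of a globally smooth map. -/
theorem SmoothNear.exists_contDiff [FiniteDimensional ℝ E] {g : E → F} {p : E}
    (h : SmoothNear g p) : ∃ g' : E → F, ContDiff ℝ ∞ g' ∧ g =ᶠ[𝓝 p] g' := by
  obtain ⟨r, hr, hs⟩ := Metric.eventually_nhds_iff_ball.1 h
  have hsm : ContDiffOn ℝ ∞ g (Metric.ball p r) := fun x hx => (hs x hx).contDiffWithinAt
  obtain ⟨χ, hχ1, hχ2, hχ3, hχ4, hχ5⟩ := exists_contDiff_tsupport_subset (n := ⊤)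
    (Metric.ball_mem_nhds p hr)
  -- flatten the bump function near `p`
  let χ' : E → ℝ := fun x => Real.smoothTransition (2 * χ x)
  have hχ'd : ContDiff ℝ ∞ χ' := Real.smoothTransition.contDiff.comp (contDiff_const.mul hχ3)
  refine ⟨fun x => χ' x • g x, contDiff_iff_contDiffAt.2 fun x => ?_, ?_⟩
  · by_cases hx : x ∈ tsupport χ
    · exact hχ'd.contDiffAt.smul (hs x (hχ1 hx))
    · have : (fun x => χ' x • g x) =ᶠ[𝓝 x] fun _ => (0 : F) := by
        filter_upwards [(isClosed_tsupport χ).isOpen_compl.mem_nhds hx] with y hy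
        simp [χ', image_eq_zero_of_notMem_tsupport hy]
      exact contDiffAt_const.congr_of_eventuallyEq this
  · have : ∀ᶠ x in 𝓝 p, 1 / 2 < χ x :=
      hχ3.continuous.continuousAt.eventually_const_lt (by rw [hχ5]; norm_num)
    filter_upwards [this] with x hx
    simp [χ', Real.smoothTransition.one_of_one_le (by linarith : 1 ≤ 2 * χ x)]

end SmoothNear

/-! ### Borel's lemma and Whitney's theorem on even functions, with parameters -/

section Whitney

/-- The quotient `h z / z ^ N` is zero near the origin, so the division creates no singularity. -/
theorem exists_eq_pow_mul {h : ℝ → ℝ} (hh : ContDiff ℝ ∞ h) (h0 : ∀ᶠ z in 𝓝 0, h z = 0)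
    (N : ℕ) : ∃ g : ℝ → ℝ, ContDiff ℝ ∞ g ∧ ∀ z, h z = z ^ N * g z := by
  refine ⟨fun z => h z / z ^ N, contDiff_iff_contDiffAt.2 fun z => ?_, fun z => ?_⟩
  · rcases eq_or_ne z 0 with rfl | hz
    · refine (contDiffAt_const (c := (0 : ℝ))).congr_of_eventuallyEq ?_
      filter_upwards [h0] with z hz; simp [hz]
    · exact hh.contDiffAt.div (contDiffAt_id.pow N) (pow_ne_zero N hz)
  · rcases eq_or_ne z 0 with rfl | hz
    · simp [h0.self_of_nhds]
    · field_simp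

theorem exists_bound_iteratedFDeriv {g : ℝ × ℝ → ℝ} (hg : ContDiff ℝ ∞ g)
    (hs : HasCompactSupport g) (j : ℕ) : ∃ M, 0 ≤ M ∧ ∀ q, ‖iteratedFDeriv ℝ j g q‖ ≤ M := by
  obtain ⟨M, hM⟩ := (hg.continuous_iteratedFDeriv (m := j)
    (by exact_mod_cast le_top)).bounded_above_of_compact_support (hs.iteratedFDeriv j)
  exact ⟨M, (norm_nonneg _).trans (hM 0), hM⟩

/-- As `ε ≤ 1`, the linear map `(u, z) ↦ (u, z/ε)` has norm at most `ε⁻¹`; every derivative costs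
one such factor. -/
theorem norm_iteratedFDeriv_comp_scale_le {g : ℝ × ℝ → ℝ} (hg : ContDiff ℝ ∞ g) {ε : ℝ}
    (h0 : 0 < ε) (h1 : ε ≤ 1) {j : ℕ} {M : ℝ} (hM : ∀ q, ‖iteratedFDeriv ℝ j g q‖ ≤ M)
    (q : ℝ × ℝ) :
    ‖iteratedFDeriv ℝ j (fun q : ℝ × ℝ => g (q.1, q.2 / ε)) q‖ ≤ M * (ε⁻¹) ^ j := by
  let L : ℝ × ℝ →L[ℝ] ℝ × ℝ :=
    (ContinuousLinearMap.fst ℝ ℝ ℝ).prod (ε⁻¹ • ContinuousLinearMap.snd ℝ ℝ ℝ)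
  have hε : 1 ≤ ε⁻¹ := (one_le_inv₀ h0).2 h1
  have hL : ‖L‖ ≤ ε⁻¹ := by
    refine ContinuousLinearMap.opNorm_le_bound _ (by positivity) fun v => ?_
    simp only [L, ContinuousLinearMap.prod_apply, ContinuousLinearMap.coe_fst',
      FunLike.coe_smul, Pi.smul_apply, ContinuousLinearMap.coe_snd', smul_eq_mul]
    rw [Prod.norm_def]
    refine max_le ?_ ?_
    · calc ‖v.1‖ ≤ ‖v‖ := norm_fst_le v
        _ ≤ ε⁻¹ * ‖v‖ := le_mul_of_one_le_left (norm_nonneg _) hε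
    · rw [norm_mul, Real.norm_of_nonneg (by positivity : 0 ≤ ε⁻¹)]
      exact mul_le_mul_of_nonneg_left (norm_snd_le v) (by positivity)
  have he : (fun q : ℝ × ℝ => g (q.1, q.2 / ε)) = g ∘ L := by
    ext q; simp [L, div_eq_inv_mul]
  rw [he, L.iteratedFDeriv_comp_right hg q (i := j) (by exact_mod_cast le_top)]
  refine (ContinuousMultilinearMap.norm_compContinuousLinearMap_le _ _).trans ?_
  rw [Finset.prod_const, Finset.card_univ, Fintype.card_fin]
  exact mul_le_mul (hM _) (pow_le_pow_left₀ (norm_nonneg _) hL j) (by positivity)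
    ((norm_nonneg _).trans (hM 0))

/-- **Borel's lemma** with a parameter: any sequence of compactly supported smooth functions of
`u` is the sequence of Taylor coefficients along `z = 0` of a smooth function of `(u, z)`. -/
theorem exists_contDiff_taylor (c : ℕ → ℝ → ℝ) (hc : ∀ k, ContDiff ℝ ∞ (c k))
    (hs : ∀ k, HasCompactSupport (c k)) :
    ∃ α : ℝ × ℝ → ℝ, ContDiff ℝ ∞ α ∧ ∀ N : ℕ, ∃ αN : ℝ × ℝ → ℝ, ContDiff ℝ ∞ αN ∧
      ∀ u z, α (u, z) = (∑ k ∈ Finset.range N, c k u * z ^ k) + z ^ N * αN (u, z) := by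
  let χ : ContDiffBump (0 : ℝ) := ⟨1, 2, one_pos, one_lt_two⟩
  have hχ : ContDiff ℝ ∞ χ := χ.contDiff
  let T : ℕ → ℕ → ℝ × ℝ → ℝ := fun k m q => c k q.1 * (q.2 ^ m * χ q.2)
  have hT : ∀ k m, ContDiff ℝ ∞ (T k m) := fun k m =>
    ((hc k).comp contDiff_fst).mul ((contDiff_snd.pow m).mul (hχ.comp contDiff_snd))
  have hTs : ∀ k m, HasCompactSupport (T k m) := by
    intro k m
    refine HasCompactSupport.intro ((hs k).isCompact.prod χ.hasCompactSupport.isCompact) ?_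
    rintro ⟨u, y⟩ hq
    simp only [mem_prod, not_and_or] at hq
    rcases hq with h | h
    · simp [T, image_eq_zero_of_notMem_tsupport h]
    · simp [T, image_eq_zero_of_notMem_tsupport h]
  choose M hM0 hM using fun k m j => exists_bound_iteratedFDeriv (hT k m) (hTs k m) j
  let B : ℕ → ℝ := fun k => ∑ m ∈ Finset.range (k + 1), ∑ j ∈ Finset.range (k + 1), M k m j
  have hB0 : ∀ k, 0 ≤ B k := fun k => Finset.sum_nonneg fun m _ => Finset.sum_nonneg fun j _ =>
    hM0 k m j
  have hMB : ∀ k m j, m ≤ k → j ≤ k → M k m j ≤ B k := by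
    intro k m j hm hj
    refine (Finset.single_le_sum (f := fun j => M k m j) (fun j _ => hM0 k m j)
      (Finset.mem_range.2 (Nat.lt_succ_of_le hj))).trans ?_
    exact Finset.single_le_sum (f := fun m => ∑ j ∈ Finset.range (k + 1), M k m j)
      (fun m _ => Finset.sum_nonneg fun j _ => hM0 k m j)
      (Finset.mem_range.2 (Nat.lt_succ_of_le hm))
  -- `B k` bounds the derivatives of order at most `k` of all `T k m` with `m ≤ k`. The width `ε k`
  -- of the `k`-th cut-off makes `ε k * B k` summable.
  let ε : ℕ → ℝ := fun k => (1 / 2) ^ k / (1 + B k)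
  have hε0 : ∀ k, 0 < ε k := fun k => div_pos (by positivity) (by linarith [hB0 k])
  have hε1 : ∀ k, ε k ≤ 1 := fun k => by
    rw [div_le_one (by linarith [hB0 k])]
    linarith [hB0 k, pow_le_one₀ (n := k) (by norm_num : (0 : ℝ) ≤ 1 / 2) (by norm_num)]
  have hεB : ∀ k, ε k * B k ≤ (1 / 2) ^ k := fun k => by
    dsimp only [ε]
    rw [div_mul_eq_mul_div, div_le_iff₀ (by linarith [hB0 k])]
    exact mul_le_mul_of_nonneg_left (by linarith) (by positivity)
  -- For `k ≥ N` this is the cut-off term `c_k z^k χ(z/ε_k)` divided by `z^N`, written as a rescaled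
  -- fixed function. The sum for `N = 0` is `α`, and the sum for general `N` supplies the tail of
  -- the remainder `αN`.
  let b : ℕ → ℕ → ℝ × ℝ → ℝ := fun N k q =>
    if k < N then 0 else ε k ^ (k - N) * T k (k - N) (q.1, q.2 / ε k)
  have hb : ∀ N k, ContDiff ℝ ∞ (b N k) := by
    intro N k
    by_cases h : k < N
    · simpa [b, h] using contDiff_const
    · simp only [b, h, if_false]
      exact contDiff_const.mul ((hT k (k - N)).comp
        (contDiff_fst.prodMk (contDiff_snd.div_const _)))
  -- The prefactor `ε^(k-N)` loses `j` factors to `j` derivatives. Since `k ≥ N + j + 1`, at least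
  -- one factor `ε k` survives and beats `B k`.
  have hbb : ∀ N j k, N + j + 1 ≤ k → ∀ q, ‖iteratedFDeriv ℝ j (b N k) q‖ ≤ (1 / 2) ^ k := by
    intro N j k hk q
    have hkN : ¬ k < N := by omega
    have he : b N k = fun q : ℝ × ℝ => ε k ^ (k - N) • T k (k - N) (q.1, q.2 / ε k) := by
      ext q; simp [b, hkN]
    have hsm : ContDiff ℝ ∞ (fun q : ℝ × ℝ => T k (k - N) (q.1, q.2 / ε k)) :=
      (hT k (k - N)).comp (contDiff_fst.prodMk (contDiff_snd.div_const _))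
    rw [he, iteratedFDeriv_const_smul_apply' (hsm.contDiffAt.of_le (by exact_mod_cast le_top)),
      norm_smul, Real.norm_of_nonneg (pow_nonneg (hε0 k).le _)]
    have h1 := norm_iteratedFDeriv_comp_scale_le (hT k (k - N)) (hε0 k) (hε1 k)
      (hM k (k - N) j) q
    have h2 : ε k ^ (k - N) * (M k (k - N) j * (ε k)⁻¹ ^ j) = ε k ^ (k - N - j) * M k (k - N) j := by
      have : k - N = (k - N - j) + j := by omega
      conv_lhs => rw [show ε k ^ (k - N) = ε k ^ (k - N - j) * ε k ^ j by rw [← pow_add, ← this]]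
      rw [inv_pow]
      field_simp [(hε0 k).ne']
    calc _ ≤ ε k ^ (k - N) * (M k (k - N) j * (ε k)⁻¹ ^ j) :=
          mul_le_mul_of_nonneg_left h1 (pow_nonneg (hε0 k).le _)
      _ = ε k ^ (k - N - j) * M k (k - N) j := h2
      _ ≤ ε k * B k := mul_le_mul (pow_le_of_le_one (hε0 k).le (hε1 k) (by omega))
          (hMB _ _ _ (by omega) (by omega)) (hM0 _ _ _) (hε0 k).le
      _ ≤ _ := hεB k
  have hcof : ∀ N j, ∀ᶠ k in cofinite, ∀ q, ‖iteratedFDeriv ℝ j (b N k) q‖ ≤ (1 / 2) ^ k := by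
    intro N j
    rw [Nat.cofinite_eq_atTop]
    filter_upwards [eventually_ge_atTop (N + j + 1)] with k hk using hbb N j k hk
  have hgeo : Summable fun k : ℕ => ((1 : ℝ) / 2) ^ k := summable_geometric_two
  have hsum : ∀ N q, Summable fun k => b N k q := by
    intro N q
    refine Summable.of_norm_bounded_eventually hgeo ?_
    filter_upwards [hcof N 0] with k hk
    simpa using hk q
  have hα : ∀ N, ContDiff ℝ ∞ (fun q => ∑' k, b N k q) := fun N =>
    contDiff_tsum_of_eventually (v := fun _ k => (1 / 2) ^ k) (hb N) (fun _ _ => hgeo)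
      (fun j _ => hcof N j)
  -- Each cut-off equals `1` near `z = 0`, so its deviation from `1` is divisible by every power of
  -- `z`. The first `N` terms thus differ from their monomials by multiples of `z ^ N`.
  have hflat : ∀ k N, ∃ g : ℝ → ℝ, ContDiff ℝ ∞ g ∧ ∀ z, χ (z / ε k) - 1 = z ^ N * g z := by
    intro k N
    refine exists_eq_pow_mul ((hχ.comp (contDiff_id.div_const _)).sub contDiff_const) ?_ N
    have : ∀ᶠ z in 𝓝 (0 : ℝ), z / ε k ∈ Metric.closedBall (0 : ℝ) 1 := by
      have hc : ContinuousAt (fun z : ℝ => z / ε k) 0 := by fun_prop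
      exact hc.eventually_mem (by simpa using Metric.closedBall_mem_nhds (0 : ℝ) one_pos)
    filter_upwards [this] with z hz
    simp only [Function.comp, id]
    rw [χ.one_of_mem_closedBall hz, sub_self]
  choose g hg hgz using hflat
  refine ⟨fun q => ∑' k, b 0 k q, hα 0, fun N => ⟨fun q =>
    (∑ k ∈ Finset.range N, c k q.1 * q.2 ^ k * g k N q.2) + ∑' k, b N k q, ?_, ?_⟩⟩
  · refine ContDiff.add (ContDiff.sum fun k _ => ?_) (hα N)
    exact (((hc k).comp contDiff_fst).mul (contDiff_snd.pow k)).mul ((hg k N).comp contDiff_snd)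
  · intro u z
    have hb0 : ∀ k, b 0 k (u, z) = c k u * z ^ k * χ (z / ε k) := by
      intro k
      have := (hε0 k).ne'
      simp only [b, T, not_lt_zero, if_false, Nat.sub_zero, div_pow]
      field_simp
    have hbN : ∀ k, b 0 (k + N) (u, z) = z ^ N * b N (k + N) (u, z) := by
      intro k
      have := (hε0 (k + N)).ne'
      rw [hb0]
      simp only [b, T, show ¬ (k + N < N) by omega, if_false, Nat.add_sub_cancel, div_pow]
      field_simp
      ring
    have hz : ∑ k ∈ Finset.range N, b N k (u, z) = 0 :=
      Finset.sum_eq_zero fun k hk => by simp [b, Finset.mem_range.1 hk]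
    simp only
    rw [← (hsum 0 (u, z)).sum_add_tsum_nat_add N, ← (hsum N (u, z)).sum_add_tsum_nat_add N, hz,
      zero_add, tsum_congr hbN, tsum_mul_left, mul_add, Finset.mul_sum, ← add_assoc,
      ← Finset.sum_add_distrib]
    congr 1
    refine Finset.sum_congr rfl fun k _ => ?_
    rw [hb0, show χ (z / ε k) = 1 + z ^ N * g k N z by rw [← hgz]; ring]
    ring

/-- A smooth function is flat along the axis `w = 0` if it is divisible by all powers of `w`. -/
def IsFlat (r : ℝ × ℝ → ℝ) : Prop :=
  ContDiff ℝ ∞ r ∧ ∀ N : ℕ, ∃ g : ℝ × ℝ → ℝ, ContDiff ℝ ∞ g ∧ ∀ q, r q = q.2 ^ N * g q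

theorem eq_of_mul_snd_eq {g h : ℝ × ℝ → ℝ} (hg : Continuous g) (hh : Continuous h)
    (H : ∀ q : ℝ × ℝ, q.2 * g q = q.2 * h q) : g = h := by
  have hd : Dense {q : ℝ × ℝ | q.2 ≠ 0} :=
    (dense_compl_singleton (0 : ℝ)).preimage isOpenMap_snd
  exact Continuous.ext_on hd hg hh fun q hq => mul_left_cancel₀ hq (H q)

theorem pdx_pow_mul {g : ℝ × ℝ → ℝ} (hg : ContDiff ℝ ∞ g) (N : ℕ) (q : ℝ × ℝ) :
    pdx (fun q : ℝ × ℝ => q.2 ^ N * g q) q = q.2 ^ N * pdx g q := by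
  have hd := hg.differentiable (by simp) q
  refine pdx_eq (u := q.1) (w := q.2) (by fun_prop) ?_
  exact (hasDerivAt_fst (u := q.1) (w := q.2) hd).const_mul (q.2 ^ N)

theorem pdy_pow_mul {g : ℝ × ℝ → ℝ} (hg : ContDiff ℝ ∞ g) (N : ℕ) (q : ℝ × ℝ) :
    pdy (fun q : ℝ × ℝ => q.2 ^ (N + 1) * g q) q =
      q.2 ^ N * ((N + 1) * g q + q.2 * pdy g q) := by
  have hd := hg.differentiable (by simp) q
  refine pdy_eq (u := q.1) (w := q.2) (by fun_prop) ?_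
  refine ((hasDerivAt_pow (N + 1) q.2).mul (hasDerivAt_snd (u := q.1) (w := q.2) hd)).congr_deriv ?_
  push_cast [Nat.add_sub_cancel]; ring

theorem IsFlat.pdx {r : ℝ × ℝ → ℝ} (hr : IsFlat r) : IsFlat (pdx r) := by
  refine ⟨contDiff_pdx hr.1, fun N => ?_⟩
  obtain ⟨g, hg, h⟩ := hr.2 N
  refine ⟨_, contDiff_pdx hg, fun q => ?_⟩
  rw [funext h, pdx_pow_mul hg]

/-- Divisibility of `r` by `w ^ (N + 1)` gives divisibility of the quotient by `w ^ N`: the factor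
`w` cancels off the axis, and by density everywhere. -/
theorem IsFlat.div {r : ℝ × ℝ → ℝ} (hr : IsFlat r) :
    ∃ r', IsFlat r' ∧ ∀ q, r q = q.2 * r' q := by
  obtain ⟨g, hg, h⟩ := hr.2 1
  refine ⟨g, ⟨hg, fun N => ?_⟩, fun q => by rw [h, pow_one]⟩
  obtain ⟨k, hk, h'⟩ := hr.2 (N + 1)
  refine ⟨k, hk, fun q => congrFun (eq_of_mul_snd_eq (h := fun q => q.2 ^ N * k q) hg.continuous
    ((continuous_snd.pow N).mul hk.continuous) fun q => ?_) q⟩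
  rw [← pow_one q.2, ← h, h']; simp only [pow_one]; ring

theorem IsFlat.pdy {r : ℝ × ℝ → ℝ} (hr : IsFlat r) : IsFlat (pdy r) := by
  refine ⟨contDiff_pdy hr.1, fun N => ?_⟩
  obtain ⟨g, hg, h⟩ := hr.2 (N + 1)
  refine ⟨fun q => (N + 1) * g q + q.2 * Minkowski.pdy g q, ?_, fun q => ?_⟩
  · exact (contDiff_const.mul hg).add (contDiff_snd.mul (contDiff_pdy hg))
  · rw [funext h, pdy_pow_mul hg]

/-- For `z > 0` the chain rule gives `r_w/(2√z) = r'/2`. For `z ≤ 0` the square root is `0` by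
convention, and flatness makes both the function and the claimed derivative vanish there. -/
theorem IsFlat.hasFDerivAt_sqrt {r r' : ℝ × ℝ → ℝ} (hr : IsFlat r) (hr' : IsFlat r')
    (h : ∀ q, Minkowski.pdy r q = q.2 * r' q) (q : ℝ × ℝ) :
    HasFDerivAt (fun q : ℝ × ℝ => r (q.1, √q.2))
      (Minkowski.pdx r (q.1, √q.2) • ContinuousLinearMap.fst ℝ ℝ ℝ +
        (r' (q.1, √q.2) / 2) • ContinuousLinearMap.snd ℝ ℝ ℝ) q := by
  obtain ⟨u, z⟩ := q
  rcases lt_or_ge 0 z with hz | hz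
  · have h1 : HasFDerivAt (fun q : ℝ × ℝ => (q.1, √q.2))
        ((ContinuousLinearMap.fst ℝ ℝ ℝ).prod ((1 / (2 * √z)) • ContinuousLinearMap.snd ℝ ℝ ℝ))
        (u, z) :=
      hasFDerivAt_fst.prodMk ((Real.hasDerivAt_sqrt hz.ne').comp_hasFDerivAt (u, z)
        (hasFDerivAt_snd (p := (u, z))))
    have h2 := (hr.1.differentiable (by simp) (u, √z)).hasFDerivAt.comp (u, z) h1
    refine h2.congr_fderiv ?_
    have := (Real.sqrt_pos.2 hz).ne'
    ext
    · simp [fderiv_apply_eq]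
    · simp [fderiv_apply_eq, h]; field_simp
  · obtain ⟨g, hg, h4⟩ := hr.2 4
    obtain ⟨g', -, h1'⟩ := hr'.2 1
    obtain ⟨g'', -, h1''⟩ := hr.pdx.2 1
    have hs : √z = 0 := Real.sqrt_eq_zero_of_nonpos hz
    have e0 : (Minkowski.pdx r (u, √z) • ContinuousLinearMap.fst ℝ ℝ ℝ +
        (r' (u, √z) / 2) • ContinuousLinearMap.snd ℝ ℝ ℝ) = 0 := by
      rw [h1', h1'']; simp [hs]
    simp only [e0]
    -- Divisibility by the fourth power suffices: `(√z)⁴` is bounded by the square of the distance,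
    -- which is negligible to first order.
    have hb : (fun q : ℝ × ℝ => r (q.1, √q.2)) =O[𝓝 (u, z)] fun q => ‖q - (u, z)‖ ^ 2 := by
      have hc : ContinuousAt (fun q : ℝ × ℝ => g (q.1, √q.2)) (u, z) :=
        (hg.continuous.comp (by fun_prop)).continuousAt
      obtain ⟨C, hC⟩ := (hc.norm.isBoundedUnder_le)
      rw [eventually_map] at hC
      refine Asymptotics.IsBigO.of_bound C ?_
      filter_upwards [hC] with q hq
      rw [h4, norm_mul, mul_comm, norm_pow, norm_pow, norm_norm]
      have hle : ‖√q.2‖ ^ 4 ≤ ‖q - (u, z)‖ ^ 2 := by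
        have h3 : ‖√q.2‖ ^ 2 ≤ ‖q - (u, z)‖ := by
          rw [Real.norm_of_nonneg (Real.sqrt_nonneg _)]
          rcases lt_or_ge 0 q.2 with h | h
          · rw [Real.sq_sqrt h.le]
            refine le_trans ?_ (norm_snd_le _)
            simp only [Prod.snd_sub]
            rw [Real.norm_of_nonneg (by linarith)]; linarith
          · rw [Real.sqrt_eq_zero_of_nonpos h]; simp
        calc ‖√q.2‖ ^ 4 = (‖√q.2‖ ^ 2) ^ 2 := by ring
          _ ≤ _ := pow_le_pow_left₀ (by positivity) h3 2
      exact mul_le_mul hq hle (by positivity) ((norm_nonneg _).trans hq)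
    have h0 : r (u, √z) = 0 := by rw [h4]; simp [hs]
    rw [hasFDerivAt_iff_isLittleO]
    simp only [h0, zero_apply, sub_zero]
    refine hb.trans_isLittleO ?_
    have ht : Tendsto (fun q : ℝ × ℝ => q - (u, z)) (𝓝 (u, z)) (𝓝 0) := by
      have : Continuous fun q : ℝ × ℝ => q - (u, z) := by fun_prop
      simpa using this.tendsto (u, z)
    exact (Asymptotics.isLittleO_norm_pow_id one_lt_two).comp_tendsto ht

/-- The first derivatives are again flat functions evaluated at `(u, √z)`, so smoothness follows by
induction on the order. -/
theorem IsFlat.contDiff_sqrt {r : ℝ × ℝ → ℝ} (hr : IsFlat r) :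
    ContDiff ℝ ∞ (fun q : ℝ × ℝ => r (q.1, √q.2)) := by
  rw [contDiff_infty]
  intro n
  induction n generalizing r with
  | zero => exact contDiff_zero.2 (hr.1.continuous.comp (by fun_prop))
  | succ n ih =>
    obtain ⟨r', hr', h⟩ := hr.pdy.div
    exact contDiff_succ_iff_hasFDerivAt.2 ⟨_, ((ih hr.pdx).smul contDiff_const).add
      (((ih hr').div_const 2).smul contDiff_const), hr.hasFDerivAt_sqrt hr' h⟩

theorem IsFlat.comp_neg {r : ℝ × ℝ → ℝ} (hr : IsFlat r) : IsFlat fun q => r (q.1, -q.2) := by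
  have hn : ContDiff ℝ ∞ fun q : ℝ × ℝ => (q.1, -q.2) := contDiff_fst.prodMk contDiff_snd.neg
  refine ⟨hr.1.comp hn, fun N => ?_⟩
  obtain ⟨g, hg, h⟩ := hr.2 N
  refine ⟨fun q => (-1) ^ N * g (q.1, -q.2), contDiff_const.mul (hg.comp hn), fun q => ?_⟩
  simp only [h]
  rw [neg_pow]; ring

theorem IsFlat.comb {r s : ℝ × ℝ → ℝ} (hr : IsFlat r) (hs : IsFlat s) (a b : ℝ) :
    IsFlat fun q => a * r q + b * s q := by
  refine ⟨(contDiff_const.mul hr.1).add (contDiff_const.mul hs.1), fun N => ?_⟩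
  obtain ⟨g, hg, h⟩ := hr.2 N
  obtain ⟨k, hk, h'⟩ := hs.2 N
  refine ⟨fun q => a * g q + b * k q, (contDiff_const.mul hg).add (contDiff_const.mul hk),
    fun q => ?_⟩
  simp only [h, h']; ring

/-- The even part, and the odd part divided by `w`, are flat and stay smooth after substituting `√z`
for `w`. At `z = w²` this gives values at `|w|`, which parity turns into values at `w`. -/
theorem IsFlat.exists_even_odd {r : ℝ × ℝ → ℝ} (hr : IsFlat r) :
    ∃ a b : ℝ × ℝ → ℝ, ContDiff ℝ ∞ a ∧ ContDiff ℝ ∞ b ∧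
      ∀ u w, r (u, w) = a (u, w ^ 2) + w * b (u, w ^ 2) := by
  have he := hr.comb hr.comp_neg (1 / 2) (1 / 2)
  obtain ⟨s, hs, h⟩ := (hr.comb hr.comp_neg (1 / 2) (-1 / 2)).div
  refine ⟨_, _, he.contDiff_sqrt, hs.contDiff_sqrt, fun u w => ?_⟩
  simp only [Real.sqrt_sq_eq_abs]
  have h2 := h (u, |w|)
  simp only at h2
  rcases le_or_gt 0 w with hw | hw
  · rw [abs_of_nonneg hw] at h2 ⊢
    rw [← h2]; ring
  · rw [abs_of_neg hw] at h2 ⊢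
    simp only [neg_neg] at h2 ⊢
    linear_combination -h2

/-- The iterated remainders of the Taylor expansion of `y` in the second variable. -/
def taylorTail (y : ℝ × ℝ → ℝ) : ℕ → ℝ × ℝ → ℝ
  | 0 => y
  | k + 1 => avg 0 (pdy (taylorTail y k))

theorem contDiff_taylorTail {y : ℝ × ℝ → ℝ} (hy : ContDiff ℝ ∞ y) :
    ∀ k, ContDiff ℝ ∞ (taylorTail y k)
  | 0 => hy
  | k + 1 => contDiff_avg 0 (contDiff_pdy (contDiff_taylorTail hy k))

/-- **Whitney's theorem** with a parameter: a smooth function of `(u, w)` is the sum of a smooth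
function of `(u, w²)` and of `w` times a smooth function of `(u, w²)`. -/
theorem exists_even_odd {y : ℝ × ℝ → ℝ} (hy : ContDiff ℝ ∞ y) {ρ : ℝ → ℝ} (hρ : ContDiff ℝ ∞ ρ)
    (hρs : HasCompactSupport ρ) :
    ∃ a b : ℝ × ℝ → ℝ, ContDiff ℝ ∞ a ∧ ContDiff ℝ ∞ b ∧
      ∀ u w, ρ u * y (u, w) = a (u, w ^ 2) + w * b (u, w ^ 2) := by
  -- The cut-off `ρ` makes the Taylor coefficients compactly supported, as Borel's lemma requires.
  let c : ℕ → ℝ → ℝ := fun k u => ρ u * taylorTail y k (u, 0)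
  have hYs : ∀ k u w, taylorTail y k (u, w) = taylorTail y k (u, 0) + w * taylorTail y (k + 1) (u, w) := fun k u w =>
    eq_axis_add_mul_avg (contDiff_taylorTail hy k) u w
  have hYN : ∀ N u w, ρ u * y (u, w) =
      (∑ k ∈ Finset.range N, c k u * w ^ k) + w ^ N * (ρ u * taylorTail y N (u, w)) := by
    intro N u w
    induction N with
    | zero => simp [taylorTail]
    | succ N ih =>
      rw [ih, Finset.sum_range_succ, hYs N u w]
      simp only [c]; ring
  have hc : ∀ k, ContDiff ℝ ∞ (c k) := fun k =>
    hρ.mul ((contDiff_taylorTail hy k).comp (contDiff_id.prodMk contDiff_const))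
  have hcs : ∀ k, HasCompactSupport (c k) := fun k => hρs.mul_right
  obtain ⟨α, hα, hαN⟩ := exists_contDiff_taylor (fun k => c (2 * k)) (fun k => hc _)
    (fun k => hcs _)
  obtain ⟨β, hβ, hβN⟩ := exists_contDiff_taylor (fun k => c (2 * k + 1)) (fun k => hc _)
    (fun k => hcs _)
  have hsq : ContDiff ℝ ∞ fun q : ℝ × ℝ => (q.1, q.2 ^ 2) :=
    contDiff_fst.prodMk (contDiff_snd.pow 2)
  -- The even and odd Taylor coefficients have been realised by `α(u, w²)` and `w β(u, w²)`.
  -- Expanding to order `2N` leaves a remainder divisible by `w^(2N)`, in particular by `w^N`.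
  have hflat : IsFlat fun q => ρ q.1 * y q - α (q.1, q.2 ^ 2) - q.2 * β (q.1, q.2 ^ 2) := by
    refine ⟨(((hρ.comp contDiff_fst).mul hy).sub (hα.comp hsq)).sub
      (contDiff_snd.mul (hβ.comp hsq)), fun N => ?_⟩
    obtain ⟨αN, hαs, hαe⟩ := hαN N
    obtain ⟨βN, hβs, hβe⟩ := hβN N
    refine ⟨fun q => q.2 ^ N * (ρ q.1 * taylorTail y (2 * N) q - αN (q.1, q.2 ^ 2)
      - q.2 * βN (q.1, q.2 ^ 2)), ?_, ?_⟩
    · exact (contDiff_snd.pow N).mul ((((hρ.comp contDiff_fst).mul (contDiff_taylorTail hy (2 * N))).sub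
        (hαs.comp hsq)).sub (contDiff_snd.mul (hβs.comp hsq)))
    · rintro ⟨u, w⟩
      have hsplit : ∑ k ∈ Finset.range (2 * N), c k u * w ^ k =
          (∑ k ∈ Finset.range N, c (2 * k) u * (w ^ 2) ^ k) +
            w * ∑ k ∈ Finset.range N, c (2 * k + 1) u * (w ^ 2) ^ k := by
        clear hαe hβe
        induction N with
        | zero => simp
        | succ N ih =>
          rw [show 2 * (N + 1) = 2 * N + 1 + 1 by ring, Finset.sum_range_succ,
            Finset.sum_range_succ, ih, Finset.sum_range_succ, Finset.sum_range_succ]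
          ring
      simp only
      rw [hYN (2 * N), hαe, hβe, hsplit]
      ring
  obtain ⟨a, b, ha, hb, hab⟩ := hflat.exists_even_odd
  refine ⟨fun q => α q + a q, fun q => β q + b q, hα.add ha, hβ.add hb, fun u w => ?_⟩
  have := hab u w
  simp only at this
  linear_combination this

end Whitney

/-! ### Local diffeomorphisms and partial derivatives of compositions -/

section LocalDiffeo

variable {E F : Type*} [NormedAddCommGroup E] [NormedSpace ℝ E] [FiniteDimensional ℝ E]
  [NormedAddCommGroup F] [NormedSpace ℝ F] [FiniteDimensional ℝ F]

/-- The smooth inverse function theorem: a smooth map with injective derivative at `p` between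
spaces of the same dimension restricts to a smooth diffeomorphism near `p`. -/
theorem SmoothNear.exists_openPartialHomeomorph {g : E → F} {p : E} (hg : SmoothNear g p)
    (hdim : Module.finrank ℝ E = Module.finrank ℝ F)
    (hinj : ∀ v, fderiv ℝ g p v = 0 → v = 0) {s : Set E} (hs : s ∈ 𝓝 p) :
    ∃ e : OpenPartialHomeomorph E F, p ∈ e.source ∧ e.source ⊆ s ∧ (∀ x, e x = g x) ∧
      ContDiffOn ℝ ∞ e e.source ∧ ContDiffOn ℝ ∞ e.symm e.target := by
  have : CompleteSpace E := FiniteDimensional.complete ℝ E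
  let e₀ : E ≃L[ℝ] F := (LinearMap.linearEquivOfInjective (fderiv ℝ g p : E →ₗ[ℝ] F)
    ((injective_iff_map_eq_zero _).2 hinj) hdim).toContinuousLinearEquiv
  have he₀ : (e₀ : E →L[ℝ] F) = fderiv ℝ g p := by ext x; rfl
  have hd : HasFDerivAt g (e₀ : E →L[ℝ] F) p := by
    rw [he₀]; exact hg.differentiableAt.hasFDerivAt
  let e₁ := hg.contDiffAt.toOpenPartialHomeomorph g hd (by simp)
  have hfd : ContinuousAt (fderiv ℝ g) p :=
    (hg.contDiffAt.fderiv_right (m := ∞) (by simp)).continuousAt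
  -- The inverse is to be smooth on its whole domain, so both smoothness and invertibility of the
  -- derivative are secured at every point of a neighbourhood, not only at `p`.
  have hev : ∀ᶠ x in 𝓝 p, x ∈ s ∧ ContDiffAt ℝ ∞ g x ∧
      fderiv ℝ g x ∈ range ((↑) : (E ≃L[ℝ] F) → E →L[ℝ] F) := by
    refine (eventually_mem_set.2 hs).and (hg.and (hfd.eventually_mem ?_))
    rw [← he₀]; exact ContinuousLinearEquiv.nhds e₀
  obtain ⟨V, hV, hVo, hpV⟩ := eventually_nhds_iff.1 hev
  have hp : p ∈ e₁.source := hg.contDiffAt.mem_toOpenPartialHomeomorph_source hd (by simp)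
  let e := e₁.restrOpen V hVo
  have hge : ∀ x, e x = g x := fun x => rfl
  refine ⟨e, ⟨hp, hpV⟩, fun x hx => (hV x hx.2).1, hge, fun x hx => ?_, fun y hy => ?_⟩
  · exact (hV x hx.2).2.1.contDiffWithinAt
  · have hx := e.map_target hy
    obtain ⟨-, h1, e', he'⟩ := hV _ hx.2
    refine (e.contDiffAt_symm hy (f₀' := e') ?_ h1).contDiffWithinAt
    rw [he']
    exact (h1.differentiableAt (by simp)).hasFDerivAt

end LocalDiffeo

section Partial

variable {F : Type*} [NormedAddCommGroup F] [NormedSpace ℝ F]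

theorem SmoothNear.pdx {g : ℝ × ℝ → F} {q : ℝ × ℝ} (h : SmoothNear g q) :
    SmoothNear (pdx g) q := by
  filter_upwards [h] with x hx
  exact (hx.fderiv_right (m := ∞) (by simp)).clm_apply contDiffAt_const

theorem SmoothNear.pdy {g : ℝ × ℝ → F} {q : ℝ × ℝ} (h : SmoothNear g q) :
    SmoothNear (pdy g) q := by
  filter_upwards [h] with x hx
  exact (hx.fderiv_right (m := ∞) (by simp)).clm_apply contDiffAt_const

theorem pdx_congr {g h : ℝ × ℝ → F} {q : ℝ × ℝ} (e : g =ᶠ[𝓝 q] h) : pdx g =ᶠ[𝓝 q] pdx h := by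
  filter_upwards [e.fderiv (𝕜 := ℝ)] with x hx using by rw [pdx, hx]; rfl

theorem pdy_congr {g h : ℝ × ℝ → F} {q : ℝ × ℝ} (e : g =ᶠ[𝓝 q] h) : pdy g =ᶠ[𝓝 q] pdy h := by
  filter_upwards [e.fderiv (𝕜 := ℝ)] with x hx using by rw [pdy, hx]; rfl

theorem pdx_pdy_comm {g : ℝ × ℝ → F} {q : ℝ × ℝ} (h : SmoothNear g q) :
    pdx (pdy g) q = pdy (pdx g) q := by
  have hd : DifferentiableAt ℝ (fderiv ℝ g) q :=
    (h.contDiffAt.fderiv_right (m := ∞) (by simp)).differentiableAt (by simp)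
  have hs := h.contDiffAt.isSymmSndFDerivAt
    (by simpa using WithTop.coe_le_coe.2 (le_top : (2 : ℕ∞) ≤ ⊤))
    ((1 : ℝ), (0 : ℝ)) ((0 : ℝ), (1 : ℝ))
  have h1 : ∀ v w : ℝ × ℝ, fderiv ℝ (fun x => fderiv ℝ g x v) q w =
      fderiv ℝ (fderiv ℝ g) q w v := by
    intro v w
    rw [fderiv_clm_apply hd (differentiableAt_const v)]
    simp
  rw [Minkowski.pdx, Minkowski.pdy]
  exact (h1 _ _).trans (hs.trans (h1 _ _).symm)

theorem pdx_comp {h : ℝ × ℝ → F} {φ : ℝ × ℝ → ℝ × ℝ} {q : ℝ × ℝ}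
    (hh : DifferentiableAt ℝ h (φ q)) (hφ : DifferentiableAt ℝ φ q) :
    pdx (fun x => h (φ x)) q = (pdx φ q).1 • pdx h (φ q) + (pdx φ q).2 • pdy h (φ q) := by
  rw [pdx, fderiv_fun_comp q hh hφ, ContinuousLinearMap.comp_apply, fderiv_apply_eq]; rfl

theorem pdy_comp {h : ℝ × ℝ → F} {φ : ℝ × ℝ → ℝ × ℝ} {q : ℝ × ℝ}
    (hh : DifferentiableAt ℝ h (φ q)) (hφ : DifferentiableAt ℝ φ q) :
    pdy (fun x => h (φ x)) q = (pdy φ q).1 • pdx h (φ q) + (pdy φ q).2 • pdy h (φ q) := by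
  rw [pdy, fderiv_fun_comp q hh hφ, ContinuousLinearMap.comp_apply, fderiv_apply_eq]; rfl

theorem pdx_smul {a : ℝ × ℝ → ℝ} {g : ℝ × ℝ → F} {q : ℝ × ℝ} (ha : DifferentiableAt ℝ a q)
    (hg : DifferentiableAt ℝ g q) :
    pdx (fun x => a x • g x) q = a q • pdx g q + pdx a q • g q := by
  rw [pdx, fderiv_fun_smul ha hg]; rfl

theorem pdy_smul {a : ℝ × ℝ → ℝ} {g : ℝ × ℝ → F} {q : ℝ × ℝ} (ha : DifferentiableAt ℝ a q)
    (hg : DifferentiableAt ℝ g q) :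
    pdy (fun x => a x • g x) q = a q • pdy g q + pdy a q • g q := by
  rw [pdy, fderiv_fun_smul ha hg]; rfl

theorem pdx_add {g h : ℝ × ℝ → F} {q : ℝ × ℝ} (hg : DifferentiableAt ℝ g q)
    (hh : DifferentiableAt ℝ h q) : pdx (fun x => g x + h x) q = pdx g q + pdx h q := by
  rw [pdx, fderiv_fun_add hg hh]; rfl

theorem pdy_add {g h : ℝ × ℝ → F} {q : ℝ × ℝ} (hg : DifferentiableAt ℝ g q)
    (hh : DifferentiableAt ℝ h q) : pdy (fun x => g x + h x) q = pdy g q + pdy h q := by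
  rw [pdy, fderiv_fun_add hg hh]; rfl

end Partial

/-! ### The fundamental forms under a change of coordinates -/

theorem det3_eq (a b c : Vec3) : det3 a b c = a 0 * (b 1 * c 2 - b 2 * c 1)
    - a 1 * (b 0 * c 2 - b 2 * c 0) + a 2 * (b 0 * c 1 - b 1 * c 0) := by
  simp [det3, Matrix.det_fin_three]; ring

theorem linner_normalL (f : ℝ × ℝ → Vec3) (q : ℝ × ℝ) :
    linner (normalL f q) (normalL f q) = -deltaL f q := by
  simp [normalL, linner, lcross, deltaL, coeffE, coeffF, coeffG, crossProduct]; ring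

theorem isSpacelikeAt_iff {f : ℝ × ℝ → Vec3} {q : ℝ × ℝ} : IsSpacelikeAt f q ↔ 0 < deltaL f q := by
  rw [IsSpacelikeAt, linner_normalL, neg_lt_zero]

theorem isTimelikeAt_iff {f : ℝ × ℝ → Vec3} {q : ℝ × ℝ} : IsTimelikeAt f q ↔ deltaL f q < 0 := by
  rw [IsTimelikeAt, linner_normalL, neg_pos]

section Change

variable {f : ℝ × ℝ → Vec3} {φ : ℝ × ℝ → ℝ × ℝ} {q : ℝ × ℝ}

theorem dS_comp (hf : DifferentiableAt ℝ f (φ q)) (hφ : DifferentiableAt ℝ φ q) :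
    dS (fun x => f (φ x)) q = (pdx φ q).1 • dS f (φ q) + (pdx φ q).2 • dT f (φ q) :=
  pdx_comp hf hφ

theorem dT_comp (hf : DifferentiableAt ℝ f (φ q)) (hφ : DifferentiableAt ℝ φ q) :
    dT (fun x => f (φ x)) q = (pdy φ q).1 • dS f (φ q) + (pdy φ q).2 • dT f (φ q) :=
  pdy_comp hf hφ

theorem dS_comp_eventually (hf : SmoothNear f (φ q)) (hφ : SmoothNear φ q) :
    dS (fun x => f (φ x)) =ᶠ[𝓝 q]
      fun x => (pdx φ x).1 • dS f (φ x) + (pdx φ x).2 • dT f (φ x) := by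
  filter_upwards [hφ.continuousAt.eventually hf, hφ] with x h1 h2
  exact dS_comp (h1.differentiableAt (by simp)) (h2.differentiableAt (by simp))

theorem dT_comp_eventually (hf : SmoothNear f (φ q)) (hφ : SmoothNear φ q) :
    dT (fun x => f (φ x)) =ᶠ[𝓝 q]
      fun x => (pdy φ x).1 • dS f (φ x) + (pdy φ x).2 • dT f (φ x) := by
  filter_upwards [hφ.continuousAt.eventually hf, hφ] with x h1 h2
  exact dT_comp (h1.differentiableAt (by simp)) (h2.differentiableAt (by simp))

theorem differentiableAt_comp_dS (hf : SmoothNear f (φ q)) (hφ : SmoothNear φ q) :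
    DifferentiableAt ℝ (fun x => dS f (φ x)) q ∧ DifferentiableAt ℝ (fun x => dT f (φ x)) q :=
  ⟨(SmoothNear.comp (g := dS f) hf.pdx hφ).differentiableAt,
    (SmoothNear.comp (g := dT f) hf.pdy hφ).differentiableAt⟩

theorem dT_dS_comm (hf : SmoothNear f q) : dS (dT f) q = dT (dS f) q := pdx_pdy_comm hf

/-- The coefficients of `f_s` and `f_t` may stay anonymous: these vectors are annihilated in the
determinants defining the second fundamental matrix. -/
theorem dS_dS_comp (hf : SmoothNear f (φ q)) (hφ : SmoothNear φ q) :
    ∃ α β : ℝ, dS (dS fun x => f (φ x)) q = α • dS f (φ q) + β • dT f (φ q)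
      + (pdx φ q).1 ^ 2 • dS (dS f) (φ q) + (2 * (pdx φ q).1 * (pdx φ q).2) • dT (dS f) (φ q)
      + (pdx φ q).2 ^ 2 • dT (dT f) (φ q) := by
  have ha := hφ.pdx.differentiableAt.fst
  have hb := hφ.pdx.differentiableAt.snd
  obtain ⟨h1, h2⟩ := differentiableAt_comp_dS hf hφ
  refine ⟨pdx (fun x => (pdx φ x).1) q, pdx (fun x => (pdx φ x).2) q, ?_⟩
  rw [show dS (dS fun x => f (φ x)) q = pdx (fun x => (pdx φ x).1 • dS f (φ x)
    + (pdx φ x).2 • dT f (φ x)) q from (pdx_congr (dS_comp_eventually hf hφ)).eq_of_nhds,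
    pdx_add (ha.fun_smul h1) (hb.fun_smul h2), pdx_smul ha h1, pdx_smul hb h2,
    show pdx (fun x => dS f (φ x)) q = _ from dS_comp hf.pdx.differentiableAt hφ.differentiableAt,
    show pdx (fun x => dT f (φ x)) q = _ from dS_comp hf.pdy.differentiableAt hφ.differentiableAt]
  rw [dT_dS_comm hf]
  module

theorem dT_dS_comp (hf : SmoothNear f (φ q)) (hφ : SmoothNear φ q) :
    ∃ α β : ℝ, dT (dS fun x => f (φ x)) q = α • dS f (φ q) + β • dT f (φ q)
      + ((pdx φ q).1 * (pdy φ q).1) • dS (dS f) (φ q)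
      + ((pdx φ q).1 * (pdy φ q).2 + (pdx φ q).2 * (pdy φ q).1) • dT (dS f) (φ q)
      + ((pdx φ q).2 * (pdy φ q).2) • dT (dT f) (φ q) := by
  have ha := hφ.pdx.differentiableAt.fst
  have hb := hφ.pdx.differentiableAt.snd
  obtain ⟨h1, h2⟩ := differentiableAt_comp_dS hf hφ
  refine ⟨pdy (fun x => (pdx φ x).1) q, pdy (fun x => (pdx φ x).2) q, ?_⟩
  rw [show dT (dS fun x => f (φ x)) q = pdy (fun x => (pdx φ x).1 • dS f (φ x)
    + (pdx φ x).2 • dT f (φ x)) q from (pdy_congr (dS_comp_eventually hf hφ)).eq_of_nhds,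
    pdy_add (ha.fun_smul h1) (hb.fun_smul h2), pdy_smul ha h1, pdy_smul hb h2,
    show pdy (fun x => dS f (φ x)) q = _ from dT_comp hf.pdx.differentiableAt hφ.differentiableAt,
    show pdy (fun x => dT f (φ x)) q = _ from dT_comp hf.pdy.differentiableAt hφ.differentiableAt]
  rw [dT_dS_comm hf]
  module

/-- Here the coefficients are explicit, because on the singular axis this formula is solved for
`f_tt` and compared with linear independence. -/
theorem dT_dT_comp (hf : SmoothNear f (φ q)) (hφ : SmoothNear φ q) :
    dT (dT fun x => f (φ x)) q = pdy (fun x => (pdy φ x).1) q • dS f (φ q)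
      + pdy (fun x => (pdy φ x).2) q • dT f (φ q)
      + (pdy φ q).1 ^ 2 • dS (dS f) (φ q) + (2 * (pdy φ q).1 * (pdy φ q).2) • dT (dS f) (φ q)
      + (pdy φ q).2 ^ 2 • dT (dT f) (φ q) := by
  have ha := hφ.pdy.differentiableAt.fst
  have hb := hφ.pdy.differentiableAt.snd
  obtain ⟨h1, h2⟩ := differentiableAt_comp_dS hf hφ
  rw [show dT (dT fun x => f (φ x)) q = pdy (fun x => (pdy φ x).1 • dS f (φ x)
    + (pdy φ x).2 • dT f (φ x)) q from (pdy_congr (dT_comp_eventually hf hφ)).eq_of_nhds,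
    pdy_add (ha.fun_smul h1) (hb.fun_smul h2), pdy_smul ha h1, pdy_smul hb h2,
    show pdy (fun x => dS f (φ x)) q = _ from dT_comp hf.pdx.differentiableAt hφ.differentiableAt,
    show pdy (fun x => dT f (φ x)) q = _ from dT_comp hf.pdy.differentiableAt hφ.differentiableAt]
  rw [dT_dS_comm hf]
  module

/-- The Jacobian determinant. -/
def jac (φ : ℝ × ℝ → ℝ × ℝ) (q : ℝ × ℝ) : ℝ :=
  (pdx φ q).1 * (pdy φ q).2 - (pdx φ q).2 * (pdy φ q).1

theorem coeffE_comp (hf : SmoothNear f (φ q)) (hφ : SmoothNear φ q) :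
    coeffE (fun x => f (φ x)) q = (pdx φ q).1 ^ 2 * coeffE f (φ q)
      + 2 * (pdx φ q).1 * (pdx φ q).2 * coeffF f (φ q) + (pdx φ q).2 ^ 2 * coeffG f (φ q) := by
  rw [coeffE, dS_comp hf.differentiableAt hφ.differentiableAt]
  simp [linner, coeffE, coeffF, coeffG]; ring

theorem coeffF_comp (hf : SmoothNear f (φ q)) (hφ : SmoothNear φ q) :
    coeffF (fun x => f (φ x)) q = (pdx φ q).1 * (pdy φ q).1 * coeffE f (φ q)
      + ((pdx φ q).1 * (pdy φ q).2 + (pdx φ q).2 * (pdy φ q).1) * coeffF f (φ q)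
      + (pdx φ q).2 * (pdy φ q).2 * coeffG f (φ q) := by
  rw [coeffF, dS_comp hf.differentiableAt hφ.differentiableAt,
    dT_comp hf.differentiableAt hφ.differentiableAt]
  simp [linner, coeffE, coeffF, coeffG]; ring

theorem coeffG_comp (hf : SmoothNear f (φ q)) (hφ : SmoothNear φ q) :
    coeffG (fun x => f (φ x)) q = (pdy φ q).1 ^ 2 * coeffE f (φ q)
      + 2 * (pdy φ q).1 * (pdy φ q).2 * coeffF f (φ q) + (pdy φ q).2 ^ 2 * coeffG f (φ q) := by
  rw [coeffG, dT_comp hf.differentiableAt hφ.differentiableAt]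
  simp [linner, coeffE, coeffF, coeffG]; ring

theorem tildeL_comp (hf : SmoothNear f (φ q)) (hφ : SmoothNear φ q) :
    tildeL (fun x => f (φ x)) q = jac φ q * ((pdx φ q).1 ^ 2 * tildeL f (φ q)
      + 2 * (pdx φ q).1 * (pdx φ q).2 * tildeM f (φ q) + (pdx φ q).2 ^ 2 * tildeN f (φ q)) := by
  obtain ⟨α, β, h⟩ := dS_dS_comp hf hφ
  rw [tildeL, h, dS_comp hf.differentiableAt hφ.differentiableAt,
    dT_comp hf.differentiableAt hφ.differentiableAt]
  simp only [det3_eq, tildeL, tildeM, tildeN, jac, Pi.add_apply, Pi.smul_apply, smul_eq_mul]; ring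

theorem tildeM_comp (hf : SmoothNear f (φ q)) (hφ : SmoothNear φ q) :
    tildeM (fun x => f (φ x)) q = jac φ q * ((pdx φ q).1 * (pdy φ q).1 * tildeL f (φ q)
      + ((pdx φ q).1 * (pdy φ q).2 + (pdx φ q).2 * (pdy φ q).1) * tildeM f (φ q)
      + (pdx φ q).2 * (pdy φ q).2 * tildeN f (φ q)) := by
  obtain ⟨α, β, h⟩ := dT_dS_comp hf hφ
  rw [tildeM, h, dS_comp hf.differentiableAt hφ.differentiableAt,
    dT_comp hf.differentiableAt hφ.differentiableAt]
  simp only [det3_eq, tildeL, tildeM, tildeN, jac, Pi.add_apply, Pi.smul_apply, smul_eq_mul]; ring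

theorem tildeN_comp (hf : SmoothNear f (φ q)) (hφ : SmoothNear φ q) :
    tildeN (fun x => f (φ x)) q = jac φ q * ((pdy φ q).1 ^ 2 * tildeL f (φ q)
      + 2 * (pdy φ q).1 * (pdy φ q).2 * tildeM f (φ q) + (pdy φ q).2 ^ 2 * tildeN f (φ q)) := by
  have h := dT_dT_comp hf hφ
  rw [tildeN, h, dS_comp hf.differentiableAt hφ.differentiableAt,
    dT_comp hf.differentiableAt hφ.differentiableAt]
  simp only [det3_eq, tildeL, tildeM, tildeN, jac, Pi.add_apply, Pi.smul_apply, smul_eq_mul]; ring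

/-- The numerator of the mean curvature. -/
def meanNum (f : ℝ × ℝ → Vec3) (q : ℝ × ℝ) : ℝ :=
  coeffG f q * tildeL f q - 2 * coeffF f q * tildeM f q + coeffE f q * tildeN f q

/-- The determinant of the second fundamental matrix (not normalized). -/
def detNum (f : ℝ × ℝ → Vec3) (q : ℝ × ℝ) : ℝ := tildeL f q * tildeN f q - tildeM f q ^ 2

/-- With `P` the Jacobian matrix, the first fundamental matrix becomes `PᵀIP`, whereas the
unnormalised second one becomes `det P · PᵀIIP`. This accounts for the weights `2`, `3` and `4` of
the discriminant, the mean curvature numerator and the second determinant. -/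
theorem deltaL_comp (hf : SmoothNear f (φ q)) (hφ : SmoothNear φ q) :
    deltaL (fun x => f (φ x)) q = jac φ q ^ 2 * deltaL f (φ q) := by
  rw [deltaL, coeffE_comp hf hφ, coeffF_comp hf hφ, coeffG_comp hf hφ]
  simp only [deltaL, jac]; ring

theorem meanNum_comp (hf : SmoothNear f (φ q)) (hφ : SmoothNear φ q) :
    meanNum (fun x => f (φ x)) q = jac φ q ^ 3 * meanNum f (φ q) := by
  rw [meanNum, coeffE_comp hf hφ, coeffF_comp hf hφ, coeffG_comp hf hφ, tildeL_comp hf hφ,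
    tildeM_comp hf hφ, tildeN_comp hf hφ]
  simp only [meanNum, jac]; ring

theorem detNum_comp (hf : SmoothNear f (φ q)) (hφ : SmoothNear φ q) :
    detNum (fun x => f (φ x)) q = jac φ q ^ 4 * detNum f (φ q) := by
  rw [detNum, tildeL_comp hf hφ, tildeM_comp hf hφ, tildeN_comp hf hφ]
  simp only [detNum, jac]; ring

end Change

/-! ### The Weingarten matrix -/

section Weingarten

variable {f : ℝ × ℝ → Vec3} {q : ℝ × ℝ}

/-- The inverse is written as adjugate over determinant. No hypothesis on `Δ` is needed: where it
vanishes, both sides are zero by the conventions for inverses. -/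
theorem weingarten_eq (f : ℝ × ℝ → Vec3) (q : ℝ × ℝ) :
    weingarten f q = (deltaL f q * √|deltaL f q|)⁻¹ •
      !![coeffG f q * tildeL f q - coeffF f q * tildeM f q,
         coeffG f q * tildeM f q - coeffF f q * tildeN f q;
         coeffE f q * tildeM f q - coeffF f q * tildeL f q,
         coeffE f q * tildeN f q - coeffF f q * tildeM f q] := by
  have hdet : Matrix.det !![coeffE f q, coeffF f q; coeffF f q, coeffG f q] = deltaL f q := by
    rw [Matrix.det_fin_two_of, deltaL]; ring
  rw [weingarten, Matrix.inv_def, hdet, Ring.inverse_eq_inv', Matrix.adjugate_fin_two_of]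
  ext i j
  fin_cases i <;> fin_cases j <;>
    simp [Matrix.mul_apply, Fin.sum_univ_two] <;> ring

theorem weingarten_trace (f : ℝ × ℝ → Vec3) (q : ℝ × ℝ) :
    (weingarten f q).trace = meanNum f q / (deltaL f q * √|deltaL f q|) := by
  rw [weingarten_eq f q, Matrix.trace_smul, Matrix.trace_fin_two_of, meanNum, smul_eq_mul,
    div_eq_inv_mul]
  ring

theorem weingarten_det (h : deltaL f q ≠ 0) :
    (weingarten f q).det = detNum f q / (deltaL f q * |deltaL f q|) := by
  have h1 : √|deltaL f q| ^ 2 = |deltaL f q| := Real.sq_sqrt (abs_nonneg _)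
  have h2 : |deltaL f q| ≠ 0 := abs_ne_zero.2 h
  rw [weingarten_eq f q, Matrix.det_smul, Matrix.det_fin_two_of, Fintype.card_fin, inv_pow, mul_pow,
    h1]
  have h3 : coeffE f q * coeffG f q - coeffF f q ^ 2 = deltaL f q := rfl
  field_simp
  rw [detNum, ← h3]; ring

theorem mem_principalCurvatures {k : ℂ} : k ∈ principalCurvatures f q ↔
    k ^ 2 - ((weingarten f q).trace : ℂ) * k + ((weingarten f q).det : ℂ) = 0 := by
  rw [principalCurvatures, Polynomial.mem_roots (Matrix.charpoly_monic _).ne_zero,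
    Matrix.charpoly_fin_two]
  simp [Polynomial.IsRoot, Matrix.trace_fin_two, Matrix.det_fin_two]

/-- Vieta's formulas over the algebraically closed field, where the characteristic polynomial
splits. -/
theorem principalCurvatures_pair {k₁ k₂ : ℂ} (h : principalCurvatures f q = {k₁, k₂}) :
    k₁ + k₂ = ((weingarten f q).trace : ℂ) ∧ k₁ * k₂ = ((weingarten f q).det : ℂ) := by
  have hs := IsAlgClosed.splits ((weingarten f q).map (algebraMap ℝ ℂ)).charpoly
  have h1 := Matrix.trace_eq_sum_roots_charpoly ((weingarten f q).map (algebraMap ℝ ℂ))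
  have h2 := Matrix.det_eq_prod_roots_charpoly ((weingarten f q).map (algebraMap ℝ ℂ))
  rw [← principalCurvatures, h] at h1 h2
  constructor
  · simp [Matrix.trace_fin_two] at h1 ⊢; exact h1.symm
  · simp [Matrix.det_fin_two] at h2 ⊢; exact h2.symm

/-- A diagonal matrix with equal eigenvalues is scalar, so the two fundamental matrices are
proportional. In this division-free form umbilicity can be moved between coordinate systems. -/
theorem IsUmbilic.eq_zero (h : IsUmbilic f q) :
    coeffF f q * tildeN f q - coeffG f q * tildeM f q = 0 ∧
    coeffE f q * tildeM f q - coeffF f q * tildeL f q = 0 ∧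
    coeffE f q * tildeN f q - coeffG f q * tildeL f q = 0 := by
  obtain ⟨hc, ⟨k, hk⟩, hd⟩ := h
  have hΔ : deltaL f q ≠ 0 := by
    rcases hc with h | h
    · exact (isSpacelikeAt_iff.1 h).ne'
    · exact (isTimelikeAt_iff.1 h).ne
  have hW := weingarten_eq f q
  have h01 : weingarten f q 0 1 = 0 := hd (by decide)
  have h10 : weingarten f q 1 0 = 0 := hd (by decide)
  obtain ⟨h1, h2⟩ := principalCurvatures_pair hk
  have h3 : weingarten f q 0 0 = weingarten f q 1 1 := by
    rw [Matrix.trace_fin_two] at h1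
    rw [Matrix.det_fin_two, h01, zero_mul, sub_zero] at h2
    -- For a diagonal matrix the discriminant of the characteristic polynomial is the square of the
    -- difference of the diagonal entries.
    have h4 : ((weingarten f q 0 0 - weingarten f q 1 1 : ℝ) : ℂ) ^ 2 = 0 := by
      push_cast at h1 h2 ⊢
      linear_combination (-(k + k) - (weingarten f q 0 0 + weingarten f q 1 1)) * h1 + 4 * h2
    have h5 := pow_eq_zero_iff (two_ne_zero) |>.1 h4
    exact sub_eq_zero.1 (by exact_mod_cast h5)
  rw [hW] at h01 h10 h3
  simp [hΔ] at h01 h10 h3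
  exact ⟨by linarith, h10, by linarith⟩

end Weingarten

/-! ### The moving frame along a curve of type `L` -/

/-- The vector with coordinates `a`, `b`, `c` in the frame consisting of the horizontal part of the
velocity, the left-ward normal and the vertical part of the velocity. -/
def frame (f : ℝ × ℝ → Vec3) (u a b c : ℝ) : Vec3 :=
  ![a * vel f u 0 - b * vel f u 1, a * vel f u 1 + b * vel f u 0, c * vel f u 2]

theorem frame_eq (f : ℝ × ℝ → Vec3) (u b c : ℝ) :
    frame f u 0 b c = b • leftNormal f u + c • verticalPart f u := by
  ext i; fin_cases i <;> simp [frame, leftNormal, verticalPart]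

theorem frame_add (f : ℝ × ℝ → Vec3) (u a b c a' b' c' : ℝ) :
    frame f u a b c + frame f u a' b' c' = frame f u (a + a') (b + b') (c + c') := by
  ext i; fin_cases i <;> simp [frame] <;> ring

theorem frame_smul (f : ℝ × ℝ → Vec3) (u a b c k : ℝ) :
    k • frame f u a b c = frame f u (k * a) (k * b) (k * c) := by
  ext i; fin_cases i <;> simp [frame] <;> ring

theorem vel_eq_frame (f : ℝ × ℝ → Vec3) (u : ℝ) : vel f u = frame f u 1 0 1 := by
  ext i; fin_cases i <;> simp [frame]

section Edge

variable {I : Set ℝ} {δ : ℝ} {f : ℝ × ℝ → Vec3} {u : ℝ}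

theorem linner_frame (h : vel f u 0 ^ 2 + vel f u 1 ^ 2 = 1) (h2 : vel f u 2 ^ 2 = 1)
    (a b c a' b' c' : ℝ) :
    linner (frame f u a b c) (frame f u a' b' c') = a * a' + b * b' - c * c' := by
  simp only [linner, frame, Matrix.cons_val]
  linear_combination (a * a' + b * b') * h - c * c' * h2

theorem dot_frame (h : vel f u 0 ^ 2 + vel f u 1 ^ 2 = 1) (h2 : vel f u 2 ^ 2 = 1)
    (a b c a' b' c' : ℝ) :
    (frame f u a b c) ⬝ᵥ (frame f u a' b' c') = a * a' + b * b' + c * c' := by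
  simp only [Matrix.vec3_dotProduct, frame, Matrix.cons_val]
  linear_combination (a * a' + b * b') * h + c * c' * h2

/-- The horizontal vectors of the frame are orthonormal and positively oriented, so its determinant
is the vertical component of `Γ'`. -/
theorem det3_frame (h : vel f u 0 ^ 2 + vel f u 1 ^ 2 = 1)
    (a b c a' b' c' a'' b'' c'' : ℝ) :
    det3 (frame f u a b c) (frame f u a' b' c') (frame f u a'' b'' c'') =
      vel f u 2 * (a * (b' * c'' - c' * b'') - b * (a' * c'' - c' * a'')
        + c * (a' * b'' - b' * a'')) := by
  simp only [det3_eq, frame, Matrix.cons_val]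
  linear_combination (vel f u 2 * (a * (b' * c'' - c' * b'') - b * (a' * c'' - c' * a'')
        + c * (a' * b'' - b' * a''))) * h

theorem frame_eq_zero (h : vel f u 0 ^ 2 + vel f u 1 ^ 2 = 1) (h2 : vel f u 2 ^ 2 = 1)
    {a b c : ℝ} (h0 : frame f u a b c = 0) : a = 0 ∧ b = 0 ∧ c = 0 := by
  have e := dot_frame h h2 a b c a b c
  rw [h0, zero_dotProduct] at e
  exact ⟨by nlinarith [sq_nonneg a, sq_nonneg b, sq_nonneg c],
    by nlinarith [sq_nonneg a, sq_nonneg b, sq_nonneg c],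
    by nlinarith [sq_nonneg a, sq_nonneg b, sq_nonneg c]⟩

theorem edgeDomain_mem_nhds (hI : IsOpen I) {q : ℝ × ℝ} (hq : q ∈ edgeDomain I δ) :
    edgeDomain I δ ∈ 𝓝 q := (hI.prod isOpen_Ioo).mem_nhds hq

theorem axis_mem (hδ : 0 < δ) (hu : u ∈ I) : (u, (0 : ℝ)) ∈ edgeDomain I δ :=
  ⟨hu, by simp [hδ]⟩

theorem smoothNear_edge (hI : IsOpen I) (hf : IsOrderFourEdge I δ f) {q : ℝ × ℝ}
    (hq : q ∈ edgeDomain I δ) : SmoothNear f q :=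
  SmoothNear.of_contDiffOn hf.edge.smooth (edgeDomain_mem_nhds hI hq)

theorem smoothNear_axis {g : ℝ × ℝ → Vec3} (hg : SmoothNear g (u, 0)) :
    SmoothNear (fun s => g (s, 0)) u :=
  SmoothNear.comp (h := fun s : ℝ => (s, (0 : ℝ))) hg
    (ContDiff.smoothNear (contDiff_id.prodMk contDiff_const) u)

theorem smoothNear_edgeCurve (hI : IsOpen I) (hδ : 0 < δ) (hf : IsOrderFourEdge I δ f)
    (hu : u ∈ I) : SmoothNear (edgeCurve f) u :=
  smoothNear_axis (smoothNear_edge hI hf (axis_mem hδ hu))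

theorem SmoothNear.deriv {F : Type*} [NormedAddCommGroup F] [NormedSpace ℝ F] {g : ℝ → F} {x : ℝ}
    (h : SmoothNear g x) : SmoothNear (deriv g) x := by
  filter_upwards [h] with y hy
  exact (hy.fderiv_right (m := ∞) (by simp)).clm_apply contDiffAt_const

theorem smoothNear_vel (hI : IsOpen I) (hδ : 0 < δ) (hf : IsOrderFourEdge I δ f)
    (hu : u ∈ I) : SmoothNear (vel f) u := (smoothNear_edgeCurve hI hδ hf hu).deriv

theorem hasDerivAt_edgeCurve (hI : IsOpen I) (hδ : 0 < δ) (hf : IsOrderFourEdge I δ f)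
    (hu : u ∈ I) : HasDerivAt (edgeCurve f) (vel f u) u :=
  (smoothNear_edgeCurve hI hδ hf hu).differentiableAt.hasDerivAt

theorem hasDerivAt_vel (hI : IsOpen I) (hδ : 0 < δ) (hf : IsOrderFourEdge I δ f)
    (hu : u ∈ I) : HasDerivAt (vel f) (acc f u) u :=
  (smoothNear_vel hI hδ hf hu).differentiableAt.hasDerivAt

theorem vel_vertical_sq (hf : IsOrderFourEdge I δ f) (harc : IsArcLengthProjection I f)
    (hu : u ∈ I) : vel f u 2 ^ 2 = 1 := by
  have h1 := (hf.typeL u hu).2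
  have h2 := harc u hu
  simp only [linner] at h1
  nlinarith

theorem acc_vertical (hI : IsOpen I) (hδ : 0 < δ) (hf : IsOrderFourEdge I δ f)
    (harc : IsArcLengthProjection I f) (hu : u ∈ I) : acc f u 2 = 0 := by
  have h := hasDerivAt_pi.1 (hasDerivAt_vel hI hδ hf hu) 2
  have h1 := h.fun_pow 2
  have h2 : (fun s => vel f s 2 ^ 2) =ᶠ[𝓝 u] fun _ => 1 := by
    filter_upwards [hI.mem_nhds hu] with s hs using vel_vertical_sq hf harc hs
  have h3 := h1.unique ((hasDerivAt_const u (1 : ℝ)).congr_of_eventuallyEq h2)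
  have h4 := vel_vertical_sq hf harc hu
  have h5 : vel f u 2 ≠ 0 := fun h => by simp [h] at h4
  simpa [h5] using h3

/-- Differentiating `|γ'|² = 1` shows that `γ''` is a multiple of `n`; the vertical velocity has
square `1` on an open set and hence zero derivative. -/
theorem acc_eq_frame (hI : IsOpen I) (hδ : 0 < δ) (hf : IsOrderFourEdge I δ f)
    (harc : IsArcLengthProjection I f) (hu : u ∈ I) :
    acc f u = frame f u 0 (planeCurvature f u) 0 := by
  have h := hasDerivAt_pi.1 (hasDerivAt_vel hI hδ hf hu)
  have h1 := ((h 0).fun_pow 2).add ((h 1).fun_pow 2)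
  have h2 : (fun s => vel f s 0 ^ 2 + vel f s 1 ^ 2) =ᶠ[𝓝 u] fun _ => 1 := by
    filter_upwards [hI.mem_nhds hu] with s hs using harc s hs
  have h3 := h1.unique ((hasDerivAt_const u (1 : ℝ)).congr_of_eventuallyEq h2)
  simp only [Nat.cast_ofNat, Nat.add_one_sub_one, pow_one] at h3
  have h4 := harc u hu
  ext i
  fin_cases i
  · simp [frame, planeCurvature]; linear_combination vel f u 0 / 2 * h3 - acc f u 0 * h4
  · simp [frame, planeCurvature]; linear_combination vel f u 1 / 2 * h3 - acc f u 1 * h4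
  · simpa [frame] using acc_vertical hI hδ hf harc hu

theorem SmoothNear.apply {E : Type*} [NormedAddCommGroup E] [NormedSpace ℝ E] {g : E → Vec3}
    {p : E} (h : SmoothNear g p) (i : Fin 3) : SmoothNear (fun x => g x i) p := by
  filter_upwards [h] with x hx using contDiffAt_pi.1 hx i

theorem smoothNear_planeCurvature (hI : IsOpen I) (hδ : 0 < δ) (hf : IsOrderFourEdge I δ f)
    (hu : u ∈ I) : SmoothNear (planeCurvature f) u := by
  have hv := smoothNear_vel hI hδ hf hu
  filter_upwards [hv.apply 0, hv.apply 1, (SmoothNear.deriv hv).apply 0,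
    (SmoothNear.deriv hv).apply 1] with x h0 h1 h2 h3
  exact (h0.mul h3).sub (h1.mul h2)

/-- These are the Frenet equations: the unit tangent of `γ` has derivative `κn`, the normal has
derivative `-κγ'`, and the vertical vector is constant. -/
theorem hasDerivAt_frame (hI : IsOpen I) (hδ : 0 < δ) (hf : IsOrderFourEdge I δ f)
    (harc : IsArcLengthProjection I f) (hu : u ∈ I) {a b c : ℝ → ℝ} {a' b' c' : ℝ}
    (ha : HasDerivAt a a' u) (hb : HasDerivAt b b' u) (hc : HasDerivAt c c' u) :
    HasDerivAt (fun s => frame f s (a s) (b s) (c s))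
      (frame f u (a' - planeCurvature f u * b u) (b' + planeCurvature f u * a u) c') u := by
  have h := hasDerivAt_vel hI hδ hf hu
  rw [acc_eq_frame hI hδ hf harc hu] at h
  replace h := hasDerivAt_pi.1 h
  have h0 := h 0
  have h1 := h 1
  have h2 := h 2
  simp only [frame, Matrix.cons_val, zero_mul, zero_sub, zero_add] at h0 h1 h2
  refine hasDerivAt_pi.2 fun i => ?_
  fin_cases i
  · simp only [frame, Fin.zero_eta, Matrix.cons_val]
    refine ((ha.mul h0).sub (hb.mul h1)).congr_deriv ?_
    ring
  · simp only [frame, Fin.mk_one, Matrix.cons_val]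
    refine ((ha.mul h1).add (hb.mul h0)).congr_deriv ?_
    ring
  · simp only [frame, Fin.reduceFinMk, Matrix.cons_val]
    refine (hc.mul h2).congr_deriv ?_
    ring

theorem smoothNear_frame {E : Type*} [NormedAddCommGroup E] [NormedSpace ℝ E]
    (hI : IsOpen I) (hδ : 0 < δ) (hf : IsOrderFourEdge I δ f)
    {s a b c : E → ℝ} {p : E} (hp : s p ∈ I) (hs : SmoothNear s p) (ha : SmoothNear a p)
    (hb : SmoothNear b p) (hc : SmoothNear c p) :
    SmoothNear (fun x => frame f (s x) (a x) (b x) (c x)) p := by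
  have hv := SmoothNear.comp (smoothNear_vel hI hδ hf hp) hs
  filter_upwards [ha, hb, hc, hv.apply 0, hv.apply 1, hv.apply 2] with x h1 h2 h3 h4 h5 h6
  refine contDiffAt_pi.2 fun i => ?_
  fin_cases i
  · exact (h1.mul h4).sub (h2.mul h5)
  · exact (h1.mul h5).add (h2.mul h4)
  · exact h3.mul h6

theorem pdx_frame (hI : IsOpen I) (hδ : 0 < δ) (hf : IsOrderFourEdge I δ f)
    (harc : IsArcLengthProjection I f) {q : ℝ × ℝ} (hu : q.1 ∈ I) {a b c : ℝ × ℝ → ℝ}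
    (ha : SmoothNear a q) (hb : SmoothNear b q) (hc : SmoothNear c q) :
    pdx (fun x => frame f x.1 (a x) (b x) (c x)) q =
      frame f q.1 (pdx a q - planeCurvature f q.1 * b q) (pdx b q + planeCurvature f q.1 * a q)
        (pdx c q) := by
  refine pdx_eq (u := q.1) (w := q.2) (smoothNear_frame hI hδ hf hu
    (ContDiff.smoothNear contDiff_fst q) ha hb hc).differentiableAt ?_
  exact hasDerivAt_frame hI hδ hf harc hu (hasDerivAt_fst (w := q.2) ha.differentiableAt)
    (hasDerivAt_fst (w := q.2) hb.differentiableAt) (hasDerivAt_fst (w := q.2) hc.differentiableAt)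

theorem pdy_frame (hI : IsOpen I) (hδ : 0 < δ) (hf : IsOrderFourEdge I δ f)
    {q : ℝ × ℝ} (hu : q.1 ∈ I) {a b c : ℝ × ℝ → ℝ}
    (ha : SmoothNear a q) (hb : SmoothNear b q) (hc : SmoothNear c q) :
    pdy (fun x => frame f x.1 (a x) (b x) (c x)) q =
      frame f q.1 (pdy a q) (pdy b q) (pdy c q) := by
  refine pdy_eq (u := q.1) (w := q.2) (smoothNear_frame hI hδ hf hu
    (ContDiff.smoothNear contDiff_fst q) ha hb hc).differentiableAt ?_
  have h1 := hasDerivAt_snd (u := q.1) (w := q.2) ha.differentiableAt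
  have h2 := hasDerivAt_snd (u := q.1) (w := q.2) hb.differentiableAt
  have h3 := hasDerivAt_snd (u := q.1) (w := q.2) hc.differentiableAt
  refine hasDerivAt_pi.2 fun i => ?_
  fin_cases i
  · exact (h1.mul_const (vel f q.1 0)).sub (h2.mul_const (vel f q.1 1))
  · exact (h1.mul_const (vel f q.1 1)).add (h2.mul_const (vel f q.1 0))
  · exact h3.mul_const (vel f q.1 2)

end Edge

/-! ### The section curves attached to a `μ`-function -/

section Cusp

/-- The angle function `λ(u, w) = w ∫₀¹ m(u, x w) dx`. -/
def angle (m : ℝ × ℝ → ℝ) (q : ℝ × ℝ) : ℝ := q.2 * avg 0 m q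

/-- The first coordinate of the section curve. -/
def secX (m : ℝ × ℝ → ℝ) (q : ℝ × ℝ) : ℝ := q.2 ^ 2 * avg 1 (fun q => Real.cos (angle m q)) q

/-- The second coordinate of the section curve. -/
def secY (m : ℝ × ℝ → ℝ) (q : ℝ × ℝ) : ℝ := q.2 ^ 2 * avg 1 (fun q => Real.sin (angle m q)) q

theorem cuspAngle_eq (m : ℝ × ℝ → ℝ) (u w : ℝ) : cuspAngle m u w = angle m (u, w) := by
  have := integral_eq_avg 0 m u w
  simpa [cuspAngle, angle] using this

theorem cuspX_eq (m : ℝ × ℝ → ℝ) (u w : ℝ) : cuspX m u w = secX m (u, w) := by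
  have := integral_eq_avg 1 (fun q => Real.cos (angle m q)) u w
  simpa [cuspX, secX, cuspAngle_eq] using this

theorem cuspY_eq (m : ℝ × ℝ → ℝ) (u w : ℝ) : cuspY m u w = secY m (u, w) := by
  have := integral_eq_avg 1 (fun q => Real.sin (angle m q)) u w
  simpa [cuspY, secY, cuspAngle_eq] using this

variable {m : ℝ × ℝ → ℝ}

theorem contDiff_angle (hm : ContDiff ℝ ∞ m) : ContDiff ℝ ∞ (angle m) :=
  contDiff_snd.mul (contDiff_avg 0 hm)

theorem contDiff_cos_angle (hm : ContDiff ℝ ∞ m) :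
    ContDiff ℝ ∞ (fun q => Real.cos (angle m q)) := Real.contDiff_cos.comp (contDiff_angle hm)

theorem contDiff_sin_angle (hm : ContDiff ℝ ∞ m) :
    ContDiff ℝ ∞ (fun q => Real.sin (angle m q)) := Real.contDiff_sin.comp (contDiff_angle hm)

theorem contDiff_secX (hm : ContDiff ℝ ∞ m) : ContDiff ℝ ∞ (secX m) :=
  (contDiff_snd.pow 2).mul (contDiff_avg 1 (contDiff_cos_angle hm))

theorem contDiff_secY (hm : ContDiff ℝ ∞ m) : ContDiff ℝ ∞ (secY m) :=
  (contDiff_snd.pow 2).mul (contDiff_avg 1 (contDiff_sin_angle hm))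

theorem pdy_pow_mul_avg (k : ℕ) {g : ℝ × ℝ → ℝ} (hg : ContDiff ℝ ∞ g) (q : ℝ × ℝ) :
    pdy (fun q : ℝ × ℝ => q.2 ^ (k + 1) * avg k g q) q = q.2 ^ k * g q := by
  have hs : ContDiff ℝ ∞ (fun q : ℝ × ℝ => q.2 ^ (k + 1) * avg k g q) :=
    (contDiff_snd.pow (k + 1)).mul (contDiff_avg k hg)
  refine pdy_eq (u := q.1) (w := q.2) (hs.differentiable (by simp) _) ?_
  have hc : Continuous fun r : ℝ => r ^ k * g (q.1, r) :=
    (continuous_pow k).mul (hg.continuous.comp (by fun_prop))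
  have h := (hc.integral_hasStrictDerivAt 0 q.2).hasDerivAt
  exact h.congr_of_eventuallyEq (Eventually.of_forall fun w =>
    (integral_eq_avg k g q.1 w).symm)

theorem pdy_angle (hm : ContDiff ℝ ∞ m) (q : ℝ × ℝ) : pdy (angle m) q = m q := by
  have := pdy_pow_mul_avg 0 hm q
  simpa using! this

theorem pdy_secX (hm : ContDiff ℝ ∞ m) (q : ℝ × ℝ) :
    pdy (secX m) q = q.2 * Real.cos (angle m q) := by
  have := pdy_pow_mul_avg 1 (contDiff_cos_angle hm) q
  simpa using! this

theorem pdy_secY (hm : ContDiff ℝ ∞ m) (q : ℝ × ℝ) :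
    pdy (secY m) q = q.2 * Real.sin (angle m q) := by
  have := pdy_pow_mul_avg 1 (contDiff_sin_angle hm) q
  simpa using! this

theorem pdy_cos_angle (hm : ContDiff ℝ ∞ m) (q : ℝ × ℝ) :
    pdy (fun q => Real.cos (angle m q)) q = -Real.sin (angle m q) * m q := by
  have h := hasDerivAt_snd (u := q.1) (w := q.2) ((contDiff_angle hm).differentiable (by simp) _)
  rw [pdy_angle hm] at h
  exact pdy_eq (u := q.1) (w := q.2) ((contDiff_cos_angle hm).differentiable (by simp) _) h.cos

theorem pdy_sin_angle (hm : ContDiff ℝ ∞ m) (q : ℝ × ℝ) :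
    pdy (fun q => Real.sin (angle m q)) q = Real.cos (angle m q) * m q := by
  have h := hasDerivAt_snd (u := q.1) (w := q.2) ((contDiff_angle hm).differentiable (by simp) _)
  rw [pdy_angle hm] at h
  exact pdy_eq (u := q.1) (w := q.2) ((contDiff_sin_angle hm).differentiable (by simp) _) h.sin

theorem pdx_angle (hm : ContDiff ℝ ∞ m) (q : ℝ × ℝ) :
    pdx (angle m) q = q.2 * avg 0 (pdx m) q := by
  have := pdx_pow_mul (contDiff_avg 0 hm) 1 q
  simpa [pdx_avg 0 hm] using! this

theorem pdx_cos_angle (hm : ContDiff ℝ ∞ m) (q : ℝ × ℝ) :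
    pdx (fun q => Real.cos (angle m q)) q = -Real.sin (angle m q) * (q.2 * avg 0 (pdx m) q) := by
  have h := hasDerivAt_fst (u := q.1) (w := q.2) ((contDiff_angle hm).differentiable (by simp) _)
  rw [pdx_angle hm] at h
  exact pdx_eq (u := q.1) (w := q.2) ((contDiff_cos_angle hm).differentiable (by simp) _) h.cos

theorem pdx_sin_angle (hm : ContDiff ℝ ∞ m) (q : ℝ × ℝ) :
    pdx (fun q => Real.sin (angle m q)) q = Real.cos (angle m q) * (q.2 * avg 0 (pdx m) q) := by
  have h := hasDerivAt_fst (u := q.1) (w := q.2) ((contDiff_angle hm).differentiable (by simp) _)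
  rw [pdx_angle hm] at h
  exact pdx_eq (u := q.1) (w := q.2) ((contDiff_sin_angle hm).differentiable (by simp) _) h.sin

theorem pdx_snd_mul {g : ℝ × ℝ → ℝ} (hg : ContDiff ℝ ∞ g) (q : ℝ × ℝ) :
    pdx (fun q : ℝ × ℝ => q.2 * g q) q = q.2 * pdx g q := by
  simpa using pdx_pow_mul hg 1 q

theorem pdy_snd_mul {g : ℝ × ℝ → ℝ} (hg : ContDiff ℝ ∞ g) (q : ℝ × ℝ) :
    pdy (fun q : ℝ × ℝ => q.2 * g q) q = g q + q.2 * pdy g q := by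
  simpa using pdy_pow_mul hg 0 q

/-- Interchanging the derivatives lets the integral be removed first by the fundamental theorem of
calculus, so only the angle is differentiated in `u`. -/
theorem pdy_pdx_secX (hm : ContDiff ℝ ∞ m) (q : ℝ × ℝ) :
    pdy (pdx (secX m)) q = -(q.2 ^ 2 * Real.sin (angle m q) * avg 0 (pdx m) q) := by
  rw [← pdx_pdy_comm (ContDiff.smoothNear (contDiff_secX hm) q), funext (pdy_secX hm),
    pdx_snd_mul (contDiff_cos_angle hm), pdx_cos_angle hm]
  ring

theorem pdy_pdx_secY (hm : ContDiff ℝ ∞ m) (q : ℝ × ℝ) :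
    pdy (pdx (secY m)) q = q.2 ^ 2 * Real.cos (angle m q) * avg 0 (pdx m) q := by
  rw [← pdx_pdy_comm (ContDiff.smoothNear (contDiff_secY hm) q), funext (pdy_secY hm),
    pdx_snd_mul (contDiff_sin_angle hm), pdx_sin_angle hm]
  ring

theorem angle_axis (m : ℝ × ℝ → ℝ) (u : ℝ) : angle m (u, 0) = 0 := by simp [angle]

/-- The remainder vanishes on the axis because `∂_w cos λ = -μ sin λ` does. Hence `cos λ = 1 +
O(w²)` and, after integration, `x = w²/2 + O(w⁴)`. -/
theorem exists_cos_expansion (hm : ContDiff ℝ ∞ m) : ∃ c : ℝ × ℝ → ℝ, ContDiff ℝ ∞ c ∧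
    (∀ q, Real.cos (angle m q) = 1 + q.2 * c q) ∧ ∀ u, c (u, 0) = 0 := by
  obtain ⟨c, hc, h, h0⟩ := exists_eq_axis_add_mul (contDiff_cos_angle hm)
  refine ⟨c, hc, fun q => ?_, fun u => ?_⟩
  · have := h q.1 q.2
    simpa [angle_axis] using this
  · rw [h0, pdy_cos_angle hm, angle_axis]; simp

/-- Since `∂_w sin λ = μ cos λ`, the angle has expansion `sin λ = μ₀w + μ₁w²/2 + O(w³)`; the second
coefficient enters the mean curvature. -/
theorem exists_sin_expansion (hm : ContDiff ℝ ∞ m) : ∃ s : ℝ × ℝ → ℝ, ContDiff ℝ ∞ s ∧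
    (∀ q, Real.sin (angle m q) = q.2 * (m (q.1, 0) + q.2 * s q)) ∧
      ∀ u, s (u, 0) = pdy m (u, 0) / 2 := by
  have hh : ContDiff ℝ ∞ (fun q => Real.cos (angle m q) * m q) := (contDiff_cos_angle hm).mul hm
  obtain ⟨s, hs, h, h0⟩ := exists_eq_axis_add_mul (contDiff_avg 0 hh)
  refine ⟨s, hs, fun q => ?_, fun u => ?_⟩
  · have h1 := eq_axis_add_mul_avg (contDiff_sin_angle hm) q.1 q.2
    have h2 := h q.1 q.2
    rw [funext (pdy_sin_angle hm), h2, avg_axis] at h1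
    simpa [angle_axis] using h1
  · have hd := (hasDerivAt_snd (u := u) (w := 0) ((contDiff_cos_angle hm).differentiable (by simp)
      _)).mul (hasDerivAt_snd (u := u) (w := 0) (hm.differentiable (by simp) _))
    have h2 := pdy_eq (hh.differentiable (by simp) (u, 0)) hd
    rw [h0, pdy_avg 0 hh, avg_axis, h2, pdy_cos_angle hm, angle_axis]
    simp; ring

theorem exists_secX_expansion (hm : ContDiff ℝ ∞ m) : ∃ X : ℝ × ℝ → ℝ, ContDiff ℝ ∞ X ∧
    (∀ q, secX m q = q.2 ^ 2 * (1 / 2 + q.2 * X q)) ∧ ∀ u, X (u, 0) = 0 := by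
  obtain ⟨c, hc, h, h0⟩ := exists_cos_expansion hm
  refine ⟨avg 2 c, contDiff_avg 2 hc, fun q => ?_, fun u => by rw [avg_axis, h0]; simp⟩
  have i1 : IntervalIntegrable (fun x : ℝ => x) MeasureTheory.volume 0 1 :=
    continuous_id.intervalIntegrable _ _
  have i2 : IntervalIntegrable (fun x : ℝ => q.2 * (x ^ 2 * c (q.1, x * q.2)))
      MeasureTheory.volume 0 1 := by
    have := hc.continuous
    exact (by fun_prop : Continuous fun x : ℝ =>
      q.2 * (x ^ 2 * c (q.1, x * q.2))).intervalIntegrable _ _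
  have : avg 1 (fun q => Real.cos (angle m q)) q = 1 / 2 + q.2 * avg 2 c q := by
    simp only [avg, h]
    rw [← intervalIntegral.integral_const_mul, show (1 : ℝ) / 2 = ∫ x in (0 : ℝ)..1, x by simp,
      ← intervalIntegral.integral_add i1 i2]
    congr 1; ext x; ring
  rw [secX, this]

theorem exists_secY_expansion (hm : ContDiff ℝ ∞ m) : ∃ Y : ℝ × ℝ → ℝ, ContDiff ℝ ∞ Y ∧
    (∀ q, secY m q = q.2 ^ 3 * Y q) ∧ ∀ u, Y (u, 0) = m (u, 0) / 3 := by
  obtain ⟨s, hs, h, -⟩ := exists_sin_expansion hm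
  have hS : ContDiff ℝ ∞ (fun q : ℝ × ℝ => m (q.1, 0) + q.2 * s q) :=
    (hm.comp (contDiff_fst.prodMk contDiff_const)).add (contDiff_snd.mul hs)
  refine ⟨avg 2 (fun q => m (q.1, 0) + q.2 * s q), contDiff_avg 2 hS, fun q => ?_, fun u => ?_⟩
  · have : avg 1 (fun q => Real.sin (angle m q)) q =
        q.2 * avg 2 (fun q => m (q.1, 0) + q.2 * s q) q := by
      simp only [avg, h]
      rw [← intervalIntegral.integral_const_mul]
      congr 1; ext x; ring
    rw [secY, this]; ring
  · rw [avg_axis]; norm_num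

end Cusp

/-! ### Normal forms and their fundamental forms -/

/-- In the coordinates given by `φ`, the map `f` is near `(s₀, 0)` the family of section curves
with sign `σ` and `μ`-function `m`. -/
structure NormalForm (I : Set ℝ) (δ : ℝ) (f : ℝ × ℝ → Vec3) (s₀ σ : ℝ) (m : ℝ × ℝ → ℝ)
    (φ : ℝ × ℝ → ℝ × ℝ) : Prop where
  sign : σ = 1 ∨ σ = -1
  smooth_mu : ContDiff ℝ ∞ m
  smooth : SmoothNear φ (s₀, 0)
  fix_axis : ∀ᶠ u in 𝓝 s₀, φ (u, 0) = (u, 0)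
  s_v : ∀ᶠ u in 𝓝 s₀, (pdy φ (u, 0)).1 = 0
  t_v : ∀ᶠ u in 𝓝 s₀, 0 < (pdy φ (u, 0)).2
  mem : ∀ᶠ q in 𝓝 (s₀, (0 : ℝ)), φ q ∈ edgeDomain I δ
  eq : ∀ᶠ q in 𝓝 (s₀, (0 : ℝ)),
    f (φ q) = edgeCurve f q.1 + frame f q.1 0 (σ * secX m q) (σ * secY m q)

theorem box_mem_nhds {s₀ r : ℝ} (hr : 0 < r) : box s₀ r ∈ 𝓝 (s₀, (0 : ℝ)) :=
  (isOpen_Ioo.prod isOpen_Ioo).mem_nhds ⟨by simp [hr], by simp [hr]⟩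

theorem exists_box_subset {s₀ : ℝ} {S : Set (ℝ × ℝ)} (hS : S ∈ 𝓝 (s₀, (0 : ℝ))) :
    ∃ r, 0 < r ∧ box s₀ r ⊆ S := by
  obtain ⟨r, hr, h⟩ := Metric.mem_nhds_iff.1 hS
  refine ⟨r, hr, fun q hq => h ?_⟩
  rw [← ball_prod_same, Real.ball_eq_Ioo, Real.ball_eq_Ioo, zero_sub, zero_add]
  exact hq

theorem tendsto_axis (s₀ : ℝ) : Tendsto (fun u : ℝ => (u, (0 : ℝ))) (𝓝 s₀) (𝓝 (s₀, 0)) :=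
  (by fun_prop : Continuous fun u : ℝ => (u, (0 : ℝ))).tendsto s₀

/-- The function `μ` is only smooth near `p`; replacing it by a globally smooth function with the
same germ makes all averages along segments smooth everywhere. -/
theorem IsMuFunctionAt.exists_normalForm {I : Set ℝ} {δ : ℝ} {f : ℝ × ℝ → Vec3} {s₀ σ : ℝ}
    {μ : ℝ × ℝ → ℝ} (h : IsMuFunctionAt I δ f s₀ σ μ) :
    ∃ m φ, NormalForm I δ f s₀ σ m φ ∧ μ =ᶠ[𝓝 (s₀, 0)] m := by
  obtain ⟨hσ, r, φ, hr, ⟨h1, h2, h3, h4⟩, hmaps, hμ, heq⟩ := h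
  obtain ⟨m, hm, hμm⟩ := (SmoothNear.of_contDiffOn hμ (box_mem_nhds hr)).exists_contDiff
  have hI : Ioo (s₀ - r) (s₀ + r) ∈ 𝓝 s₀ := Ioo_mem_nhds (by linarith) (by linarith)
  obtain ⟨r', hr', hb⟩ := exists_box_subset (inter_mem (box_mem_nhds hr) hμm)
  refine ⟨m, φ, ⟨hσ, hm, SmoothNear.of_contDiffOn h1 (box_mem_nhds hr), ?_, ?_, ?_, ?_, ?_⟩, hμm⟩
  · filter_upwards [hI] with u hu using h2 u hu
  · filter_upwards [hI] with u hu using h3 u hu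
  · filter_upwards [hI] with u hu using h4 u hu
  · filter_upwards [box_mem_nhds hr] with q hq using hmaps hq
  · filter_upwards [box_mem_nhds hr'] with q hq
    obtain ⟨u, w⟩ := q
    -- Equality of germs does not by itself identify integrals. Here the whole segment from the axis
    -- lies in a box on which `μ = m`.
    have hang : ∀ t ∈ uIcc 0 w, cuspAngle μ u t = angle m (u, t) := by
      intro t ht
      rw [← cuspAngle_eq]
      refine intervalIntegral.integral_congr fun x hx => (hb (a := (u, x)) ⟨hq.1, ?_⟩).2
      have h0 : (0 : ℝ) ∈ Ioo (-r') r' := by simp [hr']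
      exact (ordConnected_Ioo.uIcc_subset h0 (ordConnected_Ioo.uIcc_subset h0 hq.2 ht)) hx
    rw [heq u w (hb hq).1, frame_eq, add_assoc]
    have hX : cuspX μ u w = secX m (u, w) := by
      rw [← cuspX_eq]
      refine intervalIntegral.integral_congr fun t ht => ?_
      simp only [hang t ht, cuspAngle_eq]
    have hY : cuspY μ u w = secY m (u, w) := by
      rw [← cuspY_eq]
      refine intervalIntegral.integral_congr fun t ht => ?_
      simp only [hang t ht, cuspAngle_eq]
    rw [hX, hY]

section Forms

variable {I : Set ℝ} {δ : ℝ} {f : ℝ × ℝ → Vec3} {s₀ σ : ℝ} {m : ℝ × ℝ → ℝ} {φ : ℝ × ℝ → ℝ × ℝ}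

theorem smoothNear_curve_add_frame (hI : IsOpen I) (hδ : 0 < δ) (hf : IsOrderFourEdge I δ f)
    {q : ℝ × ℝ} (hq : q.1 ∈ I) {A B : ℝ × ℝ → ℝ} (hA : ContDiff ℝ ∞ A) (hB : ContDiff ℝ ∞ B) :
    SmoothNear (fun x : ℝ × ℝ => edgeCurve f x.1) q ∧
    SmoothNear (fun x : ℝ × ℝ => frame f x.1 0 (A x) (B x)) q :=
  ⟨SmoothNear.comp (h := Prod.fst) (smoothNear_edgeCurve hI hδ hf hq)
    (ContDiff.smoothNear contDiff_fst q),
  smoothNear_frame hI hδ hf hq (ContDiff.smoothNear contDiff_fst q)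
      (ContDiff.smoothNear contDiff_const q) (ContDiff.smoothNear hA q) (ContDiff.smoothNear hB q)⟩

theorem pdx_curve_add_frame (hI : IsOpen I) (hδ : 0 < δ) (hf : IsOrderFourEdge I δ f)
    (harc : IsArcLengthProjection I f) {q : ℝ × ℝ} (hq : q.1 ∈ I) {A B : ℝ × ℝ → ℝ}
    (hA : ContDiff ℝ ∞ A) (hB : ContDiff ℝ ∞ B) :
    pdx (fun x => edgeCurve f x.1 + frame f x.1 0 (A x) (B x)) q =
      frame f q.1 (1 - planeCurvature f q.1 * A q) (pdx A q) (1 + pdx B q) := by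
  obtain ⟨h1, h2⟩ := smoothNear_curve_add_frame hI hδ hf hq hA hB
  rw [pdx_add h1.differentiableAt h2.differentiableAt, pdx_frame hI hδ hf harc hq
    (ContDiff.smoothNear contDiff_const q) (ContDiff.smoothNear hA q) (ContDiff.smoothNear hB q),
    pdx_eq (u := q.1) (w := q.2) h1.differentiableAt (hasDerivAt_edgeCurve hI hδ hf hq),
    vel_eq_frame, frame_add]
  congr 1
  · simp [pdx]; ring
  · ring

theorem pdy_curve_add_frame (hI : IsOpen I) (hδ : 0 < δ) (hf : IsOrderFourEdge I δ f)
    {q : ℝ × ℝ} (hq : q.1 ∈ I) {A B : ℝ × ℝ → ℝ}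
    (hA : ContDiff ℝ ∞ A) (hB : ContDiff ℝ ∞ B) :
    pdy (fun x => edgeCurve f x.1 + frame f x.1 0 (A x) (B x)) q =
      frame f q.1 0 (pdy A q) (pdy B q) := by
  obtain ⟨h1, h2⟩ := smoothNear_curve_add_frame hI hδ hf hq hA hB
  rw [pdy_add h1.differentiableAt h2.differentiableAt, pdy_frame hI hδ hf hq
    (ContDiff.smoothNear contDiff_const q) (ContDiff.smoothNear hA q) (ContDiff.smoothNear hB q),
    pdy_eq (u := q.1) (w := q.2) h1.differentiableAt (hasDerivAt_const q.2 (edgeCurve f q.1)),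
    zero_add]
  congr 1
  simp [pdy]

theorem pdx_const_mul (k : ℝ) {A : ℝ × ℝ → ℝ} (hA : ContDiff ℝ ∞ A) (q : ℝ × ℝ) :
    pdx (fun x => k * A x) q = k * pdx A q := by
  simp only [pdx]
  rw [fderiv_const_mul (hA.differentiable (by simp) q)]; rfl

theorem pdy_const_mul (k : ℝ) {A : ℝ × ℝ → ℝ} (hA : ContDiff ℝ ∞ A) (q : ℝ × ℝ) :
    pdy (fun x => k * A x) q = k * pdy A q := by
  simp only [pdy]
  rw [fderiv_const_mul (hA.differentiable (by simp) q)]; rfl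

/-- The first and second partial derivatives of the normal form. -/
structure NormalDerivs (N : ℝ × ℝ → Vec3) (f : ℝ × ℝ → Vec3) (k : ℝ → ℝ) (σ : ℝ) (m : ℝ × ℝ → ℝ)
    (q : ℝ × ℝ) : Prop where
  dS_eq : dS N q = frame f q.1 (1 - k q.1 * (σ * secX m q)) (σ * pdx (secX m) q)
    (1 + σ * pdx (secY m) q)
  dT_eq : dT N q = frame f q.1 0 (σ * (q.2 * Real.cos (angle m q)))
    (σ * (q.2 * Real.sin (angle m q)))
  dS_dS_eq : dS (dS N) q = frame f q.1
    (-(deriv k q.1 * (σ * secX m q)) - 2 * k q.1 * (σ * pdx (secX m) q))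
    (σ * pdx (pdx (secX m)) q + k q.1 * (1 - k q.1 * (σ * secX m q)))
    (σ * pdx (pdx (secY m)) q)
  dT_dS_eq : dT (dS N) q = frame f q.1 (-(k q.1 * (σ * (q.2 * Real.cos (angle m q)))))
    (-(σ * (q.2 ^ 2 * Real.sin (angle m q) * avg 0 (pdx m) q)))
    (σ * (q.2 ^ 2 * Real.cos (angle m q) * avg 0 (pdx m) q))
  dT_dT_eq : dT (dT N) q = frame f q.1 0
    (σ * (Real.cos (angle m q) - q.2 * Real.sin (angle m q) * m q))
    (σ * (Real.sin (angle m q) + q.2 * Real.cos (angle m q) * m q))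

theorem NormalForm.derivs (hI : IsOpen I) (hδ : 0 < δ) (hf : IsOrderFourEdge I δ f)
    (harc : IsArcLengthProjection I f) (hs₀ : s₀ ∈ I) (nf : NormalForm I δ f s₀ σ m φ)
    {k : ℝ → ℝ} (hk : ContDiff ℝ ∞ k) (hkκ : planeCurvature f =ᶠ[𝓝 s₀] k) :
    ∀ᶠ q in 𝓝 (s₀, (0 : ℝ)), NormalDerivs (fun x => f (φ x)) f k σ m q := by
  have hm := nf.smooth_mu
  have hX := contDiff_secX hm
  have hY := contDiff_secY hm
  have hσX : ContDiff ℝ ∞ fun q => σ * secX m q := contDiff_const.mul hX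
  have hσY : ContDiff ℝ ∞ fun q => σ * secY m q := contDiff_const.mul hY
  have hfst : Tendsto Prod.fst (𝓝 (s₀, (0 : ℝ))) (𝓝 s₀) := continuous_fst.tendsto _
  have hmem : ∀ᶠ q in 𝓝 (s₀, (0 : ℝ)), q.1 ∈ I := hfst.eventually (hI.mem_nhds hs₀)
  have hκ : ∀ᶠ q in 𝓝 (s₀, (0 : ℝ)), planeCurvature f q.1 = k q.1 := hfst.eventually hkκ
  have hS : dS (fun x => f (φ x)) =ᶠ[𝓝 (s₀, 0)] fun q =>
      frame f q.1 (1 - k q.1 * (σ * secX m q)) (σ * pdx (secX m) q) (1 + σ * pdx (secY m) q) := by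
    filter_upwards [nf.eq.eventually_nhds, hmem, hκ] with q h1 h2 h3
    rw [show dS (fun x => f (φ x)) q = _ from (pdx_congr h1).eq_of_nhds,
      pdx_curve_add_frame hI hδ hf harc h2 hσX hσY, h3, pdx_const_mul σ hX, pdx_const_mul σ hY]
  have hT : dT (fun x => f (φ x)) =ᶠ[𝓝 (s₀, 0)] fun q =>
      frame f q.1 0 (σ * (q.2 * Real.cos (angle m q))) (σ * (q.2 * Real.sin (angle m q))) := by
    filter_upwards [nf.eq.eventually_nhds, hmem] with q h1 h2
    rw [show dT (fun x => f (φ x)) q = _ from (pdy_congr h1).eq_of_nhds,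
      pdy_curve_add_frame hI hδ hf h2 hσX hσY, pdy_const_mul σ hX, pdy_const_mul σ hY,
      pdy_secX hm, pdy_secY hm]
  have hXx := contDiff_pdx hX
  have hYx := contDiff_pdx hY
  have ha : ContDiff ℝ ∞ fun q : ℝ × ℝ => 1 - k q.1 * (σ * secX m q) := by fun_prop
  have hb : ContDiff ℝ ∞ fun q : ℝ × ℝ => σ * pdx (secX m) q := by fun_prop
  have hd : ContDiff ℝ ∞ fun q : ℝ × ℝ => 1 + σ * pdx (secY m) q := by fun_prop
  have hax : ∀ q : ℝ × ℝ, pdx (fun q : ℝ × ℝ => 1 - k q.1 * (σ * secX m q)) q =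
      -(deriv k q.1 * (σ * secX m q)) - k q.1 * (σ * pdx (secX m) q) := fun q => by
    refine pdx_eq (u := q.1) (w := q.2) (ha.differentiable (by simp) _) ?_
    have h1 := (hk.differentiable (by simp) q.1).hasDerivAt
    have h2 := hasDerivAt_fst (u := q.1) (w := q.2) (hX.differentiable (by simp) _)
    refine ((h1.mul (h2.const_mul σ)).const_sub 1).congr_deriv ?_
    ring
  have hay : ∀ q : ℝ × ℝ, pdy (fun q : ℝ × ℝ => 1 - k q.1 * (σ * secX m q)) q =
      -(k q.1 * (σ * (q.2 * Real.cos (angle m q)))) := fun q => by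
    refine pdy_eq (u := q.1) (w := q.2) (ha.differentiable (by simp) _) ?_
    have h2 := hasDerivAt_snd (u := q.1) (w := q.2) (hX.differentiable (by simp) _)
    rw [pdy_secX hm] at h2
    exact ((h2.const_mul σ).const_mul (k q.1)).const_sub 1
  have hdx : ∀ q : ℝ × ℝ, pdx (fun q : ℝ × ℝ => 1 + σ * pdx (secY m) q) q =
      σ * pdx (pdx (secY m)) q := fun q => by
    refine pdx_eq (u := q.1) (w := q.2) (hd.differentiable (by simp) _) ?_
    exact ((hasDerivAt_fst (u := q.1) (w := q.2)
      (hYx.differentiable (by simp) _)).const_mul σ).const_add 1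
  have hdy : ∀ q : ℝ × ℝ, pdy (fun q : ℝ × ℝ => 1 + σ * pdx (secY m) q) q =
      σ * pdy (pdx (secY m)) q := fun q => by
    refine pdy_eq (u := q.1) (w := q.2) (hd.differentiable (by simp) _) ?_
    exact ((hasDerivAt_snd (u := q.1) (w := q.2)
      (hYx.differentiable (by simp) _)).const_mul σ).const_add 1
  have hc : ContDiff ℝ ∞ fun q : ℝ × ℝ => q.2 * Real.cos (angle m q) :=
    contDiff_snd.mul (contDiff_cos_angle hm)
  have hs : ContDiff ℝ ∞ fun q : ℝ × ℝ => q.2 * Real.sin (angle m q) :=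
    contDiff_snd.mul (contDiff_sin_angle hm)
  filter_upwards [hS.eventually_nhds, hT.eventually_nhds, hmem, hκ] with q h1 h2 h3 h4
  refine ⟨h1.self_of_nhds, h2.self_of_nhds, ?_, ?_, ?_⟩
  · rw [show dS (dS fun x => f (φ x)) q = _ from (pdx_congr h1).eq_of_nhds,
      pdx_frame hI hδ hf harc h3 (ContDiff.smoothNear ha q) (ContDiff.smoothNear hb q)
        (ContDiff.smoothNear hd q), hax, hdx, pdx_const_mul σ hXx, h4]
    congr 1; ring
  · rw [show dT (dS fun x => f (φ x)) q = _ from (pdy_congr h1).eq_of_nhds,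
      pdy_frame hI hδ hf h3 (ContDiff.smoothNear ha q) (ContDiff.smoothNear hb q)
        (ContDiff.smoothNear hd q), hay, hdy, pdy_const_mul σ hXx, pdy_pdx_secX hm,
        pdy_pdx_secY hm]
    congr 1; ring
  · rw [show dT (dT fun x => f (φ x)) q = _ from (pdy_congr h2).eq_of_nhds,
      pdy_frame hI hδ hf h3 (ContDiff.smoothNear contDiff_const q)
        (ContDiff.smoothNear (contDiff_const.mul hc) q)
        (ContDiff.smoothNear (contDiff_const.mul hs) q), pdy_const_mul σ hc, pdy_const_mul σ hs,
        pdy_snd_mul (contDiff_cos_angle hm), pdy_snd_mul (contDiff_sin_angle hm),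
        pdy_cos_angle hm, pdy_sin_angle hm]
    congr 1
    · simp [pdy]
    · ring
    · ring

/-- The expansions of the coefficients of the fundamental forms of a normal form. -/
theorem NormalForm.exists_expansion (hI : IsOpen I) (hδ : 0 < δ) (hf : IsOrderFourEdge I δ f)
    (harc : IsArcLengthProjection I f) (hs₀ : s₀ ∈ I) (nf : NormalForm I δ f s₀ σ m φ)
    {k : ℝ → ℝ} (hk : ContDiff ℝ ∞ k) (hkκ : planeCurvature f =ᶠ[𝓝 s₀] k) :
    ∃ E₁ F₁ G₁ L₁ M₁ N₁ : ℝ × ℝ → ℝ, ContDiff ℝ ∞ E₁ ∧ ContDiff ℝ ∞ F₁ ∧ ContDiff ℝ ∞ G₁ ∧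
      ContDiff ℝ ∞ L₁ ∧ ContDiff ℝ ∞ M₁ ∧ ContDiff ℝ ∞ N₁ ∧
      (∀ᶠ q in 𝓝 (s₀, (0 : ℝ)),
        coeffE (fun x => f (φ x)) q = q.2 ^ 2 * (-σ * k q.1 + q.2 * E₁ q) ∧
        coeffF (fun x => f (φ x)) q = q.2 ^ 2 * (-σ * m (q.1, 0) + q.2 * F₁ q) ∧
        coeffG (fun x => f (φ x)) q = q.2 ^ 2 * (1 + q.2 * G₁ q) ∧
        tildeL (fun x => f (φ x)) q =
          vel f q.1 2 * (q.2 ^ 2 * (-σ * k q.1 * m (q.1, 0) + q.2 * L₁ q)) ∧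
        tildeM (fun x => f (φ x)) q = vel f q.1 2 * (q.2 ^ 2 * (k q.1 + q.2 * M₁ q)) ∧
        tildeN (fun x => f (φ x)) q = vel f q.1 2 * (q.2 ^ 2 * (m (q.1, 0) + q.2 * N₁ q))) ∧
      ∀ u, E₁ (u, 0) = -2 * σ * pdx m (u, 0) / 3 ∧ F₁ (u, 0) = -σ * pdy m (u, 0) / 2 ∧
        G₁ (u, 0) = 0 ∧ L₁ (u, 0) = (deriv k u - σ * k u * pdy m (u, 0)) / 2 ∧
        M₁ (u, 0) = pdx m (u, 0) ∧ N₁ (u, 0) = pdy m (u, 0) := by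
  have hm := nf.smooth_mu
  have hσ : σ ^ 2 = 1 := by rcases nf.sign with h | h <;> simp [h]
  obtain ⟨c, hc, hc1, hc0⟩ := exists_cos_expansion hm
  obtain ⟨s, hs, hs1, hs0⟩ := exists_sin_expansion hm
  obtain ⟨X, hX, hX1, hX0⟩ := exists_secX_expansion hm
  obtain ⟨Y, hY, hY1, hY0⟩ := exists_secY_expansion hm
  obtain ⟨m₁, hm₁, hm1, hm0⟩ := exists_eq_axis_add_mul hm
  have hk' : ContDiff ℝ ∞ (deriv k) := (contDiff_infty_iff_deriv.1 hk).2
  have hma : ContDiff ℝ ∞ fun q : ℝ × ℝ => m (q.1, 0) :=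
    hm.comp (contDiff_fst.prodMk contDiff_const)
  have hka : ContDiff ℝ ∞ fun q : ℝ × ℝ => k q.1 := hk.comp contDiff_fst
  have hka' : ContDiff ℝ ∞ fun q : ℝ × ℝ => deriv k q.1 := hk'.comp contDiff_fst
  have hXx := contDiff_pdx hX
  have hYx := contDiff_pdx hY
  have hXxx := contDiff_pdx hXx
  have hYxx := contDiff_pdx hYx
  have hl := contDiff_avg 0 (contDiff_pdx hm)
  have eXx : ∀ q, pdx (secX m) q = q.2 ^ 3 * pdx X q := by
    intro q
    rw [show secX m = fun q => q.2 ^ 2 * (1 / 2 + q.2 * X q) from funext hX1,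
      pdx_pow_mul (g := fun q : ℝ × ℝ => 1 / 2 + q.2 * X q) (by fun_prop) 2 q,
      pdx_add (by fun_prop) ((contDiff_snd.mul hX).differentiable (by simp) q),
      pdx_snd_mul hX]
    simp [pdx]; ring
  have eYx : ∀ q, pdx (secY m) q = q.2 ^ 3 * pdx Y q := by
    intro q
    rw [show secY m = fun q => q.2 ^ 3 * Y q from funext hY1, pdx_pow_mul hY]
  have eXxx : ∀ q, pdx (pdx (secX m)) q = q.2 ^ 3 * pdx (pdx X) q := fun q => by
    rw [funext eXx, pdx_pow_mul hXx]
  have eYxx : ∀ q, pdx (pdx (secY m)) q = q.2 ^ 3 * pdx (pdx Y) q := fun q => by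
    rw [funext eYx, pdx_pow_mul hYx]
  have hXx0 : ∀ u, pdx X (u, 0) = 0 := fun u =>
    pdx_eq (hX.differentiable (by simp) _) (by simpa [hX0] using hasDerivAt_const u (0 : ℝ))
  have hYx0 : ∀ u, pdx Y (u, 0) = pdx m (u, 0) / 3 := fun u =>
    pdx_eq (hY.differentiable (by simp) _) (by
      simp only [hY0]
      exact (hasDerivAt_fst (hm.differentiable (by simp) _)).div_const 3)
  -- Each witness is what remains of the coefficient after dividing by `w²` (and by the vertical
  -- velocity in the second form), subtracting the leading term and dividing by `w` once more. All
  -- are polynomial in smooth functions, so no division is left.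
  refine ⟨fun q => -2 * k q.1 * σ * X q - 2 * σ * pdx Y q
        + k q.1 ^ 2 * q.2 * (1 / 2 + q.2 * X q) ^ 2 + q.2 ^ 3 * pdx X q ^ 2
        - q.2 ^ 3 * pdx Y q ^ 2,
    fun q => -σ * s q + q.2 * (1 + q.2 * c q) * pdx X q
      - q.2 ^ 2 * pdx Y q * (m (q.1, 0) + q.2 * s q),
    fun q => 2 * c q + q.2 * c q ^ 2 - q.2 * (m (q.1, 0) + q.2 * s q) ^ 2,
    fun q => q.2 * (1 + q.2 ^ 2 * (-k q.1 * σ * (1 / 2 + q.2 * X q))) * (1 + q.2 * c q)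
        * pdx (pdx Y) q
      - σ * s q * k q.1 - σ * (m (q.1, 0) + q.2 * s q) * q.2
        * (-k q.1 * σ * (1 / 2 + q.2 * X q) * k q.1
          + (σ * q.2 * pdx (pdx X) q - k q.1 ^ 2 * σ * (1 / 2 + q.2 * X q))
          + q.2 ^ 2 * (-k q.1 * σ * (1 / 2 + q.2 * X q))
            * (σ * q.2 * pdx (pdx X) q - k q.1 ^ 2 * σ * (1 / 2 + q.2 * X q)))
      + q.2 ^ 4 * pdx X q * (m (q.1, 0) + q.2 * s q)
        * (-deriv k q.1 * σ * (1 / 2 + q.2 * X q) - 2 * k q.1 * σ * q.2 * pdx X q)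
      - σ * (1 + σ * q.2 ^ 3 * pdx Y q) * (1 + q.2 * c q)
        * (-deriv k q.1 * σ * (1 / 2 + q.2 * X q) - 2 * k q.1 * σ * q.2 * pdx X q),
    fun q => (1 + q.2 ^ 2 * (-k q.1 * σ * (1 / 2 + q.2 * X q))) * avg 0 (pdx m) q
        * ((1 + q.2 * c q) ^ 2 + q.2 ^ 2 * (m (q.1, 0) + q.2 * s q) ^ 2)
      - σ * k q.1 * q.2 ^ 3 * pdx X q * (m (q.1, 0) + q.2 * s q) * (1 + q.2 * c q)
      + k q.1 * ((2 * c q + q.2 * c q ^ 2)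
        + σ * q.2 ^ 2 * pdx Y q * (1 + q.2 * (2 * c q + q.2 * c q ^ 2))),
    fun q => m₁ q + q.2 * (-k q.1 * σ * (1 / 2 + q.2 * X q)) * m q,
    by fun_prop, by fun_prop, by fun_prop, by fun_prop, by fun_prop, by fun_prop, ?_, ?_⟩
  · have hmem : ∀ᶠ q in 𝓝 (s₀, (0 : ℝ)), q.1 ∈ I :=
      (continuous_fst.tendsto (s₀, (0 : ℝ))).eventually (hI.mem_nhds hs₀)
    filter_upwards [nf.derivs hI hδ hf harc hs₀ hk hkκ, hmem] with q hq hqI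
    have e1 := harc q.1 hqI
    have e2 := vel_vertical_sq hf harc hqI
    have pyth := Real.sin_sq_add_cos_sq (angle m q)
    have hmq : m q = m (q.1, 0) + q.2 * m₁ q := hm1 q.1 q.2
    obtain ⟨d1, d2, d3, d4, d5⟩ := hq
    rw [hs1, hc1] at pyth
    rw [eXx, eYx, hX1] at d1
    rw [hs1, hc1] at d2 d4 d5
    rw [eXxx, eXx, eYxx, hX1] at d3
    refine ⟨?_, ?_, ?_, ?_, ?_, ?_⟩
    · rw [coeffE, d1, linner_frame e1 e2]
      linear_combination (k q.1 ^ 2 * q.2 ^ 4 * (1 / 2 + q.2 * X q) ^ 2 + q.2 ^ 6 * pdx X q ^ 2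
        - q.2 ^ 6 * pdx Y q ^ 2) * hσ
    · rw [coeffF, d1, d2, linner_frame e1 e2]
      linear_combination (q.2 ^ 4 * (1 + q.2 * c q) * pdx X q
        - q.2 ^ 5 * pdx Y q * (m (q.1, 0) + q.2 * s q)) * hσ
    · rw [coeffG, d2, linner_frame e1 e2]
      linear_combination (q.2 ^ 2 * (1 + q.2 * c q) ^ 2
        - q.2 ^ 4 * (m (q.1, 0) + q.2 * s q) ^ 2) * hσ
    · rw [tildeL, d1, d2, d3, det3_frame e1]
      congr 1
      rcases nf.sign with h | h <;> rw [h] <;> ring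
    · rw [tildeM, d1, d2, d4, det3_frame e1]
      congr 1
      rcases nf.sign with h | h <;> rw [h] <;> ring
    · rw [tildeN, d1, d2, d5, det3_frame e1]
      congr 1
      rcases nf.sign with h | h <;> rw [h]
      · linear_combination (q.2 ^ 2 * (1 - k q.1 * q.2 ^ 2 * (1 / 2 + q.2 * X q)) * m q) * pyth
          + q.2 ^ 2 * hmq
      · linear_combination (q.2 ^ 2 * (1 + k q.1 * q.2 ^ 2 * (1 / 2 + q.2 * X q)) * m q) * pyth
          + q.2 ^ 2 * hmq
  · intro u
    refine ⟨?_, ?_, ?_, ?_, ?_, ?_⟩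
    · simp [hX0, hYx0]; ring
    · simp [hs0]; ring
    · simp [hc0]
    · simp [hs0]
      linear_combination (deriv k u / 2) * hσ
    · simp [avg_axis, hc0]
    · simp [hm0]

end Forms

/-! ### The order of an edge -/

section Order

theorem iteratedDeriv_id_mul {h : ℝ → ℝ} (hh : ContDiff ℝ ∞ h) (n : ℕ) :
    iteratedDeriv (n + 1) (fun t => t * h t) =
      fun t => t * iteratedDeriv (n + 1) h t + (n + 1) * iteratedDeriv n h t := by
  have hd : ∀ k t, HasDerivAt (iteratedDeriv k h) (iteratedDeriv (k + 1) h t) t := fun k t => by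
    rw [iteratedDeriv_succ]
    exact ((hh.differentiable_iteratedDeriv k (by exact_mod_cast ENat.natCast_lt_top k)) t).hasDerivAt
  induction n with
  | zero =>
    ext t
    rw [iteratedDeriv_succ, iteratedDeriv_zero]
    have := ((hasDerivAt_id t).mul (hd 0 t)).deriv
    simp only [iteratedDeriv_zero, id] at this
    rw [show (fun t => t * h t) = id * h from rfl, this]; simp; ring
  | succ n ih =>
    rw [iteratedDeriv_succ, ih]
    ext t
    have := (((hasDerivAt_id t).mul (hd (n + 1) t)).add ((hd n t).const_mul ((n : ℝ) + 1))).deriv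
    refine this.trans ?_
    simp only [id]; push_cast; ring

theorem iteratedDeriv_taylorTail {y : ℝ × ℝ → ℝ} (hy : ContDiff ℝ ∞ y) (u : ℝ) (k j : ℕ) :
    iteratedDeriv (k + 1) (fun t => taylorTail y j (u, t)) 0 =
      (k + 1) * iteratedDeriv k (fun t => taylorTail y (j + 1) (u, t)) 0 := by
  have h : (fun t => taylorTail y j (u, t)) =
      fun t => taylorTail y j (u, 0) + t * taylorTail y (j + 1) (u, t) :=
    funext fun t => eq_axis_add_mul_avg (contDiff_taylorTail hy j) u t
  have hs : ContDiff ℝ ∞ fun t => taylorTail y (j + 1) (u, t) :=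
    (contDiff_taylorTail hy (j + 1)).comp (contDiff_const.prodMk contDiff_id)
  rw [h, iteratedDeriv_const_add (by omega), iteratedDeriv_id_mul hs]
  simp

/-- Each derivative at the axis strips one factor `t` from the expansion, so the iterated remainders
evaluated there are the Taylor coefficients. -/
theorem iteratedDeriv_eq_taylorTail {y : ℝ × ℝ → ℝ} (hy : ContDiff ℝ ∞ y) (u : ℝ) (k : ℕ) :
    iteratedDeriv k (fun t => y (u, t)) 0 = k.factorial * taylorTail y k (u, 0) := by
  have : ∀ k j, iteratedDeriv k (fun t => taylorTail y j (u, t)) 0 =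
      k.factorial * taylorTail y (j + k) (u, 0) := by
    intro k
    induction k with
    | zero => intro j; simp
    | succ k ih =>
      intro j
      rw [iteratedDeriv_taylorTail hy, ih, Nat.factorial_succ, show j + 1 + k = j + (k + 1) by omega]
      push_cast; ring
  have h := this k 0
  rw [zero_add] at h
  exact h

theorem edgeOrder_eq_four {f : ℝ × ℝ → Vec3} {s : ℝ} (h : edgeOrder f s = 4) :
    (∀ k < 4, iteratedDeriv k (fun t : ℝ => deltaL f (s, t)) 0 = 0) ∧
      iteratedDeriv 4 (fun t : ℝ => deltaL f (s, t)) 0 ≠ 0 := by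
  have h1 : ∀ k < 4, iteratedDeriv k (fun t : ℝ => deltaL f (s, t)) 0 = 0 := by
    intro k hk
    by_contra hne
    have : edgeOrder f s ≤ k := iInf₂_le k hne
    rw [h] at this
    have : 4 ≤ k := by exact_mod_cast this
    omega
  refine ⟨h1, fun h4 => ?_⟩
  have : (5 : ℕ∞) ≤ edgeOrder f s := by
    refine le_iInf₂ fun k hk => ?_
    have h5 : 5 ≤ k := by
      by_contra hlt
      rcases (by omega : k < 4 ∨ k = 4) with h | rfl
      · exact hk (h1 k h)
      · exact hk h4
    exact_mod_cast h5
  rw [h] at this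
  exact absurd this (by decide)

theorem SmoothNear.linner {E : Type*} [NormedAddCommGroup E] [NormedSpace ℝ E] {g h : E → Vec3}
    {p : E} (hg : SmoothNear g p) (hh : SmoothNear h p) :
    SmoothNear (fun x => Minkowski.linner (g x) (h x)) p := by
  filter_upwards [hg.apply 0, hg.apply 1, hg.apply 2, hh.apply 0, hh.apply 1, hh.apply 2]
    with x h1 h2 h3 h4 h5 h6
  exact ((h1.mul h4).add (h2.mul h5)).sub (h3.mul h6)

theorem smoothNear_deltaL {f : ℝ × ℝ → Vec3} {q : ℝ × ℝ} (hf : SmoothNear f q) :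
    SmoothNear (deltaL f) q := by
  have hS : SmoothNear (dS f) q := hf.pdx
  have hT : SmoothNear (dT f) q := hf.pdy
  filter_upwards [hS.linner hS, hS.linner hT, hT.linner hT] with x h1 h2 h3
  exact (h1.mul h3).sub (h2.pow 2)

/-- Order four at every nearby point of the axis kills the first four Taylor coefficients for all
such `u`, not only for `s₀`. This makes `Δ` divisible by `t⁴` as a function of two variables; the
quotient at `p` is the fourth coefficient. -/
theorem exists_deltaL_eq {I : Set ℝ} {δ : ℝ} {f : ℝ × ℝ → Vec3} {s₀ : ℝ}
    (hI : IsOpen I) (hδ : 0 < δ) (hf : IsOrderFourEdge I δ f) (hs₀ : s₀ ∈ I) :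
    ∃ D : ℝ × ℝ → ℝ, ContDiff ℝ ∞ D ∧ (∀ᶠ q in 𝓝 (s₀, (0 : ℝ)), deltaL f q = q.2 ^ 4 * D q) ∧
      D (s₀, 0) ≠ 0 := by
  obtain ⟨g, hg, hfg⟩ := (smoothNear_deltaL
    (smoothNear_edge hI hf (axis_mem hδ hs₀))).exists_contDiff
  have hit : ∀ᶠ u in 𝓝 s₀, ∀ k, iteratedDeriv k (fun t : ℝ => deltaL f (u, t)) 0 =
      k.factorial * taylorTail g k (u, 0) := by
    filter_upwards [(tendsto_axis s₀).eventually hfg.eventually_nhds] with u hu k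
    rw [← iteratedDeriv_eq_taylorTail hg]
    refine Filter.EventuallyEq.iteratedDeriv_eq k ?_
    exact ((by fun_prop : Continuous fun t : ℝ => (u, t)).tendsto 0).eventually hu
  refine ⟨taylorTail g 4, contDiff_taylorTail hg 4, ?_, fun h0 => ?_⟩
  · have hfst : Tendsto Prod.fst (𝓝 (s₀, (0 : ℝ))) (𝓝 s₀) := continuous_fst.tendsto _
    filter_upwards [hfst.eventually hit, hfst.eventually (hI.mem_nhds hs₀), hfg] with q h1 h2 h3
    have hz : ∀ k < 4, taylorTail g k (q.1, 0) = 0 := fun k hk => by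
      have := h1 k
      rw [(edgeOrder_eq_four (hf.order_eq _ h2)).1 k hk] at this
      simpa [Nat.factorial_ne_zero] using this.symm
    have hst : ∀ k < 4, taylorTail g k q = q.2 * taylorTail g (k + 1) q := fun k hk => by
      have := eq_axis_add_mul_avg (contDiff_taylorTail hg k) q.1 q.2
      rw [hz k hk, zero_add] at this
      exact this
    rw [h3, show g q = taylorTail g 0 q from rfl, hst 0 (by omega), hst 1 (by omega),
      hst 2 (by omega), hst 3 (by omega)]
    ring
  · have := hit.self_of_nhds 4
    rw [h0, mul_zero] at this
    exact (edgeOrder_eq_four (hf.order_eq _ hs₀)).2 this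

instance neBot_offAxis (u : ℝ) : (𝓝[{q : ℝ × ℝ | q.2 ≠ 0}] (u, (0 : ℝ))).NeBot := by
  have hd : Dense {q : ℝ × ℝ | q.2 ≠ 0} :=
    (dense_compl_singleton (0 : ℝ)).preimage isOpenMap_snd
  exact mem_closure_iff_nhdsWithin_neBot.1 (hd _)

theorem eq_of_pow_mul_eq {g h : ℝ × ℝ → ℝ} {u : ℝ} (n : ℕ) (hg : ContinuousAt g (u, 0))
    (hh : ContinuousAt h (u, 0)) (H : ∀ᶠ q in 𝓝 (u, (0 : ℝ)), q.2 ^ n * g q = q.2 ^ n * h q) :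
    g (u, 0) = h (u, 0) := by
  refine tendsto_nhds_unique_of_eventuallyEq (l := 𝓝[{q : ℝ × ℝ | q.2 ≠ 0}] (u, (0 : ℝ)))
    (hg.tendsto.mono_left nhdsWithin_le_nhds) (hh.tendsto.mono_left nhdsWithin_le_nhds) ?_
  filter_upwards [nhdsWithin_le_nhds H, self_mem_nhdsWithin] with q h1 h2
  exact mul_left_cancel₀ (pow_ne_zero n h2) h1

end Order

/-! ### Leading terms of the discriminant and of the curvature numerators; non-degeneracy. -/

section Core

variable {I : Set ℝ} {δ : ℝ} {f : ℝ × ℝ → Vec3} {s₀ σ : ℝ} {m : ℝ × ℝ → ℝ} {φ : ℝ × ℝ → ℝ × ℝ}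

/-- Multiplying the expansions, the `w⁴` terms `-σκμ₀ + 2σκμ₀ - σκμ₀` of the mean curvature
numerator cancel, so it starts at `w⁵`. That is why `H^L` has at most a simple pole in `w`, with the
displayed coefficient as the obstruction. -/
theorem NormalForm.exists_invariants (hI : IsOpen I) (hδ : 0 < δ) (hf : IsOrderFourEdge I δ f)
    (harc : IsArcLengthProjection I f) (hs₀ : s₀ ∈ I) (nf : NormalForm I δ f s₀ σ m φ)
    {k : ℝ → ℝ} (hk : ContDiff ℝ ∞ k) (hkκ : planeCurvature f =ᶠ[𝓝 s₀] k) :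
    ∃ D K H₁ U : ℝ × ℝ → ℝ, ContDiff ℝ ∞ D ∧ ContDiff ℝ ∞ K ∧ ContDiff ℝ ∞ H₁ ∧ ContDiff ℝ ∞ U ∧
      (∀ᶠ q in 𝓝 (s₀, (0 : ℝ)),
        deltaL (fun x => f (φ x)) q = q.2 ^ 4 * D q ∧
        detNum (fun x => f (φ x)) q = q.2 ^ 4 * K q ∧
        meanNum (fun x => f (φ x)) q = vel f q.1 2 * (q.2 ^ 5 *
          (σ / 6 * (8 * m (q.1, 0) * pdx m (q.1, 0) + 3 * σ * deriv k q.1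
            - 3 * k q.1 * pdy m (q.1, 0)) + q.2 * H₁ q)) ∧
        coeffF (fun x => f (φ x)) q * tildeN (fun x => f (φ x)) q -
          coeffG (fun x => f (φ x)) q * tildeM (fun x => f (φ x)) q =
            vel f q.1 2 * (q.2 ^ 4 * U q)) ∧
      ∀ u, D (u, 0) = -(σ * k u + m (u, 0) ^ 2) ∧ K (u, 0) = -(k u * (σ * m (u, 0) ^ 2 + k u)) ∧
        U (u, 0) = -(σ * m (u, 0) ^ 2 + k u) := by
  have hm := nf.smooth_mu
  have hσ : σ ^ 2 = 1 := by rcases nf.sign with h | h <;> simp [h]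
  obtain ⟨E₁, F₁, G₁, L₁, M₁, N₁, hE, hF, hG, hL, hM, hN, hev, h0⟩ :=
    nf.exists_expansion hI hδ hf harc hs₀ hk hkκ
  have hma : ContDiff ℝ ∞ fun q : ℝ × ℝ => m (q.1, 0) :=
    hm.comp (contDiff_fst.prodMk contDiff_const)
  have hka : ContDiff ℝ ∞ fun q : ℝ × ℝ => k q.1 := hk.comp contDiff_fst
  have hA : ContDiff ℝ ∞ fun q : ℝ × ℝ => L₁ q + G₁ q * (-σ * k q.1 * m (q.1, 0))
      - 2 * (-σ * m (q.1, 0) * M₁ q + F₁ q * k q.1) - σ * k q.1 * N₁ q + E₁ q * m (q.1, 0)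
      + q.2 * (G₁ q * L₁ q - 2 * F₁ q * M₁ q + E₁ q * N₁ q) := by fun_prop
  obtain ⟨H₁, hH₁, hH, -⟩ := exists_eq_axis_add_mul hA
  refine ⟨fun q => (-σ * k q.1 + q.2 * E₁ q) * (1 + q.2 * G₁ q)
      - (-σ * m (q.1, 0) + q.2 * F₁ q) ^ 2,
    fun q => (-σ * k q.1 * m (q.1, 0) + q.2 * L₁ q) * (m (q.1, 0) + q.2 * N₁ q)
      - (k q.1 + q.2 * M₁ q) ^ 2, H₁,
    fun q => (-σ * m (q.1, 0) + q.2 * F₁ q) * (m (q.1, 0) + q.2 * N₁ q)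
      - (1 + q.2 * G₁ q) * (k q.1 + q.2 * M₁ q),
    by fun_prop, by fun_prop, hH₁, by fun_prop, ?_, fun u => ⟨?_, ?_, ?_⟩⟩
  · have hmem : ∀ᶠ q in 𝓝 (s₀, (0 : ℝ)), q.1 ∈ I :=
      (continuous_fst.tendsto (s₀, (0 : ℝ))).eventually (hI.mem_nhds hs₀)
    filter_upwards [hev, hmem] with q ⟨e, F, g, l, M, n⟩ hq
    have e2 := vel_vertical_sq hf harc hq
    refine ⟨?_, ?_, ?_, ?_⟩
    · rw [deltaL, e, F, g]; ring
    · rw [detNum, l, M, n]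
      linear_combination (q.2 ^ 4 * ((-σ * k q.1 * m (q.1, 0) + q.2 * L₁ q)
        * (m (q.1, 0) + q.2 * N₁ q) - (k q.1 + q.2 * M₁ q) ^ 2)) * e2
    · rw [meanNum, e, F, g, l, M, n]
      have h1 := hH q.1 q.2
      obtain ⟨z1, z2, z3, z4, z5, z6⟩ := h0 q.1
      simp only [z1, z2, z3, z4, z5, z6, Prod.mk.eta] at h1
      have h2 : σ / 6 * (8 * m (q.1, 0) * pdx m (q.1, 0) + 3 * σ * deriv k q.1
            - 3 * k q.1 * pdy m (q.1, 0)) + q.2 * H₁ q = L₁ q + G₁ q * (-σ * k q.1 * m (q.1, 0))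
      - 2 * (-σ * m (q.1, 0) * M₁ q + F₁ q * k q.1) - σ * k q.1 * N₁ q + E₁ q * m (q.1, 0)
      + q.2 * (G₁ q * L₁ q - 2 * F₁ q * M₁ q + E₁ q * N₁ q) := by
        rw [h1]
        linear_combination (deriv k q.1 / 2) * hσ
      rw [h2]; ring
    · rw [F, n, g, M]; ring
  · simp; linear_combination -(m (u, 0) ^ 2) * hσ
  · simp; ring
  · simp; ring

/-- The second component of the coordinate change is divisible by `w`. -/
theorem NormalForm.exists_snd_eq (nf : NormalForm I δ f s₀ σ m φ) :
    ∃ ψ : ℝ × ℝ → ℝ, ContDiff ℝ ∞ ψ ∧ (∀ᶠ q in 𝓝 (s₀, (0 : ℝ)), (φ q).2 = q.2 * ψ q) ∧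
      0 < ψ (s₀, 0) := by
  have hs : SmoothNear (fun q => (φ q).2) (s₀, (0 : ℝ)) := by
    filter_upwards [nf.smooth] with q hq using hq.snd
  obtain ⟨g, hg, hφg⟩ := hs.exists_contDiff
  obtain ⟨ψ, hψ, h, h0⟩ := exists_eq_axis_add_mul hg
  refine ⟨ψ, hψ, ?_, ?_⟩
  · have hax : ∀ᶠ u in 𝓝 s₀, g (u, 0) = 0 := by
      filter_upwards [nf.fix_axis, (tendsto_axis s₀).eventually hφg] with u h1 h2
      rw [← h2, h1]
    filter_upwards [hφg, (continuous_fst.tendsto (s₀, (0 : ℝ))).eventually hax] with q h1 h2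
    rw [h1]
    have := h q.1 q.2
    rw [h2, zero_add] at this
    exact this
  · rw [h0, ← (pdy_congr hφg).eq_of_nhds]
    have h1 := nf.t_v.self_of_nhds
    have h2 := hasDerivAt_snd (u := s₀) (w := 0) nf.smooth.differentiableAt
    have h3 := pdy_eq hs.differentiableAt h2.snd
    rw [h3]; exact h1

theorem NormalForm.jac_axis (nf : NormalForm I δ f s₀ σ m φ) :
    pdx φ (s₀, 0) = (1, 0) ∧ pdy φ (s₀, 0) = (0, (pdy φ (s₀, 0)).2) ∧ 0 < (pdy φ (s₀, 0)).2 := by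
  refine ⟨?_, ?_, nf.t_v.self_of_nhds⟩
  · refine (hasDerivAt_fst (u := s₀) (w := 0) nf.smooth.differentiableAt).unique ?_
    refine ((hasDerivAt_id s₀).prodMk (hasDerivAt_const s₀ (0 : ℝ))).congr_of_eventuallyEq ?_
    exact nf.fix_axis
  · ext
    · exact nf.s_v.self_of_nhds
    · rfl

theorem NormalForm.jac_pos (nf : NormalForm I δ f s₀ σ m φ) : 0 < jac φ (s₀, 0) := by
  obtain ⟨h1, h2, h3⟩ := nf.jac_axis
  rw [jac, h1, h2]; simpa using h3

theorem NormalForm.continuousAt_jac (nf : NormalForm I δ f s₀ σ m φ) :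
    ContinuousAt (jac φ) (s₀, 0) := by
  have h1 := nf.smooth.pdx.continuousAt
  have h2 := nf.smooth.pdy.continuousAt
  exact (h1.fst.mul h2.snd).sub (h1.snd.mul h2.fst)

/-- A generalized cuspidal edge of order four has `σ κ + μ₀² ≠ 0`. -/
theorem NormalForm.nondegenerate (hI : IsOpen I) (hδ : 0 < δ) (hf : IsOrderFourEdge I δ f)
    (harc : IsArcLengthProjection I f) (hs₀ : s₀ ∈ I) (nf : NormalForm I δ f s₀ σ m φ) :
    σ * planeCurvature f s₀ + m (s₀, 0) ^ 2 ≠ 0 := by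
  obtain ⟨k, hk, hkκ⟩ := (smoothNear_planeCurvature hI hδ hf hs₀).exists_contDiff
  obtain ⟨D, K, H₁, U, hD, -, -, -, hev, h0⟩ :=
    nf.exists_invariants hI hδ hf harc hs₀ hk hkκ
  obtain ⟨D', hD', hev', hD0⟩ := exists_deltaL_eq hI hδ hf hs₀
  obtain ⟨ψ, hψ, hψe, hψ0⟩ := nf.exists_snd_eq
  have hφ0 : φ (s₀, 0) = (s₀, 0) := nf.fix_axis.self_of_nhds
  have hc := nf.smooth.continuousAt
  have ht : Tendsto φ (𝓝 (s₀, 0)) (𝓝 (s₀, 0)) := by simpa [ContinuousAt, hφ0] using hc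
  have hcont : ContinuousAt (fun q => jac φ q ^ 2 * (ψ q ^ 4 * D' (φ q))) (s₀, 0) :=
    (nf.continuousAt_jac.pow 2).mul ((hψ.continuous.continuousAt.pow 4).mul
      (hD'.continuous.continuousAt.comp hc))
  have hsm : ∀ᶠ q in 𝓝 (s₀, (0 : ℝ)), SmoothNear f (φ q) := by
    filter_upwards [nf.mem] with q hq using smoothNear_edge hI hf hq
  -- The discriminant of `f ∘ φ` is factored twice: by the expansion in the frame, and through the
  -- order of `f` and the Jacobian. Cancelling `w⁴` and letting `w → 0` compares the leading
  -- coefficients.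
  have key := eq_of_pow_mul_eq 4 hD.continuous.continuousAt hcont (by
    filter_upwards [hev, ht.eventually hev', hψe, hsm, nf.smooth.eventually]
      with q h1 h2 h3 h4 h5
    rw [← h1.1, deltaL_comp h4 h5, h2, h3]; ring)
  rw [(h0 s₀).1, ← hkκ.eq_of_nhds, hφ0] at key
  intro h
  rw [h, neg_zero] at key
  have : 0 ≠ jac φ (s₀, 0) ^ 2 * (ψ (s₀, 0) ^ 4 * D' (s₀, 0)) :=
    (mul_ne_zero (pow_ne_zero _ nf.jac_pos.ne') (mul_ne_zero (pow_ne_zero _ hψ0.ne') hD0)).symm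
  exact this key

end Core

/-! ### Curvatures near the singular set -/

section Curvature

variable {I : Set ℝ} {δ : ℝ} {f : ℝ × ℝ → Vec3} {s₀ σ : ℝ} {m : ℝ × ℝ → ℝ} {φ : ℝ × ℝ → ℝ × ℝ}

theorem dT_axis (hf : IsOrderFourEdge I δ f) {u : ℝ} (hu : u ∈ I) : dT f (u, 0) = 0 :=
  hf.edge.dT_eq_zero u hu

theorem dS_axis (hI : IsOpen I) (hδ : 0 < δ) (hf : IsOrderFourEdge I δ f) {u : ℝ} (hu : u ∈ I) :
    dS f (u, 0) = vel f u :=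
  (hasDerivAt_fst (smoothNear_edge hI hf (axis_mem hδ hu)).differentiableAt).deriv.symm

theorem deltaL_axis (hf : IsOrderFourEdge I δ f) {u : ℝ} (hu : u ∈ I) : deltaL f (u, 0) = 0 := by
  simp [deltaL, coeffG, coeffF, linner, dT_axis hf hu]

/-- The singular curvature is `σ κ / 2`. -/
theorem NormalForm.singularCurvature_eq (hI : IsOpen I) (hδ : 0 < δ) (hf : IsOrderFourEdge I δ f)
    (harc : IsArcLengthProjection I f) (hs₀ : s₀ ∈ I) (nf : NormalForm I δ f s₀ σ m φ) :
    ∀ᶠ u in 𝓝 s₀, singularCurvature f u = σ * planeCurvature f u / 2 := by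
  obtain ⟨k, hk, hkκ⟩ := (smoothNear_planeCurvature hI hδ hf hs₀).exists_contDiff
  have hσ : σ ^ 2 = 1 := by rcases nf.sign with h | h <;> simp [h]
  filter_upwards [(tendsto_axis s₀).eventually (nf.derivs hI hδ hf harc hs₀ hk hkκ),
    (tendsto_axis s₀).eventually nf.smooth.eventually, hI.mem_nhds hs₀, nf.fix_axis, nf.s_v,
    nf.t_v] with u hN hφ hu hfix hs ht
  have e1 := harc u hu
  have e2 := vel_vertical_sq hf harc hu
  have h1 := hN.dT_dT_eq
  have hsf : SmoothNear f (φ (u, 0)) := by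
    rw [hfix]; exact smoothNear_edge hI hf (axis_mem hδ hu)
  rw [dT_dT_comp hsf hφ, hfix, hs, dT_axis hf hu, dS_axis hI hδ hf hu, vel_eq_frame, frame_smul,
    angle_axis] at h1
  set α := pdy (fun x => (pdy φ x).1) (u, 0)
  set d := (pdy φ (u, 0)).2
  -- On the axis `f_t = 0` and `φ_w = (0, d)`, so the chain rule determines `f_tt` up to a multiple
  -- `α` of `Γ'`. The projection defining the cuspidal direction removes this multiple.
  have h2 : dT (dT f) (u, 0) = frame f u (-α / d ^ 2) (σ / d ^ 2) (-α / d ^ 2) := by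
    have h3 : d ^ 2 • dT (dT f) (u, 0) = frame f u (-α) σ (-α) := by
      have h4 : d ^ 2 • dT (dT f) (u, 0) = frame f u 0 σ 0 + (-1 : ℝ) • frame f u α 0 α := by
        simp at h1
        rw [← h1]; module
      rw [h4, frame_smul, frame_add]; congr 1 <;> ring
    have h5 : dT (dT f) (u, 0) = (d ^ 2)⁻¹ • (d ^ 2 • dT (dT f) (u, 0)) := by
      rw [smul_smul, inv_mul_cancel₀ (by positivity), one_smul]
    rw [h5, h3, frame_smul]; congr 1 <;> ring
  have h3 : cuspDir f u = frame f u 0 (σ / d ^ 2) 0 := by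
    rw [cuspDir, h2, vel_eq_frame, dot_frame e1 e2, dot_frame e1 e2, sub_eq_add_neg, ← neg_smul,
      frame_smul, frame_add]
    congr 1 <;> ring
  have h4 : √(cuspDir f u ⬝ᵥ cuspDir f u) = 1 / d ^ 2 := by
    rw [h3, dot_frame e1 e2, show (0 : ℝ) * 0 + σ / d ^ 2 * (σ / d ^ 2) + 0 * 0 = (1 / d ^ 2) ^ 2 by
      rw [div_pow, one_pow, ← hσ]; ring]
    exact Real.sqrt_sq (by positivity)
  rw [singularCurvature, h4, h3, frame_smul, acc_eq_frame hI hδ hf harc hu, vel_eq_frame,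
    dot_frame e1 e2, dot_frame e1 e2]
  field_simp
  ring

/-- Near the singular set, the invariants of `f` are governed by functions `D`, `K`, `H`. -/
theorem NormalForm.exists_curvatures (hI : IsOpen I) (hδ : 0 < δ) (hf : IsOrderFourEdge I δ f)
    (harc : IsArcLengthProjection I f) (hs₀ : s₀ ∈ I) (nf : NormalForm I δ f s₀ σ m φ)
    {k : ℝ → ℝ} (hk : ContDiff ℝ ∞ k) (hkκ : planeCurvature f =ᶠ[𝓝 s₀] k) :
    ∃ D K H₁ : ℝ × ℝ → ℝ, ContDiff ℝ ∞ D ∧ ContDiff ℝ ∞ K ∧ ContDiff ℝ ∞ H₁ ∧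
      (∀ᶠ q in 𝓝 (s₀, (0 : ℝ)), q.2 ≠ 0 →
        (0 < deltaL f (φ q) ↔ 0 < D q) ∧ (deltaL f (φ q) < 0 ↔ D q < 0) ∧
        gaussL f (φ q) = -K q / (D q ^ 2 * q.2 ^ 4) ∧
        (weingarten f (φ q)).det = K q / (D q * |D q| * q.2 ^ 4) ∧
        (weingarten f (φ q)).trace = vel f q.1 2 *
          (σ / 6 * (8 * m (q.1, 0) * pdx m (q.1, 0) + 3 * σ * deriv k q.1
            - 3 * k q.1 * pdy m (q.1, 0)) + q.2 * H₁ q) / (D q * √|D q| * q.2) ∧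
        ¬ IsUmbilic f (φ q)) ∧
      ∀ u, D (u, 0) = -(σ * k u + m (u, 0) ^ 2) ∧
        K (u, 0) = -(k u * (σ * m (u, 0) ^ 2 + k u)) := by
  have hσ : σ ^ 2 = 1 := by rcases nf.sign with h | h <;> simp [h]
  obtain ⟨D, K, H₁, U, hD, hK, hH, hU, hev, h0⟩ :=
    nf.exists_invariants hI hδ hf harc hs₀ hk hkκ
  have hnd := nf.nondegenerate hI hδ hf harc hs₀
  rw [hkκ.eq_of_nhds] at hnd
  refine ⟨D, K, H₁, hD, hK, hH, ?_, fun u => ⟨(h0 u).1, (h0 u).2.1⟩⟩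
  -- This value is `-σ(σκ + μ₀²)`, so the order-four condition alone excludes umbilics.
  have hU0 : U (s₀, 0) ≠ 0 := by
    rw [(h0 s₀).2.2]
    intro h
    apply hnd
    linear_combination -σ * h - m (s₀, 0) ^ 2 * hσ
  have hD0 : D (s₀, 0) ≠ 0 := by rw [(h0 s₀).1]; exact neg_ne_zero.2 hnd
  have hmem : ∀ᶠ q in 𝓝 (s₀, (0 : ℝ)), q.1 ∈ I :=
    (continuous_fst.tendsto (s₀, (0 : ℝ))).eventually (hI.mem_nhds hs₀)
  filter_upwards [hev, nf.mem, nf.smooth.eventually,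
    nf.continuousAt_jac.eventually_const_lt nf.jac_pos,
    hU.continuous.continuousAt.eventually_ne hU0,
    hD.continuous.continuousAt.eventually_ne hD0, hmem] with q h1 h2 hφ hJ hUq hDq hq hw
  have hsf := smoothNear_edge hI hf h2
  obtain ⟨e1, e2, e3, e4⟩ := h1
  rw [deltaL_comp hsf hφ] at e1
  rw [detNum_comp hsf hφ] at e2
  rw [meanNum_comp hsf hφ] at e3
  set J := jac φ q
  have hΔ : deltaL f (φ q) = q.2 ^ 4 / J ^ 2 * D q := by
    field_simp; linear_combination e1
  have hdet : detNum f (φ q) = q.2 ^ 4 * K q / J ^ 4 := by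
    field_simp; linear_combination e2
  have hmean : meanNum f (φ q) = vel f q.1 2 * (q.2 ^ 5 *
          (σ / 6 * (8 * m (q.1, 0) * pdx m (q.1, 0) + 3 * σ * deriv k q.1
            - 3 * k q.1 * pdy m (q.1, 0)) + q.2 * H₁ q)) / J ^ 3 := by
    rw [eq_div_iff (by positivity), ← e3]; ring
  have hw4 : 0 < q.2 ^ 4 := by positivity
  have hpos : 0 < q.2 ^ 4 / J ^ 2 := by positivity
  have habs : |deltaL f (φ q)| = q.2 ^ 4 / J ^ 2 * |D q| := by
    rw [hΔ, abs_mul, abs_of_pos hpos]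
  have hsqrt : √|deltaL f (φ q)| = q.2 ^ 2 / J * √|D q| := by
    rw [habs, Real.sqrt_mul hpos.le, show q.2 ^ 4 / J ^ 2 = (q.2 ^ 2 / J) ^ 2 by
      rw [div_pow]; ring, Real.sqrt_sq (by positivity)]
  have hDs : √|D q| ≠ 0 := Real.sqrt_ne_zero'.2 (abs_pos.2 hDq)
  have hDa : |D q| ≠ 0 := abs_ne_zero.2 hDq
  refine ⟨?_, ?_, ?_, ?_, ?_, fun hum => ?_⟩
  · rw [hΔ, mul_pos_iff_of_pos_left hpos]
  · rw [hΔ, mul_neg_iff]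
    constructor
    · rintro (⟨-, h⟩ | ⟨h, -⟩)
      · exact h
      · exact absurd h hpos.le.not_gt
    · exact fun h => Or.inl ⟨hpos, h⟩
  · rw [gaussL, show tildeL f (φ q) * tildeN f (φ q) - tildeM f (φ q) ^ 2 = detNum f (φ q) from rfl,
      hdet, hΔ]
    field_simp
  · rw [weingarten_det (by rw [hΔ]; exact mul_ne_zero hpos.ne' hDq), hdet, habs, hΔ]
    field_simp
  · rw [weingarten_trace, hmean, hsqrt, hΔ]
    field_simp
  · obtain ⟨z1, z2, z3⟩ := hum.eq_zero
    -- Proportionality of the two fundamental matrices is independent of coordinates: the relations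
    -- for `f` at `φ q` imply the corresponding one for `f ∘ φ` at `q`.
    have : coeffF (fun x => f (φ x)) q * tildeN (fun x => f (φ x)) q -
          coeffG (fun x => f (φ x)) q * tildeM (fun x => f (φ x)) q = 0 := by
      rw [coeffF_comp hsf hφ, coeffG_comp hsf hφ, tildeM_comp hsf hφ, tildeN_comp hsf hφ]
      set a := (pdx φ q).1
      set b := (pdx φ q).2
      set c := (pdy φ q).1
      set d := (pdy φ q).2
      linear_combination (jac φ q * (a * d - b * c)) * (d ^ 2 * z1 + c ^ 2 * z2 + c * d * z3)
    rw [e4] at this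
    have hv : vel f q.1 2 ≠ 0 := fun h => by
      have := vel_vertical_sq hf harc hq
      simp [h] at this
    simp [hv, hw, hUq] at this

theorem NormalForm.exists_chart (nf : NormalForm I δ f s₀ σ m φ) {S : Set (ℝ × ℝ)}
    (hS : S ∈ 𝓝 (s₀, (0 : ℝ))) :
    ∃ e : OpenPartialHomeomorph (ℝ × ℝ) (ℝ × ℝ), (s₀, 0) ∈ e.source ∧ e.source ⊆ S ∧
      (∀ x, e x = φ x) ∧ ContDiffOn ℝ ∞ e e.source ∧ ContDiffOn ℝ ∞ e.symm e.target := by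
  obtain ⟨h1, h2, h3⟩ := nf.jac_axis
  refine nf.smooth.exists_openPartialHomeomorph rfl (fun v hv => ?_) hS
  rw [fderiv_apply_eq, h1, h2] at hv
  have hv1 := congrArg Prod.fst hv
  have hv2 := congrArg Prod.snd hv
  simp [h3.ne'] at hv1 hv2
  ext <;> simp [hv1, hv2]

/-- The neighbourhoods `V` are images of boxes under `φ`. They are open because `φ` is a local
diffeomorphism at `p`. -/
theorem NormalForm.exists_box (nf : NormalForm I δ f s₀ σ m φ) {G : ℝ × ℝ → Prop}
    (hG : ∀ᶠ q in 𝓝 (s₀, (0 : ℝ)), G q) :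
    ∃ r, 0 < r ∧ (∀ q ∈ box s₀ r, G q) ∧ IsOpen (φ '' box s₀ r) := by
  obtain ⟨e, he, hes, heq, -, -⟩ := nf.exists_chart (eventually_mem_set.1 hG)
  obtain ⟨r, hr, hb⟩ := exists_box_subset (e.open_source.mem_nhds he)
  refine ⟨r, hr, fun q hq => hes (hb hq), ?_⟩
  rw [← funext heq]
  exact e.isOpen_image_of_subset_source (isOpen_Ioo.prod isOpen_Ioo) hb

end Curvature

/-! ### Reality and growth of the roots of a quadratic polynomial. -/

section Roots

/-- A root with non-zero imaginary part has `2 Re k = t`, and then the discriminant would be `-4 (Im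
k)² < 0`. -/
theorem im_eq_zero_of_discrim {k : ℂ} {t d : ℝ} (h : k ^ 2 - (t : ℂ) * k + (d : ℂ) = 0)
    (hd : 0 ≤ t ^ 2 - 4 * d) : k.im = 0 := by
  have hre := congrArg Complex.re h
  have him := congrArg Complex.im h
  simp [pow_two] at hre him
  by_contra hne
  have h1 : 2 * k.re = t := mul_right_cancel₀ hne (by linarith)
  nlinarith [mul_self_pos.2 hne]

theorem im_ne_zero_of_discrim {k : ℂ} {t d : ℝ} (h : k ^ 2 - (t : ℂ) * k + (d : ℂ) = 0)
    (hd : t ^ 2 - 4 * d < 0) : k.im ≠ 0 := by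
  have hre := congrArg Complex.re h
  simp [pow_two] at hre
  intro hk
  rw [hk] at hre
  nlinarith [sq_nonneg (2 * k.re - t)]

/-- If one root is bounded, the other is `O(1/w)` because the sum is, and so the product is
`O(1/w)`. This contradicts its growth of order `w⁻⁴`. -/
theorem false_of_bounded_root {r c B C : ℝ} (hr : 0 < r) (hc : 0 < c) {k₁ k₂ : ℝ → ℂ}
    {t d : ℝ → ℝ} (h : ∀ w ∈ Ioo 0 r, k₁ w + k₂ w = t w ∧ k₁ w * k₂ w = d w ∧ |t w| ≤ B / w ∧
      c / w ^ 4 ≤ |d w| ∧ ‖k₁ w‖ ≤ C) : False := by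
  have hB : 0 ≤ B := by
    obtain ⟨-, -, h3, -, -⟩ := h (r / 2) ⟨by linarith, by linarith⟩
    have := (abs_nonneg _).trans h3
    by_contra hB
    exact absurd this (not_le.2 (div_neg_of_neg_of_pos (not_le.1 hB) (by linarith)))
  have hC : 0 ≤ C := (norm_nonneg _).trans (h (r / 2) ⟨by linarith, by linarith⟩).2.2.2.2
  set Q := C * (B + C) with hQ
  have hQ0 : 0 ≤ Q := by positivity
  -- The contradiction needs `c ≤ Q w³` to fail. For `w ≤ 1` one has `w³ ≤ w`, and the last entry of
  -- the minimum makes `Q w` at most `c / 2`.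
  set w := min (r / 2) (min 1 (c / (2 * (Q + 1)))) with hw
  have hw0 : 0 < w := lt_min (by linarith) (lt_min one_pos (by positivity))
  have hwr : w < r := (min_le_left _ _).trans_lt (by linarith)
  have hw1 : w ≤ 1 := (min_le_right _ _).trans (min_le_left _ _)
  have hwc : w ≤ c / (2 * (Q + 1)) := (min_le_right _ _).trans (min_le_right _ _)
  obtain ⟨h1, h2, h3, h4, h5⟩ := h w ⟨hw0, hwr⟩
  have hk2 : ‖k₂ w‖ ≤ B / w + C := by
    have : k₂ w = (t w : ℂ) - k₁ w := by rw [← h1]; ring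
    rw [this]
    refine (norm_sub_le _ _).trans (add_le_add ?_ h5)
    rw [Complex.norm_real]; exact h3
  have hdn : |d w| ≤ C * (B / w + C) := by
    have : |d w| = ‖k₁ w‖ * ‖k₂ w‖ := by
      rw [← norm_mul, h2, Complex.norm_real, Real.norm_eq_abs]
    rw [this]
    exact mul_le_mul h5 hk2 (norm_nonneg _) hC
  have h6 : C ≤ C / w := by rw [le_div_iff₀ hw0]; nlinarith
  have h7 : c / w ^ 4 ≤ Q / w := by
    refine (h4.trans hdn).trans ?_
    rw [hQ, mul_div_assoc, add_div]
    exact mul_le_mul_of_nonneg_left (by linarith) hC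
  rw [div_le_div_iff₀ (by positivity) hw0] at h7
  have h8 : c ≤ Q * w ^ 3 := by
    have : c * w ≤ (Q * w ^ 3) * w := by linarith [h7, show Q * w ^ 4 = Q * w ^ 3 * w by ring]
    exact le_of_mul_le_mul_right this hw0
  have h9 : w ^ 3 ≤ w := by
    calc w ^ 3 ≤ w ^ 1 := pow_le_pow_of_le_one hw0.le hw1 (by norm_num)
      _ = w := pow_one w
  rw [le_div_iff₀ (by positivity)] at hwc
  nlinarith

theorem eq_zero_of_forall_abs_le {r h c : ℝ} (hr : 0 < r) (H : ∀ w ∈ Ioo 0 r, |h| ≤ w * c) :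
    h = 0 := by
  have hlim : Tendsto (fun w : ℝ => w * c) (𝓝[>] 0) (𝓝 0) := by
    have : Continuous fun w : ℝ => w * c := by fun_prop
    simpa using (this.tendsto 0).mono_left nhdsWithin_le_nhds
  have : |h| ≤ 0 := ge_of_tendsto hlim (by
    filter_upwards [Ioo_mem_nhdsGT hr] with w hw using H w hw)
  exact abs_nonpos_iff.1 this

end Roots

/-! ### Curvature estimates on boxes in normal coordinates. -/

section Main

variable {I : Set ℝ} {δ : ℝ} {f : ℝ × ℝ → Vec3} {s₀ σ : ℝ} {m : ℝ × ℝ → ℝ} {φ : ℝ × ℝ → ℝ × ℝ}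

/-- The geometric content of the functions `D`, `A`, `B`, `R`, `H` describing the curvatures of `f`
in normal coordinates: off the axis, at the point with coordinates `(u, w)`, the discriminant
has the sign of `D`, the Weingarten matrix has determinant `A / w ^ 4` and trace `± B / w`. -/
structure CurvatureData (I : Set ℝ) (δ : ℝ) (f : ℝ × ℝ → Vec3) (s₀ σ : ℝ) (m : ℝ × ℝ → ℝ)
    (φ : ℝ × ℝ → ℝ × ℝ) (W : Set (ℝ × ℝ)) (r : ℝ) (D A B : ℝ × ℝ → ℝ) (h : ℝ → ℝ)
    (a b R H : ℝ) : Prop where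
  pos : 0 < r
  isOpen : IsOpen (φ '' box s₀ r)
  mem : ∀ q ∈ box s₀ r, φ q ∈ W ∧ φ q ∈ edgeDomain I δ
  axis : ∀ u, (u, (0 : ℝ)) ∈ box s₀ r → φ (u, 0) = (u, 0)
  off_axis : ∀ q ∈ box s₀ r, (φ q).2 = 0 ↔ q.2 = 0
  delta_pos : ∀ q ∈ box s₀ r, q.2 ≠ 0 → (0 < deltaL f (φ q) ↔ 0 < D (s₀, 0))
  delta_neg : ∀ q ∈ box s₀ r, q.2 ≠ 0 → (deltaL f (φ q) < 0 ↔ D (s₀, 0) < 0)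
  gauss : ∀ q ∈ box s₀ r, q.2 ≠ 0 → gaussL f (φ q) * (SignType.sign (D (s₀, 0)) : ℝ)
    = -A q / q.2 ^ 4
  det : ∀ q ∈ box s₀ r, q.2 ≠ 0 → (weingarten f (φ q)).det = A q / q.2 ^ 4
  trace_abs : ∀ q ∈ box s₀ r, q.2 ≠ 0 → |(weingarten f (φ q)).trace| = |B q| / |q.2|
  not_umbilic : ∀ q ∈ box s₀ r, q.2 ≠ 0 → ¬ IsUmbilic f (φ q)
  B_le : ∀ q ∈ box s₀ r, |B q| ≤ b
  B_upper : ∀ q ∈ box s₀ r, |B q| ≤ H * (|h q.1| + |q.2|)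
  B_lower : ∀ q ∈ box s₀ r, |h q.1| ≤ R * (|B q| + |q.2|)
  A_ge : A (s₀, 0) ≠ 0 → ∀ q ∈ box s₀ r, a ≤ |A q| ∧ 0 < A q * A (s₀, 0) ∧
    q.2 ^ 2 * B q ^ 2 < 4 * |A q|
  R_nonneg : 0 ≤ R
  a_pos : A (s₀, 0) ≠ 0 → 0 < a

theorem eventually_abs_le {g : ℝ × ℝ → ℝ} {p : ℝ × ℝ} (hg : ContinuousAt g p) :
    ∀ᶠ q in 𝓝 p, |g q| ≤ |g p| + 1 := by
  filter_upwards [hg.abs.eventually_lt_const (lt_add_one |g p|)] with q hq using hq.le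

/-- The functions and constants are fixed before the neighbourhood `W` and the extra condition `G`.
Boxes can then be shrunk later with the same lower bound `a`, as the divergence of `K^L` requires.
-/
theorem NormalForm.exists_curvatureData (hI : IsOpen I) (hδ : 0 < δ) (hf : IsOrderFourEdge I δ f)
    (harc : IsArcLengthProjection I f) (hs₀ : s₀ ∈ I) (nf : NormalForm I δ f s₀ σ m φ)
    {k : ℝ → ℝ} (hk : ContDiff ℝ ∞ k) (hkκ : planeCurvature f =ᶠ[𝓝 s₀] k) :
    ∃ D A B : ℝ × ℝ → ℝ, ∃ a b R H : ℝ,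
      (∀ u, D (u, 0) = -(σ * k u + m (u, 0) ^ 2)) ∧ D (s₀, 0) ≠ 0 ∧
      (A (s₀, 0) * |D (s₀, 0)| = σ * k s₀) ∧
      ∀ W ∈ 𝓝 (s₀, (0 : ℝ)), ∀ G : ℝ × ℝ → Prop, (∀ᶠ q in 𝓝 (s₀, (0 : ℝ)), G q) →
      ∃ r, (∀ q ∈ box s₀ r, G q) ∧ CurvatureData I δ f s₀ σ m φ W r D A B
        (fun u => 8 * m (u, 0) * pdx m (u, 0) + 3 * σ * deriv k u - 3 * k u * pdy m (u, 0))
        a b R H := by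
  have hσ : σ ^ 2 = 1 := by rcases nf.sign with h | h <;> simp [h]
  have hσa : |σ| = 1 := by rcases nf.sign with h | h <;> simp [h]
  have hm := nf.smooth_mu
  obtain ⟨D, K, H₁, hD, hK, hH, hev, h0⟩ := nf.exists_curvatures hI hδ hf harc hs₀ hk hkκ
  have hnd := nf.nondegenerate hI hδ hf harc hs₀
  rw [hkκ.eq_of_nhds] at hnd
  obtain ⟨ψ, hψ, hψe, hψ0⟩ := nf.exists_snd_eq
  have hD0 : D (s₀, 0) ≠ 0 := by rw [(h0 s₀).1]; exact neg_ne_zero.2 hnd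
  have hDc : ContinuousAt D (s₀, 0) := hD.continuous.continuousAt
  let h : ℝ → ℝ := fun u =>
    8 * m (u, 0) * pdx m (u, 0) + 3 * σ * deriv k u - 3 * k u * pdy m (u, 0)
  have hhc : Continuous fun q : ℝ × ℝ => h q.1 := by
    have h1 := hm.continuous
    have h2 := (contDiff_pdx hm).continuous
    have h3 := (contDiff_pdy hm).continuous
    have h4 := hk.continuous
    have h5 := (contDiff_infty_iff_deriv.1 hk).2.continuous
    dsimp only [h]; fun_prop
  -- After removing powers of `w`, the factor `R` is the denominator of the trace, `A` is the
  -- determinant and `B` the trace of the Weingarten matrix up to the sign of the vertical velocity.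
  let R : ℝ × ℝ → ℝ := fun q => D q * √|D q|
  let A : ℝ × ℝ → ℝ := fun q => K q / (D q * |D q|)
  let B : ℝ × ℝ → ℝ := fun q => (σ / 6 * h q.1 + q.2 * H₁ q) / R q
  have hRc : ContinuousAt R (s₀, 0) := hDc.mul hDc.abs.sqrt
  have hR0 : R (s₀, 0) ≠ 0 := mul_ne_zero hD0 (Real.sqrt_ne_zero'.2 (abs_pos.2 hD0))
  have hAc : ContinuousAt A (s₀, 0) := hK.continuous.continuousAt.div (hDc.mul hDc.abs)
    (mul_ne_zero hD0 (abs_ne_zero.2 hD0))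
  have hBc : ContinuousAt B (s₀, 0) := by
    refine ContinuousAt.div ?_ hRc hR0
    exact (continuousAt_const.mul hhc.continuousAt).add
      (continuousAt_snd.mul hH.continuous.continuousAt)
  have hHc : ContinuousAt H₁ (s₀, 0) := hH.continuous.continuousAt
  have hRi : ContinuousAt (fun q => (R q)⁻¹) (s₀, 0) := hRc.inv₀ hR0
  set CR := |R (s₀, 0)| + 1
  set CI := |(R (s₀, 0))⁻¹| + 1
  set CH := |H₁ (s₀, 0)| + 1
  refine ⟨D, A, B, |A (s₀, 0)| / 2, |B (s₀, 0)| + 1, 6 * (CR + CH), CI * (1 + CH),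
    fun u => (h0 u).1, hD0, ?_, fun W hW G hG => ?_⟩
  -- Since `κ(κ + σμ₀²) = σκ(σκ + μ₀²)`, the factor `D` divides out and `A` has the sign of `σκ`,
  -- hence of the singular curvature.
  · have : K (s₀, 0) = σ * k s₀ * D (s₀, 0) := by
      rw [(h0 s₀).1, (h0 s₀).2]; linear_combination (k s₀ ^ 2) * hσ
    have hDa : |D (s₀, 0)| ≠ 0 := abs_ne_zero.2 hD0
    dsimp only [A]
    rw [this]; field_simp
  have hφ0 : φ (s₀, 0) = (s₀, 0) := nf.fix_axis.self_of_nhds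
  have ht : Tendsto φ (𝓝 (s₀, 0)) (𝓝 (s₀, 0)) := by
    simpa [ContinuousAt, hφ0] using nf.smooth.continuousAt
  have hfst : Tendsto Prod.fst (𝓝 (s₀, (0 : ℝ))) (𝓝 s₀) := continuous_fst.tendsto _
  have hDD : ∀ᶠ q in 𝓝 (s₀, (0 : ℝ)), 0 < D q * D (s₀, 0) :=
    (hDc.mul continuousAt_const).eventually_const_lt (mul_self_pos.2 hD0)
  have hAev : ∀ᶠ q in 𝓝 (s₀, (0 : ℝ)), A (s₀, 0) ≠ 0 → |A (s₀, 0)| / 2 ≤ |A q| ∧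
      0 < A q * A (s₀, 0) ∧ q.2 ^ 2 * B q ^ 2 < 4 * |A q| := by
    by_cases hA : A (s₀, 0) = 0
    · exact Eventually.of_forall fun q hq => absurd hA hq
    have h1 : ∀ᶠ q in 𝓝 (s₀, (0 : ℝ)), |A (s₀, 0)| / 2 < |A q| :=
      hAc.abs.eventually_const_lt (half_lt_self (abs_pos.2 hA))
    have h2 : ∀ᶠ q in 𝓝 (s₀, (0 : ℝ)), 0 < A q * A (s₀, 0) :=
      (hAc.mul continuousAt_const).eventually_const_lt (mul_self_pos.2 hA)
    have h3 : ∀ᶠ q in 𝓝 (s₀, (0 : ℝ)), q.2 ^ 2 * B q ^ 2 < 4 * |A q| :=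
      ((continuousAt_snd.pow 2).mul (hBc.pow 2)).eventually_lt
        (continuousAt_const.mul hAc.abs) (by simpa using hA)
    filter_upwards [h1, h2, h3] with q h1 h2 h3 _ using ⟨h1.le, h2, h3⟩
  obtain ⟨r, hr, hGr, hopen⟩ := nf.exists_box (hev.and (hG.and ((ht.eventually hW).and (nf.mem.and
    (hψe.and ((hψ.continuous.continuousAt.eventually_const_lt hψ0).and
    ((hfst.eventually nf.fix_axis).and (hDD.and (hAev.and ((eventually_abs_le hRc).and
    ((eventually_abs_le hRi).and ((eventually_abs_le hHc).and ((eventually_abs_le hBc).and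
    (hfst.eventually (hI.mem_nhds hs₀)))))))))))))))
  choose g1 g2 g3 g4 g5 g6 g7 g8 g9 g10 g11 g12 g13 g14 using hGr
  have hDq : ∀ q (hq : q ∈ box s₀ r), D q ≠ 0 := fun q hq h => by
    have := g8 q hq; rw [h, zero_mul] at this; exact lt_irrefl _ this
  have hRq : ∀ q (hq : q ∈ box s₀ r), R q ≠ 0 := fun q hq =>
    mul_ne_zero (hDq q hq) (Real.sqrt_ne_zero'.2 (abs_pos.2 (hDq q hq)))
  refine ⟨r, g2, hr, hopen, fun q hq => ⟨g3 q hq, g4 q hq⟩, fun u hu => g7 _ hu, fun q hq => ?_,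
    fun q hq hw => ?_, fun q hq hw => ?_, fun q hq hw => ?_, fun q hq hw => ?_,
    fun q hq hw => ?_, fun q hq hw => (g1 q hq hw).2.2.2.2.2, g13, fun q hq => ?_, fun q hq => ?_,
    fun hA q hq => g9 q hq hA, by positivity, fun hA => by positivity⟩
  · rw [g5 q hq]; simp [(g6 q hq).ne']
  · rw [(g1 q hq hw).1]
    have := g8 q hq
    exact ⟨fun h => (pos_iff_pos_of_mul_pos this).1 h, fun h => (pos_iff_pos_of_mul_pos this).2 h⟩
  · rw [(g1 q hq hw).2.1]
    have := g8 q hq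
    exact ⟨fun h => (neg_iff_neg_of_mul_pos this).1 h, fun h => (neg_iff_neg_of_mul_pos this).2 h⟩
  · rw [(g1 q hq hw).2.2.1]
    have h1 := g8 q hq
    have h2 := hDq q hq
    rcases lt_or_gt_of_ne hD0 with h | h
    · have h3 : D q < 0 := (neg_iff_neg_of_mul_pos h1).2 h
      simp only [A, sign_neg h, abs_of_neg h3]
      simp; field_simp
    · have h3 : 0 < D q := (pos_iff_pos_of_mul_pos h1).2 h
      simp only [A, sign_pos h, abs_of_pos h3]
      simp; field_simp
  · rw [(g1 q hq hw).2.2.2.1]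
    simp only [A, div_div]
  · rw [(g1 q hq hw).2.2.2.2.1]
    have hv : |vel f q.1 2| = 1 := by
      have := vel_vertical_sq hf harc (g14 q hq)
      rwa [← sq_abs, pow_eq_one_iff_of_nonneg (abs_nonneg _) two_ne_zero] at this
    rw [abs_div, abs_mul, hv, one_mul, abs_mul (D q * √|D q|), ← div_div, ← abs_div]
  · have h1 := g11 q hq
    have h2 := g12 q hq
    calc |B q| = |σ / 6 * h q.1 + q.2 * H₁ q| * |(R q)⁻¹| := by
          rw [← abs_mul, ← div_eq_mul_inv]
      _ ≤ ((1 + CH) * (|h q.1| + |q.2|)) * CI := by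
          refine mul_le_mul ?_ h1 (abs_nonneg _) (by positivity)
          refine (abs_add_le _ _).trans ?_
          rw [abs_mul, abs_mul, abs_div, hσa]
          have : |q.2| * |H₁ q| ≤ |q.2| * CH := mul_le_mul_of_nonneg_left h2 (abs_nonneg _)
          have hCH : 0 ≤ CH := by positivity
          norm_num
          nlinarith [abs_nonneg (h q.1), abs_nonneg q.2, mul_nonneg hCH (abs_nonneg (h q.1))]
      _ = _ := by ring
  · have h1 := g10 q hq
    have h2 := g12 q hq
    have h3 : σ / 6 * h q.1 = B q * R q - q.2 * H₁ q := by
      simp only [B]; rw [div_mul_cancel₀ _ (hRq q hq)]; ring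
    have h4 : |h q.1| = 6 * |σ / 6 * h q.1| := by
      rw [abs_mul, abs_div, hσa]; norm_num; ring
    show |h q.1| ≤ _
    rw [h4, h3]
    have h5 : |B q * R q - q.2 * H₁ q| ≤ |B q| * CR + |q.2| * CH := by
      refine (abs_sub _ _).trans ?_
      rw [abs_mul (B q) (R q), abs_mul q.2 (H₁ q)]
      exact add_le_add (mul_le_mul_of_nonneg_left h1 (abs_nonneg _))
        (mul_le_mul_of_nonneg_left h2 (abs_nonneg _))
    have hCH : 0 ≤ CH := by positivity
    have hCR : 0 ≤ CR := by positivity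
    nlinarith [abs_nonneg (B q), abs_nonneg q.2, mul_nonneg hCH (abs_nonneg (B q)),
      mul_nonneg hCR (abs_nonneg q.2)]

end Main

theorem not_accPt_of_mem_nhds {X : Type*} [TopologicalSpace X] {p : X} {S V : Set X}
    (hV : V ∈ 𝓝 p) (h : ∀ q ∈ V, q ∉ S) : ¬ AccPt p (𝓟 S) := by
  rw [accPt_iff_frequently, not_frequently]
  filter_upwards [hV] with q hq hS using h q hq hS.2

/-! ### From the curvature estimates to the assertions of the theorem. -/

section Main

variable {I : Set ℝ} {δ : ℝ} {f : ℝ × ℝ → Vec3} {s₀ σ : ℝ} {m : ℝ × ℝ → ℝ} {φ : ℝ × ℝ → ℝ × ℝ}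
  {W : Set (ℝ × ℝ)} {r : ℝ} {D A B : ℝ × ℝ → ℝ} {h : ℝ → ℝ} {a b R H : ℝ}

namespace CurvatureData

/-- The chart `φ` sends exactly the points with `w = 0` to the axis, so statements on `V \ Σ` become
statements about the box. -/
theorem forall_off_axis (cd : CurvatureData I δ f s₀ σ m φ W r D A B h a b R H)
    {P : ℝ × ℝ → Prop} :
    (∀ q ∈ φ '' box s₀ r \ sAxis, P q) ↔ ∀ q ∈ box s₀ r, q.2 ≠ 0 → P (φ q) := by
  constructor
  · exact fun H q hq hw => H _ ⟨mem_image_of_mem _ hq, fun h => hw ((cd.off_axis q hq).1 h)⟩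
  · rintro H _ ⟨⟨q, hq, rfl⟩, hw⟩
    exact H q hq fun h => hw ((cd.off_axis q hq).2 h)

theorem axis_mem_iff (cd : CurvatureData I δ f s₀ σ m φ W r D A B h a b R H)
    {s : ℝ} : (s, (0 : ℝ)) ∈ φ '' box s₀ r ↔ s ∈ Ioo (s₀ - r) (s₀ + r) := by
  have hr := cd.pos
  constructor
  · rintro ⟨q, hq, hqs⟩
    have hw : q.2 = 0 := (cd.off_axis q hq).1 (by rw [hqs])
    obtain ⟨u, w⟩ := q
    obtain rfl : w = 0 := hw
    rw [cd.axis u hq] at hqs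
    cases hqs
    exact hq.1
  · intro hs
    have : (s, (0 : ℝ)) ∈ box s₀ r := ⟨hs, by simp [hr]⟩
    exact ⟨_, this, cd.axis s this⟩

theorem pt_mem (cd : CurvatureData I δ f s₀ σ m φ W r D A B h a b R H)
    {w : ℝ} (hw : w ∈ Ioo 0 r) : (s₀, w) ∈ box s₀ r := by
  have hr := cd.pos
  exact ⟨by simp [hr], by linarith [hw.1], hw.2⟩

theorem center_mem (cd : CurvatureData I δ f s₀ σ m φ W r D A B h a b R H) :
    (s₀, (0 : ℝ)) ∈ φ '' box s₀ r :=
  cd.axis_mem_iff.2 (by have := cd.pos; simp [this])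

theorem mem_nhds (cd : CurvatureData I δ f s₀ σ m φ W r D A B h a b R H) :
    φ '' box s₀ r ∈ 𝓝 (s₀, (0 : ℝ)) := cd.isOpen.mem_nhds cd.center_mem

theorem half_mem (cd : CurvatureData I δ f s₀ σ m φ W r D A B h a b R H) :
    (s₀, r / 2) ∈ box s₀ r ∧ ((s₀, r / 2) : ℝ × ℝ).2 ≠ 0 := by
  have hr := cd.pos
  exact ⟨cd.pt_mem ⟨by linarith, by linarith⟩, (half_pos hr).ne'⟩

theorem spacelike_iff (cd : CurvatureData I δ f s₀ σ m φ W r D A B h a b R H) :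
    (∀ q ∈ φ '' box s₀ r \ sAxis, IsSpacelikeAt f q) ↔ 0 < D (s₀, 0) := by
  rw [cd.forall_off_axis]
  constructor
  · intro h
    have h1 := cd.half_mem
    exact (cd.delta_pos _ h1.1 h1.2).1 (isSpacelikeAt_iff.1 (h _ h1.1 h1.2))
  · exact fun h q hq hw => isSpacelikeAt_iff.2 ((cd.delta_pos q hq hw).2 h)

theorem timelike_iff (cd : CurvatureData I δ f s₀ σ m φ W r D A B h a b R H) :
    (∀ q ∈ φ '' box s₀ r \ sAxis, IsTimelikeAt f q) ↔ D (s₀, 0) < 0 := by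
  rw [cd.forall_off_axis]
  constructor
  · intro h
    have h1 := cd.half_mem
    exact (cd.delta_neg _ h1.1 h1.2).1 (isTimelikeAt_iff.1 (h _ h1.1 h1.2))
  · exact fun h q hq hw => isTimelikeAt_iff.2 ((cd.delta_neg q hq hw).2 h)

/-- Here `|H^L| = |B| / (2|w|)`, and `B` and `h` bound each other up to `O(w)`. If `H^L` is bounded,
letting `w → 0` over each fixed `s` gives `h s = 0`; if `h = 0` on the axis, then `B` itself is
`O(w)`. -/
theorem meanL_bounded_iff (cd : CurvatureData I δ f s₀ σ m φ W r D A B h a b R H) :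
    (∃ C : ℝ, ∀ q ∈ φ '' box s₀ r \ sAxis, |meanL f q| ≤ C) ↔
      ∀ s : ℝ, (s, (0 : ℝ)) ∈ φ '' box s₀ r → h s = 0 := by
  have habs : ∀ q, |meanL f q| = |(weingarten f q).trace| / 2 := fun q => by
    rw [meanL, abs_div, abs_two]
  constructor
  · rintro ⟨C, hC⟩ s hs
    rw [cd.axis_mem_iff] at hs
    rw [cd.forall_off_axis] at hC
    refine eq_zero_of_forall_abs_le cd.pos (c := R * (2 * C + 1)) fun w hw => ?_
    have hq : (s, w) ∈ box s₀ r := ⟨hs, by linarith [cd.pos, hw.1], hw.2⟩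
    have h1 := hC _ hq hw.1.ne'
    rw [habs, cd.trace_abs _ hq hw.1.ne', div_le_iff₀ two_pos] at h1
    have hw' : |w| = w := abs_of_pos hw.1
    simp only [hw'] at h1
    rw [div_le_iff₀ hw.1] at h1
    have h2 := cd.B_lower _ hq
    simp only [hw'] at h2
    refine h2.trans ?_
    nlinarith [mul_le_mul_of_nonneg_left h1 cd.R_nonneg]
  · intro h0
    refine ⟨H / 2, cd.forall_off_axis.2 fun q hq hw => ?_⟩
    rw [habs, cd.trace_abs q hq hw]
    have h1 := cd.B_upper q hq
    rw [h0 q.1 (cd.axis_mem_iff.2 hq.1), abs_zero, zero_add, ← div_le_iff₀ (abs_pos.2 hw)] at h1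
    linarith

theorem not_umbilic_image (cd : CurvatureData I δ f s₀ σ m φ W r D A B h a b R H)
    (hf : IsOrderFourEdge I δ f) {q : ℝ × ℝ} (hq : q ∈ φ '' box s₀ r) :
    ¬ IsUmbilic f q := by
  obtain ⟨q, hq, rfl⟩ := hq
  by_cases hw : q.2 = 0
  -- On the axis `Δ = 0`, so the point is neither space-like nor time-like and is excluded by
  -- definition.
  · obtain ⟨u, w⟩ := q
    obtain rfl : w = 0 := hw
    have h1 := (cd.mem _ hq).2
    rw [cd.axis u hq] at h1 ⊢
    rintro ⟨h2 | h2, -⟩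
    · rw [isSpacelikeAt_iff, deltaL_axis hf h1.1] at h2; exact lt_irrefl _ h2
    · rw [isTimelikeAt_iff, deltaL_axis hf h1.1] at h2; exact lt_irrefl _ h2
  · exact cd.not_umbilic q hq hw

/-- The Gauss equation in the Lorentzian setting: `K^L` is minus `det W` at space-like points and
plus `det W` at time-like ones. -/
theorem gauss_spacelike (cd : CurvatureData I δ f s₀ σ m φ W r D A B h a b R H)
    (hD : 0 < D (s₀, 0)) {q : ℝ × ℝ} (hq : q ∈ box s₀ r) (hw : q.2 ≠ 0) :
    gaussL f (φ q) = -A q / q.2 ^ 4 := by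
  rw [← cd.gauss q hq hw, sign_pos hD]; simp

theorem gauss_timelike (cd : CurvatureData I δ f s₀ σ m φ W r D A B h a b R H)
    (hD : D (s₀, 0) < 0) {q : ℝ × ℝ} (hq : q ∈ box s₀ r) (hw : q.2 ≠ 0) :
    gaussL f (φ q) = A q / q.2 ^ 4 := by
  have := cd.gauss q hq hw
  rw [sign_neg hD] at this
  simp at this
  rw [neg_div] at this
  linarith

theorem abs_gauss (cd : CurvatureData I δ f s₀ σ m φ W r D A B h a b R H)
    (hD : D (s₀, 0) ≠ 0) {q : ℝ × ℝ} (hq : q ∈ box s₀ r) (hw : q.2 ≠ 0) :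
    |gaussL f (φ q)| = |A q| / q.2 ^ 4 := by
  have h4 : |q.2 ^ 4| = q.2 ^ 4 := abs_of_nonneg (by positivity)
  rcases lt_or_gt_of_ne hD with h | h
  · rw [cd.gauss_timelike h hq hw, abs_div, h4]
  · rw [cd.gauss_spacelike h hq hw, abs_div, abs_neg, h4]

theorem A_pos (cd : CurvatureData I δ f s₀ σ m φ W r D A B h a b R H)
    (hA : 0 < A (s₀, 0)) {q : ℝ × ℝ} (hq : q ∈ box s₀ r) : 0 < A q :=
  (pos_iff_pos_of_mul_pos (cd.A_ge hA.ne' q hq).2.1).2 hA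

theorem A_neg (cd : CurvatureData I δ f s₀ σ m φ W r D A B h a b R H)
    (hA : A (s₀, 0) < 0) {q : ℝ × ℝ} (hq : q ∈ box s₀ r) : A q < 0 :=
  (neg_iff_neg_of_mul_pos (cd.A_ge hA.ne q hq).2.1).2 hA

theorem gauss_pos_of_timelike (cd : CurvatureData I δ f s₀ σ m φ W r D A B h a b R H)
    (hD : D (s₀, 0) < 0) (hA : A (s₀, 0) ≠ 0) :
    (∀ q ∈ φ '' box s₀ r \ sAxis, 0 < gaussL f q) ↔ 0 < A (s₀, 0) := by
  rw [cd.forall_off_axis]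
  constructor
  · intro h
    obtain ⟨h1, h2⟩ := cd.half_mem
    have h3 := h _ h1 h2
    rw [cd.gauss_timelike hD h1 h2] at h3
    by_contra hA'
    exact h3.not_ge (div_nonpos_of_nonpos_of_nonneg
      (cd.A_neg (lt_of_le_of_ne (not_lt.1 hA') hA) h1).le (by positivity))
  · intro hA' q hq hw
    rw [cd.gauss_timelike hD hq hw]
    exact div_pos (cd.A_pos hA' hq) (by positivity)

theorem gauss_neg_of_timelike (cd : CurvatureData I δ f s₀ σ m φ W r D A B h a b R H)
    (hD : D (s₀, 0) < 0) (hA : A (s₀, 0) ≠ 0) :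
    (∀ q ∈ φ '' box s₀ r \ sAxis, gaussL f q < 0) ↔ A (s₀, 0) < 0 := by
  rw [cd.forall_off_axis]
  constructor
  · intro h
    obtain ⟨h1, h2⟩ := cd.half_mem
    have h3 := h _ h1 h2
    rw [cd.gauss_timelike hD h1 h2] at h3
    by_contra hA'
    exact h3.not_ge (div_nonneg
      (cd.A_pos (lt_of_le_of_ne (not_lt.1 hA') hA.symm) h1).le (by positivity))
  · intro hA' q hq hw
    rw [cd.gauss_timelike hD hq hw]
    exact div_neg_of_neg_of_pos (cd.A_neg hA' hq) (by positivity)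

theorem gauss_pos_of_spacelike (cd : CurvatureData I δ f s₀ σ m φ W r D A B h a b R H)
    (hD : 0 < D (s₀, 0)) (hA : A (s₀, 0) < 0) :
    ∀ q ∈ φ '' box s₀ r \ sAxis, 0 < gaussL f q := by
  rw [cd.forall_off_axis]
  intro q hq hw
  rw [cd.gauss_spacelike hD hq hw]
  exact div_pos (neg_pos.2 (cd.A_neg hA hq)) (by positivity)

/-- The square of the trace is `B²/w²` while the determinant is `A/w⁴`. Near the axis the sign is
therefore decided by `-A`, provided `A` does not vanish at `p`. -/
theorem discrim_eq (cd : CurvatureData I δ f s₀ σ m φ W r D A B h a b R H)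
    {q : ℝ × ℝ} (hq : q ∈ box s₀ r) (hw : q.2 ≠ 0) :
    (weingarten f (φ q)).trace ^ 2 - 4 * (weingarten f (φ q)).det
      = (q.2 ^ 2 * B q ^ 2 - 4 * A q) / q.2 ^ 4 := by
  rw [← sq_abs (weingarten f (φ q)).trace, cd.trace_abs q hq hw, cd.det q hq hw, div_pow, sq_abs,
    sq_abs]
  field_simp

theorem discrim_neg (cd : CurvatureData I δ f s₀ σ m φ W r D A B h a b R H)
    (hA : 0 < A (s₀, 0)) {q : ℝ × ℝ} (hq : q ∈ box s₀ r) (hw : q.2 ≠ 0) :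
    (weingarten f (φ q)).trace ^ 2 - 4 * (weingarten f (φ q)).det < 0 := by
  rw [cd.discrim_eq hq hw]
  have h1 := (cd.A_ge hA.ne' q hq).2.2
  rw [abs_of_pos (cd.A_pos hA hq)] at h1
  exact div_neg_of_neg_of_pos (by linarith) (by positivity)

theorem discrim_pos (cd : CurvatureData I δ f s₀ σ m φ W r D A B h a b R H)
    (hA : A (s₀, 0) < 0) {q : ℝ × ℝ} (hq : q ∈ box s₀ r) (hw : q.2 ≠ 0) :
    0 < (weingarten f (φ q)).trace ^ 2 - 4 * (weingarten f (φ q)).det := by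
  rw [cd.discrim_eq hq hw]
  have h1 := cd.A_neg hA hq
  exact div_pos (by nlinarith [sq_nonneg (q.2 * B q)]) (by positivity)

theorem im_eq_zero (cd : CurvatureData I δ f s₀ σ m φ W r D A B h a b R H)
    (hA : A (s₀, 0) < 0) :
    ∀ q ∈ φ '' box s₀ r \ sAxis, ∀ k ∈ principalCurvatures f q, k.im = 0 := by
  rw [cd.forall_off_axis]
  intro q hq hw k hk
  exact im_eq_zero_of_discrim (mem_principalCurvatures.1 hk) (cd.discrim_pos hA hq hw).le

theorem im_ne_zero (cd : CurvatureData I δ f s₀ σ m φ W r D A B h a b R H)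
    (hA : 0 < A (s₀, 0)) :
    ∀ q ∈ φ '' box s₀ r \ sAxis, ∀ k ∈ principalCurvatures f q, k.im ≠ 0 := by
  rw [cd.forall_off_axis]
  intro q hq hw k hk
  exact im_ne_zero_of_discrim (mem_principalCurvatures.1 hk) (cd.discrim_neg hA hq hw)

theorem not_quasiUmbilic_image (cd : CurvatureData I δ f s₀ σ m φ W r D A B h a b R H)
    (hf : IsOrderFourEdge I δ f) (hA : A (s₀, 0) ≠ 0) {q : ℝ × ℝ}
    (hq : q ∈ φ '' box s₀ r) : ¬ IsQuasiUmbilic f q := by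
  obtain ⟨q, hq, rfl⟩ := hq
  by_cases hw : q.2 = 0
  · obtain ⟨u, w⟩ := q
    obtain rfl : w = 0 := hw
    have h1 := (cd.mem _ hq).2
    rw [cd.axis u hq] at h1 ⊢
    rintro ⟨h2 | h2, -⟩
    · rw [isSpacelikeAt_iff, deltaL_axis hf h1.1] at h2; exact lt_irrefl _ h2
    · rw [isTimelikeAt_iff, deltaL_axis hf h1.1] at h2; exact lt_irrefl _ h2
  · rintro ⟨-, ⟨k, hk⟩, -⟩
    obtain ⟨h1, h2⟩ := principalCurvatures_pair hk
    have h3 : (((weingarten f (φ q)).trace ^ 2 - 4 * (weingarten f (φ q)).det : ℝ) : ℂ) = 0 := by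
      push_cast
      rw [← h1, ← h2]; ring
    have h4 := Complex.ofReal_eq_zero.1 h3
    rcases lt_or_gt_of_ne hA with h | h
    · exact (cd.discrim_pos h hq hw).ne' h4
    · exact (cd.discrim_neg h hq hw).ne h4

/-- It suffices to approach `p` along the section `u = s₀`. The selections `k₁`, `k₂` are arbitrary,
so the second root is covered by exchanging them. -/
theorem not_bounded_left (cd : CurvatureData I δ f s₀ σ m φ W r D A B h a b R H)
    (hA : A (s₀, 0) ≠ 0) {k₁ k₂ : ℝ × ℝ → ℂ}
    (hk : ∀ q ∈ φ '' box s₀ r \ sAxis, principalCurvatures f q = {k₁ q, k₂ q}) :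
    ¬ ∃ C : ℝ, ∀ q ∈ φ '' box s₀ r \ sAxis, ‖k₁ q‖ ≤ C := by
  rintro ⟨C, hC⟩
  rw [cd.forall_off_axis] at hk hC
  refine false_of_bounded_root cd.pos (cd.a_pos hA) (k₁ := fun w => k₁ (φ (s₀, w)))
    (k₂ := fun w => k₂ (φ (s₀, w))) (t := fun w => (weingarten f (φ (s₀, w))).trace)
    (d := fun w => (weingarten f (φ (s₀, w))).det) (B := b) (C := C) fun w hw => ?_
  have hq := cd.pt_mem hw
  have hw0 : ((s₀, w) : ℝ × ℝ).2 ≠ 0 := hw.1.ne'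
  obtain ⟨h1, h2⟩ := principalCurvatures_pair (hk _ hq hw0)
  refine ⟨h1, h2, ?_, ?_, hC _ hq hw0⟩
  · rw [cd.trace_abs _ hq hw0]
    simp only [abs_of_pos hw.1]
    exact div_le_div_of_nonneg_right (cd.B_le _ hq) hw.1.le
  · have hw4 : (0 : ℝ) < w ^ 4 := by have := hw.1; positivity
    rw [cd.det _ hq hw0, abs_div]
    simp only [abs_of_pos hw4]
    exact div_le_div_of_nonneg_right (cd.A_ge hA _ hq).1 hw4.le

end CurvatureData

/-- The criterion for cuspidal edges enters as the hypothesis `hcusp`, since its proof concerns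
diffeomorphisms rather than curvature. It is also used in (2), where a point that is not a cuspidal
edge has `μ₀ = 0`. -/
theorem NormalForm.main (hI : IsOpen I) (hδ : 0 < δ) (hf : IsOrderFourEdge I δ f)
    (harc : IsArcLengthProjection I f) (hs₀ : s₀ ∈ I) (nf : NormalForm I δ f s₀ σ m φ)
    {μ : ℝ × ℝ → ℝ} (hμ : μ =ᶠ[𝓝 (s₀, 0)] m)
    (hcusp : IsCuspidalEdgePoint f (s₀, 0) ↔ m (s₀, 0) ≠ 0) (hW : W ∈ 𝓝 (s₀, (0 : ℝ))) :
    ∃ V : Set (ℝ × ℝ),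
      IsOpen V ∧ ((s₀, 0) : ℝ × ℝ) ∈ V ∧ V ⊆ W ∧ V ⊆ edgeDomain I δ ∧
      ((∀ q ∈ V \ sAxis, IsSpacelikeAt f q) ∨
        (∀ q ∈ V \ sAxis, IsTimelikeAt f q)) ∧
      ((∃ C : ℝ, ∀ q ∈ V \ sAxis, |meanL f q| ≤ C) ↔
        ∀ s : ℝ, ((s, 0) : ℝ × ℝ) ∈ V →
          3 * planeCurvature f s * muOne μ s =
            8 * muZero μ s * deriv (muZero μ) s
              + 3 * σ * deriv (planeCurvature f) s) ∧
      (¬ AccPt ((s₀, 0) : ℝ × ℝ)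
        (𝓟 {q | q ∈ edgeDomain I δ ∧ IsUmbilic f q})) ∧
      (IsCuspidalEdgePoint f (s₀, 0) ↔ muZero μ s₀ ≠ 0) ∧
      (acc f s₀ ≠ 0 →
        ((∀ q ∈ V \ sAxis, IsSpacelikeAt f q) →
          (∀ s : ℝ, ((s, 0) : ℝ × ℝ) ∈ V → IsConcaveAt f s) ∧
          ∀ q ∈ V \ sAxis, 0 < gaussL f q) ∧
        ((∀ q ∈ V \ sAxis, IsTimelikeAt f q) →
          ((∀ q ∈ V \ sAxis, 0 < gaussL f q) ↔
            IsConvexAt f s₀) ∧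
          ((∀ q ∈ V \ sAxis, gaussL f q < 0) ↔
            IsConcaveAt f s₀) ∧
          (¬ IsCuspidalEdgePoint f (s₀, 0) →
            (∀ q ∈ V \ sAxis, 0 < gaussL f q) ∧
            IsConvexAt f s₀)) ∧
        Tendsto (fun q => |gaussL f q|)
          (𝓝[sAxisᶜ] ((s₀, 0) : ℝ × ℝ)) atTop ∧
        ((∀ q ∈ V \ sAxis, 0 < gaussL f q) ∨
          (∀ q ∈ V \ sAxis, gaussL f q < 0)) ∧
        (∀ k₁ k₂ : ℝ × ℝ → ℂ,
          (∀ q ∈ V \ sAxis, principalCurvatures f q = {k₁ q, k₂ q}) →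
          (¬ ∃ C : ℝ, ∀ q ∈ V \ sAxis, ‖k₁ q‖ ≤ C) ∧
          (¬ ∃ C : ℝ, ∀ q ∈ V \ sAxis, ‖k₂ q‖ ≤ C)) ∧
        ((∀ q ∈ V \ sAxis, IsSpacelikeAt f q) →
          ∀ q ∈ V \ sAxis, ∀ k ∈ principalCurvatures f q, k.im = 0) ∧
        ((∀ q ∈ V \ sAxis, IsTimelikeAt f q) →
          ((∀ q ∈ V \ sAxis, gaussL f q < 0) →
            ∀ q ∈ V \ sAxis, ∀ k ∈ principalCurvatures f q, k.im = 0) ∧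
          ((∀ q ∈ V \ sAxis, 0 < gaussL f q) →
            ∀ q ∈ V \ sAxis, ∀ k ∈ principalCurvatures f q, k.im ≠ 0)) ∧
        (¬ AccPt ((s₀, 0) : ℝ × ℝ)
          (𝓟 {q | q ∈ edgeDomain I δ ∧ IsQuasiUmbilic f q}))) := by
  obtain ⟨k, hk, hkκ⟩ := (smoothNear_planeCurvature hI hδ hf hs₀).exists_contDiff
  obtain ⟨D, A, B, a, b, R, H, hDax, hD0, hAD, hdata⟩ :=
    nf.exists_curvatureData hI hδ hf harc hs₀ hk hkκ
  have hfst : Tendsto Prod.fst (𝓝 (s₀, (0 : ℝ))) (𝓝 s₀) := continuous_fst.tendsto _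
  have hmu0 : ∀ᶠ u in 𝓝 s₀, muZero μ u = m (u, 0) := (tendsto_axis s₀).eventually hμ
  have hmu0d : ∀ᶠ u in 𝓝 s₀, deriv (muZero μ) u = pdx m (u, 0) := by
    filter_upwards [hmu0.eventually_nhds] with u hu
    rw [EventuallyEq.deriv_eq (f := fun u => m (u, 0)) hu]
    exact (hasDerivAt_fst (nf.smooth_mu.differentiable (by simp) (u, 0))).deriv
  have hmu1 : ∀ᶠ u in 𝓝 s₀, muOne μ u = pdy m (u, 0) := by
    filter_upwards [(tendsto_axis s₀).eventually hμ.eventually_nhds] with u hu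
    have h1 : (fun t => μ (u, t)) =ᶠ[𝓝 0] fun t => m (u, t) :=
      ((by fun_prop : Continuous fun t : ℝ => (u, t)).tendsto 0).eventually hu
    rw [muOne, h1.deriv_eq]
    exact (hasDerivAt_snd (nf.smooth_mu.differentiable (by simp) (u, 0))).deriv
  have hksign : ∀ᶠ u in 𝓝 s₀, k s₀ ≠ 0 → 0 < k u * k s₀ := by
    by_cases h0 : k s₀ = 0
    · exact Eventually.of_forall fun u hu => absurd h0 hu
    · filter_upwards [(hk.continuous.continuousAt.mul continuousAt_const).eventually_const_lt
        (mul_self_pos.2 h0)] with u hu _ using hu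
  have hsing := nf.singularCurvature_eq hI hδ hf harc hs₀
  have hkd : ∀ᶠ u in 𝓝 s₀, deriv (planeCurvature f) u = deriv k u := by
    filter_upwards [hkκ.eventually_nhds] with u hu using EventuallyEq.deriv_eq (f := k) hu
  obtain ⟨r, hG, cd⟩ := hdata W hW _ (hfst.eventually
    (hkκ.and (hkd.and (hmu0.and (hmu0d.and (hmu1.and (hsing.and hksign)))))))
  choose g1 g2 g3 g4 g5 g6 g7 using hG
  have hr := cd.pos
  have hax : ∀ s, (s, (0 : ℝ)) ∈ φ '' box s₀ r → (s, (0 : ℝ)) ∈ box s₀ r := fun s hs =>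
    ⟨cd.axis_mem_iff.1 hs, by simp [hr]⟩
  have h00 := hax s₀ cd.center_mem
  have hDpos : 0 < |D (s₀, 0)| := abs_pos.2 hD0
  have hconv : IsConvexAt f s₀ ↔ 0 < A (s₀, 0) := by
    rw [IsConvexAt, g6 _ h00, g1 _ h00, ← hAD, div_pos_iff_of_pos_right two_pos,
      mul_pos_iff_of_pos_right hDpos]
  have hconc : IsConcaveAt f s₀ ↔ A (s₀, 0) < 0 := by
    rw [IsConcaveAt, g6 _ h00, g1 _ h00, ← hAD, div_lt_iff₀ two_pos, zero_mul,
      ← neg_pos, ← neg_mul, mul_pos_iff_of_pos_right hDpos, neg_pos]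
  refine ⟨φ '' box s₀ r, cd.isOpen, cd.center_mem, ?_, ?_, ?_, ?_, ?_, ?_, fun hacc => ?_⟩
  · rintro _ ⟨q, hq, rfl⟩; exact (cd.mem q hq).1
  · rintro _ ⟨q, hq, rfl⟩; exact (cd.mem q hq).2
  · rcases lt_or_gt_of_ne hD0 with h | h
    · exact Or.inr (cd.timelike_iff.2 h)
    · exact Or.inl (cd.spacelike_iff.2 h)
  · rw [cd.meanL_bounded_iff]
    refine forall₂_congr fun s hs => ?_
    have h1 := hax s hs
    rw [g1 _ h1, g2 _ h1, g3 _ h1, g4 _ h1, g5 _ h1]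
    constructor <;> intro h <;> linarith
  · exact not_accPt_of_mem_nhds cd.mem_nhds fun q hq h => cd.not_umbilic_image hf hq h.2
  · rw [hcusp, g3 _ h00]
  have hk0 : k s₀ ≠ 0 := by
    intro h0
    refine hacc ?_
    rw [acc_eq_frame hI hδ hf harc hs₀, g1 _ h00, h0]
    simp [frame_eq]
  have hσ : σ ≠ 0 := by rcases nf.sign with h | h <;> simp [h]
  have hA0 : A (s₀, 0) ≠ 0 := fun h => by
    rw [h, zero_mul] at hAD
    exact mul_ne_zero hσ hk0 hAD.symm
  -- Space-like type means `σκ + μ₀² < 0`, which forces `σκ < 0`.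
  have hAneg : 0 < D (s₀, 0) → A (s₀, 0) < 0 := fun hD => by
    have h1 : σ * k s₀ < 0 := by
      have := hDax s₀
      nlinarith [sq_nonneg (m (s₀, 0))]
    rw [← hAD] at h1
    exact neg_of_mul_neg_left h1 hDpos.le
  have hbdd : ∀ {k₁ k₂ : ℝ × ℝ → ℂ},
      (∀ q ∈ φ '' box s₀ r \ sAxis, principalCurvatures f q = {k₁ q, k₂ q}) →
      ¬ ∃ C : ℝ, ∀ q ∈ φ '' box s₀ r \ sAxis, ‖k₁ q‖ ≤ C := cd.not_bounded_left hA0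
  refine ⟨fun h => ?_, fun h => ?_, ?_, ?_, fun k₁ k₂ hkk => ⟨hbdd hkk, hbdd (k₂ := k₁) fun q hq => ?_⟩,
    fun h => cd.im_eq_zero (hAneg (cd.spacelike_iff.1 h)), fun h => ?_,
    not_accPt_of_mem_nhds cd.mem_nhds fun q hq h => cd.not_quasiUmbilic_image hf hA0 hq h.2⟩
  · have hD := cd.spacelike_iff.1 h
    refine ⟨fun s hs => ?_, cd.gauss_pos_of_spacelike hD (hAneg hD)⟩
    have h1 := hax s hs
    have h2 : σ * k s₀ < 0 := by
      rw [← hAD]; exact mul_neg_of_neg_of_pos (hAneg hD) hDpos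
    have h3 := g7 _ h1 hk0
    simp only at h3
    rw [IsConcaveAt, g6 _ h1, g1 _ h1]
    -- On the chosen box `κ(s)` and `κ(s₀)` have the same sign, so negativity of `σκ` passes from
    -- `s₀` to all points of the axis in `V`.
    have h4 : (σ * k s) * (k s₀) ^ 2 = (σ * k s₀) * (k s * k s₀) := by ring
    have h5 : (σ * k s) * (k s₀) ^ 2 < 0 := h4 ▸ mul_neg_of_neg_of_pos h2 h3
    have h6 : 0 < (k s₀) ^ 2 := by positivity
    have := neg_of_mul_neg_left h5 h6.le
    simp only; linarith
  · have hD := cd.timelike_iff.1 h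
    refine ⟨(cd.gauss_pos_of_timelike hD hA0).trans hconv.symm,
      (cd.gauss_neg_of_timelike hD hA0).trans hconc.symm, fun hnc => ?_⟩
    rw [hcusp, not_not] at hnc
    -- With `μ₀ = 0` the leading coefficient of `Δ` is `-σκ`, and it is negative at time-like type.
    have h1 : 0 < σ * k s₀ := by
      have := hDax s₀
      rw [hnc] at this
      linarith
    rw [← hAD] at h1
    have hA := (mul_pos_iff_of_pos_right hDpos).1 h1
    exact ⟨(cd.gauss_pos_of_timelike hD hA0).2 hA, hconv.2 hA⟩
  · refine tendsto_atTop.2 fun C => ?_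
    have hsm : ∀ᶠ q in 𝓝 (s₀, (0 : ℝ)), C * q.2 ^ 4 < a := by
      have : Continuous fun q : ℝ × ℝ => C * q.2 ^ 4 := by fun_prop
      exact (this.continuousAt (x := (s₀, (0 : ℝ)))).eventually_lt_const
        (by simpa using cd.a_pos hA0)
    -- For each `C` a smaller box is taken on which `C w⁴ < a`; the bound `a ≤ |A|` still holds
    -- there, so `|K^L| = |A|/w⁴` exceeds `C`.
    obtain ⟨r', hG', cd'⟩ := hdata W hW _ hsm
    filter_upwards [mem_nhdsWithin_of_mem_nhds cd'.mem_nhds, self_mem_nhdsWithin] with q hq hq'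
    have key := (cd'.forall_off_axis (P := fun q => C ≤ |gaussL f q|)).2 (fun q hq hw => by
      rw [cd'.abs_gauss hD0 hq hw, le_div_iff₀ (by positivity)]
      exact (hG' q hq).le.trans (cd'.A_ge hA0 q hq).1)
    exact key q ⟨hq, hq'⟩
  · rcases lt_or_gt_of_ne hD0 with hD | hD
    · rcases lt_or_gt_of_ne hA0 with hA | hA
      · exact Or.inr ((cd.gauss_neg_of_timelike hD hA0).2 hA)
      · exact Or.inl ((cd.gauss_pos_of_timelike hD hA0).2 hA)
    · exact Or.inl (cd.gauss_pos_of_spacelike hD (hAneg hD))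
  · rw [hkk q hq, Multiset.pair_comm]
  · have hD := cd.timelike_iff.1 h
    exact ⟨fun hK => cd.im_eq_zero ((cd.gauss_neg_of_timelike hD hA0).1 hK),
      fun hK => cd.im_ne_zero ((cd.gauss_pos_of_timelike hD hA0).1 hK)⟩

end Main

/-! ### Tubular coordinates of the target along the curve. -/

section Tube

variable {I : Set ℝ} {δ : ℝ} {f : ℝ × ℝ → Vec3} {s₀ : ℝ}

/-- The map of `ℝ³` into itself which sends `z` to the point with coordinates `β z`, `γ z` in the
affine plane through `Γ (s₀ + z₀)` spanned by the normal and the vertical vector. -/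
def tube (f : ℝ × ℝ → Vec3) (s₀ : ℝ) (β γ : Vec3 → ℝ) (z : Vec3) : Vec3 :=
  edgeCurve f (s₀ + z 0) + frame f (s₀ + z 0) 0 (β z) (γ z)

theorem smoothNear_leftNormal (hI : IsOpen I) (hδ : 0 < δ) (hf : IsOrderFourEdge I δ f)
    (hs₀ : s₀ ∈ I) : SmoothNear (leftNormal f) s₀ ∧ SmoothNear (verticalPart f) s₀ := by
  have hc : ∀ c : ℝ, SmoothNear (fun _ : ℝ => c) s₀ := fun c =>
    ContDiff.smoothNear contDiff_const s₀
  have key : ∀ b c : ℝ, SmoothNear (fun s => b • leftNormal f s + c • verticalPart f s) s₀ :=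
    fun b c => (smoothNear_frame hI hδ hf (s := fun s => s) hs₀ (ContDiff.smoothNear contDiff_id s₀)
      (hc 0) (hc b) (hc c)).congr (Eventually.of_forall fun s => (frame_eq f s b c).symm)
  exact ⟨by simpa using key 1 0, by simpa using key 0 1⟩

theorem smoothNear_tube (hI : IsOpen I) (hδ : 0 < δ) (hf : IsOrderFourEdge I δ f)
    (hs₀ : s₀ ∈ I) {β γ : Vec3 → ℝ} (hβ : SmoothNear β 0) (hγ : SmoothNear γ 0) :
    SmoothNear (tube f s₀ β γ) 0 := by
  have hu : SmoothNear (fun z : Vec3 => s₀ + z 0) 0 := ContDiff.smoothNear (by fun_prop) 0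
  have h1 : SmoothNear (fun z : Vec3 => edgeCurve f (s₀ + z 0)) 0 :=
    SmoothNear.comp (g := edgeCurve f) (by simpa using smoothNear_edgeCurve hI hδ hf hs₀) hu
  have h2 := smoothNear_frame hI hδ hf (p := (0 : Vec3)) (by simpa using hs₀) hu
    (ContDiff.smoothNear (contDiff_const (c := (0 : ℝ))) 0) hβ hγ
  filter_upwards [h1, h2] with z h1 h2 using h1.add h2

/-- Since `β` and `γ` vanish at the origin, the derivatives of the normal and vertical vectors do
not contribute. The `z₀`-direction moves along `Γ'`, whose frame coordinates are `(1, 0, 1)`. -/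
theorem fderiv_tube (hI : IsOpen I) (hδ : 0 < δ) (hf : IsOrderFourEdge I δ f)
    (hs₀ : s₀ ∈ I) {β γ : Vec3 → ℝ} (hβ : SmoothNear β 0) (hγ : SmoothNear γ 0)
    (hβ0 : β 0 = 0) (hγ0 : γ 0 = 0) (v : Vec3) :
    fderiv ℝ (tube f s₀ β γ) 0 v = frame f s₀ (v 0) (fderiv ℝ β 0 v) (v 0 + fderiv ℝ γ 0 v) := by
  have hu : HasFDerivAt (fun z : Vec3 => s₀ + z 0)
      (ContinuousLinearMap.proj (R := ℝ) (φ := fun _ : Fin 3 => ℝ) 0) 0 :=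
    (ContinuousLinearMap.proj (R := ℝ) (φ := fun _ : Fin 3 => ℝ) 0).hasFDerivAt.const_add s₀
  have hs : s₀ + (0 : Vec3) 0 = s₀ := by simp
  obtain ⟨hn, hv⟩ := smoothNear_leftNormal hI hδ hf hs₀
  have h1 : HasFDerivAt (fun z : Vec3 => edgeCurve f (s₀ + z 0)) _ 0 :=
    HasFDerivAt.comp (g := edgeCurve f) 0
      (by rw [hs]; exact (hasDerivAt_edgeCurve hI hδ hf hs₀).hasFDerivAt) hu
  have h2 : HasFDerivAt (fun z : Vec3 => leftNormal f (s₀ + z 0)) _ 0 :=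
    HasFDerivAt.comp (g := leftNormal f) 0
      (by rw [hs]; exact hn.differentiableAt.hasFDerivAt) hu
  have h3 : HasFDerivAt (fun z : Vec3 => verticalPart f (s₀ + z 0)) _ 0 :=
    HasFDerivAt.comp (g := verticalPart f) 0
      (by rw [hs]; exact hv.differentiableAt.hasFDerivAt) hu
  have h4 := h1.add ((hβ.differentiableAt.hasFDerivAt.smul h2).add
    (hγ.differentiableAt.hasFDerivAt.smul h3))
  have h5 : tube f s₀ β γ = fun z => edgeCurve f (s₀ + z 0) +
      (β z • leftNormal f (s₀ + z 0) + γ z • verticalPart f (s₀ + z 0)) :=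
    funext fun z => by rw [tube, frame_eq]
  rw [h5]
  erw [h4.fderiv]
  have h6 : frame f s₀ (v 0) (fderiv ℝ β 0 v) (v 0 + fderiv ℝ γ 0 v) = v 0 • vel f s₀ +
      (fderiv ℝ β 0 v • leftNormal f s₀ + fderiv ℝ γ 0 v • verticalPart f s₀) := by
    rw [vel_eq_frame, ← frame_eq, frame_smul, frame_add]; simp
  rw [h6]
  simp [hβ0, hγ0]

/-- The derivative is triangular: its tangential component determines `v 0`, and what remains is the
derivative of `(β, γ)` on the plane `v 0 = 0`. -/
theorem exists_tube_chart (hI : IsOpen I) (hδ : 0 < δ) (hf : IsOrderFourEdge I δ f)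
    (harc : IsArcLengthProjection I f) (hs₀ : s₀ ∈ I) {β γ : Vec3 → ℝ} (hβ : SmoothNear β 0)
    (hγ : SmoothNear γ 0) (hβ0 : β 0 = 0) (hγ0 : γ 0 = 0)
    (hinj : ∀ v : Vec3, v 0 = 0 → fderiv ℝ β 0 v = 0 → fderiv ℝ γ 0 v = 0 → v = 0) :
    ∃ e : OpenPartialHomeomorph Vec3 Vec3, 0 ∈ e.source ∧ (∀ z, e z = tube f s₀ β γ z) ∧
      ContDiffOn ℝ ∞ e e.source ∧ ContDiffOn ℝ ∞ e.symm e.target := by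
  obtain ⟨e, h1, -, h2⟩ := (smoothNear_tube hI hδ hf hs₀ hβ hγ).exists_openPartialHomeomorph rfl
    (fun v hv => by
      rw [fderiv_tube hI hδ hf hs₀ hβ hγ hβ0 hγ0] at hv
      obtain ⟨h1, h2, h3⟩ := frame_eq_zero (harc s₀ hs₀) (vel_vertical_sq hf harc hs₀) hv
      exact hinj v h1 h2 (by rwa [h1, zero_add] at h3)) univ_mem
  exact ⟨e, h1, h2⟩

end Tube

/-! ### The criterion for cuspidal edge singular points. -/

section Cuspidal

variable {I : Set ℝ} {δ : ℝ} {f : ℝ × ℝ → Vec3} {s₀ σ : ℝ} {m : ℝ × ℝ → ℝ} {φ : ℝ × ℝ → ℝ × ℝ}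

/-- In suitable coordinates of the source the section curves are `w ↦ (w², w³ y(u, w))`. -/
theorem exists_chart_section (hm : ContDiff ℝ ∞ m) (s₀ : ℝ) :
    ∃ (e : OpenPartialHomeomorph (ℝ × ℝ) (ℝ × ℝ)) (y : ℝ × ℝ → ℝ), (s₀, 0) ∈ e.source ∧
      e (s₀, 0) = (0, 0) ∧ ContDiffOn ℝ ∞ e e.source ∧ ContDiffOn ℝ ∞ e.symm e.target ∧
      ContDiff ℝ ∞ y ∧ (m (s₀, 0) ≠ 0 → y (0, 0) ≠ 0) ∧
      ∀ᶠ q in 𝓝 (s₀, (0 : ℝ)), (e q).1 = q.1 - s₀ ∧ secX m q = (e q).2 ^ 2 ∧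
        secY m q = (e q).2 ^ 3 * y (e q) := by
  obtain ⟨X, hX, hXe, hX0⟩ := exists_secX_expansion hm
  obtain ⟨Y, hY, hYe, hY0⟩ := exists_secY_expansion hm
  have hZ : ContDiff ℝ ∞ fun q : ℝ × ℝ => 1 / 2 + q.2 * X q :=
    contDiff_const.add (contDiff_snd.mul hX)
  have hpos : ∀ᶠ q in 𝓝 (s₀, (0 : ℝ)), 0 < 1 / 2 + q.2 * X q :=
    hZ.continuous.continuousAt.eventually_const_lt (by simp)
  have hR : SmoothNear (fun q : ℝ × ℝ => √(1 / 2 + q.2 * X q)) (s₀, 0) := by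
    filter_upwards [hpos] with q hq using hZ.contDiffAt.sqrt hq.ne'
  -- The new parameter is the smooth square root of `x = w²(1/2 + wX)`, with the sign of `w`.
  let M : ℝ × ℝ → ℝ × ℝ := fun q => (q.1 - s₀, q.2 * √(1 / 2 + q.2 * X q))
  have hM2 : SmoothNear (fun q : ℝ × ℝ => q.2 * √(1 / 2 + q.2 * X q)) (s₀, 0) := by
    filter_upwards [hR] with q hq using contDiffAt_snd.mul hq
  have hM : SmoothNear M (s₀, 0) :=
    SmoothNear.prodMk (ContDiff.smoothNear (contDiff_fst.sub contDiff_const) _) hM2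
  have hM0 : M (s₀, 0) = (0, 0) := by simp [M]
  have hMx : pdx M (s₀, 0) = (1, 0) := by
    refine pdx_eq hM.differentiableAt ?_
    have : (fun s => M (s, (0 : ℝ))) = fun s => (s - s₀, (0 : ℝ)) := by ext s <;> simp [M]
    rw [this]
    exact ((hasDerivAt_id s₀).sub_const s₀).prodMk (hasDerivAt_const _ _)
  have hMy : pdy M (s₀, 0) = (0, √(1 / 2)) := by
    refine pdy_eq hM.differentiableAt ?_
    have h1 := hasDerivAt_snd hR.differentiableAt
    have h2 := (hasDerivAt_id (0 : ℝ)).mul h1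
    refine ((hasDerivAt_const (0 : ℝ) (s₀ - s₀)).prodMk h2).congr_deriv ?_
    simp
  obtain ⟨e, he, hes, heq, hsm, hsm'⟩ := hM.exists_openPartialHomeomorph rfl (fun v hv => by
    rw [fderiv_apply_eq, hMx, hMy] at hv
    have hv1 := congrArg Prod.fst hv
    have hv2 := congrArg Prod.snd hv
    simp at hv1 hv2
    ext <;> simp [hv1, hv2]) (eventually_mem_set.1 hpos)
  have hes0 : e.symm (0, 0) = (s₀, 0) := by rw [← hM0, ← heq, e.left_inv he]
  have ht : ((0 : ℝ), (0 : ℝ)) ∈ e.target := by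
    rw [← hM0, ← heq]; exact e.map_source he
  have hy : SmoothNear (fun x => Y (e.symm x) /
      √(1 / 2 + (e.symm x).2 * X (e.symm x)) ^ 3) (0, 0) := by
    refine SmoothNear.comp (g := fun q : ℝ × ℝ => Y q / √(1 / 2 + q.2 * X q) ^ 3) ?_
      (SmoothNear.of_contDiffOn hsm' (e.open_target.mem_nhds ht))
    rw [hes0]
    filter_upwards [hR, hpos] with q hq hp
    exact hY.contDiffAt.div (hq.pow 3) (by positivity)
  obtain ⟨y, hys, hye⟩ := hy.exists_contDiff
  refine ⟨e, y, he, by rw [heq, hM0], hsm, hsm', hys, fun hm0 => ?_, ?_⟩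
  · rw [← hye.self_of_nhds]
    simp only [hes0, hY0]
    simpa using hm0
  · have hc : Tendsto e (𝓝 (s₀, 0)) (𝓝 (0, 0)) := by
      have := e.continuousAt he
      rwa [ContinuousAt, heq, hM0] at this
    filter_upwards [hc.eventually hye, e.open_source.mem_nhds he, hpos] with q hq hqs hp
    have h1 : √(1 / 2 + q.2 * X q) ^ 2 = 1 / 2 + q.2 * X q := Real.sq_sqrt hp.le
    have h2 : √(1 / 2 + q.2 * X q) ≠ 0 := (Real.sqrt_pos.2 hp).ne'
    rw [← hq, e.left_inv hqs, heq, hXe, hYe]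
    refine ⟨rfl, ?_, ?_⟩
    · rw [mul_pow, h1]
    · simp only [M]
      rw [mul_pow, mul_assoc, mul_div_cancel₀ _ (pow_ne_zero 3 h2)]

/-- Whitney's theorem gives `W³y = W³a(u, W²) + W⁴b(u, W²)`, a function of `(u, W², W³)` that is
affine in `W³` with slope `a`. As `a` does not vanish at the origin, this function completes to a
diffeomorphism of the target carrying the standard cuspidal edge to `f`. -/
theorem NormalForm.isCuspidalEdgePoint (hI : IsOpen I) (hδ : 0 < δ) (hf : IsOrderFourEdge I δ f)
    (harc : IsArcLengthProjection I f) (hs₀ : s₀ ∈ I) (nf : NormalForm I δ f s₀ σ m φ)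
    (hm0 : m (s₀, 0) ≠ 0) : IsCuspidalEdgePoint f (s₀, 0) := by
  have hσ : σ ≠ 0 := by rcases nf.sign with h | h <;> simp [h]
  obtain ⟨e, y, he, he0, hsm, hsm', hy, hy0, hev⟩ := exists_chart_section nf.smooth_mu s₀
  let ρ : ContDiffBump (0 : ℝ) := ⟨1, 2, one_pos, one_lt_two⟩
  obtain ⟨a, b, ha, hb, hab⟩ := exists_even_odd hy (ρ := ρ) ρ.contDiff ρ.hasCompactSupport
  have ha0 : a (0, 0) ≠ 0 := by
    have h1 := hab 0 0
    have h2 : ρ 0 = 1 := ρ.one_of_mem_closedBall (by simp [ρ])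
    rw [h2] at h1
    simp at h1
    rw [← h1]; exact hy0 hm0
  have hp : ContDiff ℝ ∞ fun z : Vec3 => (z 0, z 1) := by fun_prop
  let β : Vec3 → ℝ := fun z => σ * z 1
  -- With `z₁ = W²` and `z₂ = W³`, the term `W⁴b` becomes `z₁²b` and contributes nothing to the
  -- derivative at the origin.
  let γ : Vec3 → ℝ := fun z => σ * ((z 1) ^ 2 * b (z 0, z 1) + z 2 * a (z 0, z 1))
  have hβ : ContDiff ℝ ∞ β := by dsimp only [β]; fun_prop
  have ha' : ContDiff ℝ ∞ fun z : Vec3 => a (z 0, z 1) := ha.comp hp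
  have hb' : ContDiff ℝ ∞ fun z : Vec3 => b (z 0, z 1) := hb.comp hp
  have hγ : ContDiff ℝ ∞ γ := by dsimp only [γ]; fun_prop
  have hpr : ∀ i : Fin 3, HasFDerivAt (fun z : Vec3 => z i)
      (ContinuousLinearMap.proj (R := ℝ) (φ := fun _ : Fin 3 => ℝ) i) 0 := fun i =>
    (ContinuousLinearMap.proj (R := ℝ) (φ := fun _ : Fin 3 => ℝ) i).hasFDerivAt
  have hdβ : ∀ v, fderiv ℝ β 0 v = σ * v 1 := fun v => by
    rw [((hpr 1).const_mul σ).fderiv]; simp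
  have hdγ : ∀ v, fderiv ℝ γ 0 v = σ * (a (0, 0) * v 2) := fun v => by
    have h1 := (hb'.differentiable (by simp) 0).hasFDerivAt
    have h2 := (ha'.differentiable (by simp) 0).hasFDerivAt
    have h3 := (((((hpr 1).mul (hpr 1)).mul h1).add ((hpr 2).mul h2)).const_mul σ)
    have h4 : γ = fun z => σ * (z 1 * z 1 * b (z 0, z 1) + z 2 * a (z 0, z 1)) := by
      ext z; simp only [γ]; ring
    rw [h4]
    erw [h3.fderiv]
    simp
  obtain ⟨g, hg0, hg, hgs, hgs'⟩ := exists_tube_chart hI hδ hf harc hs₀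
    (ContDiff.smoothNear hβ 0) (ContDiff.smoothNear hγ 0) (by simp [β]) (by simp [γ])
    (fun v h0 h1 h2 => by
      rw [hdβ] at h1
      rw [hdγ] at h2
      simp [hσ, ha0] at h1 h2
      ext i; fin_cases i
      · exact h0
      · exact h1
      · exact h2)
  let cusp : ℝ × ℝ → Vec3 := fun q => ![q.1, q.2 ^ 2, q.2 ^ 3]
  have hcusp : Continuous cusp := by
    refine continuous_pi fun i => ?_
    fin_cases i
    · exact continuous_fst
    · exact continuous_snd.pow 2
    · exact continuous_snd.pow 3
  have hcusp0 : cusp (0, 0) = 0 := by ext i; fin_cases i <;> simp [cusp]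
  have het : Tendsto e (𝓝 (s₀, 0)) (𝓝 (0, 0)) := by
    have := e.continuousAt he
    rwa [ContinuousAt, he0] at this
  have hct : Tendsto (fun q => cusp (e q)) (𝓝 (s₀, 0)) (𝓝 0) := by
    rw [← hcusp0]; exact (hcusp.tendsto _).comp het
  have hρ1 : ∀ᶠ q in 𝓝 (s₀, (0 : ℝ)), ρ (e q).1 = 1 :=
    ((continuous_fst.tendsto _).comp het).eventually ρ.eventuallyEq_one
  have hgood : ∀ᶠ q in 𝓝 (s₀, (0 : ℝ)), q ∈ e.source ∧ cusp (e q) ∈ g.source ∧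
      f (φ q) = g (cusp (e q)) := by
    filter_upwards [hev, nf.eq, e.open_source.mem_nhds he,
      hct.eventually (g.open_source.mem_nhds hg0), hρ1] with q h1 h2 h3 h4 h5
    refine ⟨h3, h4, ?_⟩
    obtain ⟨h6, h7, h8⟩ := h1
    have h9 := hab (e q).1 (e q).2
    rw [h5, one_mul] at h9
    have h10 : s₀ + (e q).1 = q.1 := by rw [h6]; ring
    rw [h2, hg, tube]
    simp only [cusp, β, γ, Matrix.cons_val, h10]
    rw [h7, h8, h9]
    congr 2
    ring
  obtain ⟨c, hc0, hcs, hcφ, hcsm, hcsm'⟩ := nf.exists_chart (eventually_mem_set.1 hgood)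
  have hφ0 : φ (s₀, 0) = (s₀, 0) := nf.fix_axis.self_of_nhds
  have hc1 : c.symm (s₀, 0) = (s₀, 0) := by
    conv_lhs => rw [← hφ0, ← hcφ]
    exact c.left_inv hc0
  have hct' : (s₀, (0 : ℝ)) ∈ c.target := by
    have := c.map_source hc0
    rwa [hcφ, hφ0] at this
  have hf0 : f (s₀, 0) = g 0 := by
    have := (hgood.self_of_nhds).2.2
    rwa [hφ0, he0, hcusp0] at this
  refine ⟨c.symm.trans e, g.symm, ?_, ?_, ?_, ?_, hgs', ?_, ?_, ?_, fun q hq => ?_⟩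
  · rw [OpenPartialHomeomorph.trans_source]
    exact ⟨hct', by rw [mem_preimage, hc1]; exact he⟩
  · rw [hf0]; exact g.map_source hg0
  · rw [OpenPartialHomeomorph.trans_source]
    exact hsm.comp (hcsm'.mono inter_subset_left) fun x hx => hx.2
  · rw [OpenPartialHomeomorph.trans_target]
    exact hcsm.comp (hsm'.mono inter_subset_left) fun x hx => hx.2
  · simpa using hgs
  · rw [OpenPartialHomeomorph.coe_trans, Function.comp_apply, hc1, he0]
  · rw [hf0, g.left_inv hg0]
  · rw [OpenPartialHomeomorph.trans_source] at hq
    obtain ⟨h1, h2, h3⟩ := hcs (c.map_target hq.1)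
    rw [← hcφ, c.right_inv hq.1] at h3
    refine ⟨?_, ?_⟩
    · rw [h3]; exact g.map_source h2
    · rw [h3, g.left_inv h2]; rfl

/-- If `μ₀ = 0`, the section through `p` is `p + w²V(w)` with `V'(0) = 0`, so it has neither a
linear nor a cubic term. In cuspidal coordinates `(a, b², b³)` its velocity `(a', b')` is non-zero,
but the missing linear term gives `a' = 0` and the missing cubic term gives `b' = 0`. -/
theorem NormalForm.ne_zero_of_isCuspidalEdgePoint
    (nf : NormalForm I δ f s₀ σ m φ)
    (hc : IsCuspidalEdgePoint f (s₀, 0)) : m (s₀, 0) ≠ 0 := by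
  intro hm0
  obtain ⟨c, Ψ, hc1, hΨ1, hcs, hcs', hΨs, -, hc0, hΨ0, hev⟩ := hc
  obtain ⟨X, hX, hXe, hX0⟩ := exists_secX_expansion nf.smooth_mu
  obtain ⟨Y, hY, hYe, hY0⟩ := exists_secY_expansion nf.smooth_mu
  set p := f (s₀, 0) with hp
  obtain ⟨Ψ', hΨ', hΨe⟩ :=
    (SmoothNear.of_contDiffOn hΨs (Ψ.open_source.mem_nhds hΨ1)).exists_contDiff
  let V : ℝ → Vec3 := fun w =>
    frame f s₀ 0 (σ * (1 / 2 + w * X (s₀, w))) (σ * (w * Y (s₀, w)))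
  have hline : ContDiff ℝ ∞ fun w : ℝ => (s₀, w) := contDiff_const.prodMk contDiff_id
  have hXs : ContDiff ℝ ∞ fun w : ℝ => X (s₀, w) := hX.comp hline
  have hYs : ContDiff ℝ ∞ fun w : ℝ => Y (s₀, w) := hY.comp hline
  have hV : ContDiff ℝ ∞ V := by
    refine contDiff_pi.2 fun i => ?_
    fin_cases i <;> simp only [V, frame, Fin.zero_eta, Fin.mk_one, Fin.reduceFinMk,
      Matrix.cons_val] <;> fun_prop
  -- The normal component has no linear term because `X` vanishes on the axis; the vertical one has
  -- none because `Y(s₀, 0) = μ₀/3 = 0`.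
  have hV0 : HasDerivAt V 0 0 := by
    have h1 : HasDerivAt (fun w : ℝ => σ * (1 / 2 + w * X (s₀, w))) 0 0 := by
      have := (((hasDerivAt_id (0 : ℝ)).mul
        (hXs.differentiable (by simp) 0).hasDerivAt).const_add (1 / 2)).const_mul σ
      exact this.congr_deriv (by simp [hX0])
    have h2 : HasDerivAt (fun w : ℝ => σ * (w * Y (s₀, w))) 0 0 := by
      have := ((hasDerivAt_id (0 : ℝ)).mul
        (hYs.differentiable (by simp) 0).hasDerivAt).const_mul σ
      exact this.congr_deriv (by simp [hY0, hm0])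
    have h3 : V = fun w => (σ * (1 / 2 + w * X (s₀, w))) • leftNormal f s₀ +
        (σ * (w * Y (s₀, w))) • verticalPart f s₀ := funext fun w => frame_eq _ _ _ _
    rw [h3]
    exact ((h1.smul_const _).add (h2.smul_const _)).congr_deriv (by simp)
  have hφ0 : φ (s₀, 0) = (s₀, 0) := nf.fix_axis.self_of_nhds
  have hlt : Tendsto (fun w : ℝ => (s₀, w)) (𝓝 0) (𝓝 (s₀, 0)) := hline.continuous.tendsto 0
  have hφt : Tendsto (fun w : ℝ => φ (s₀, w)) (𝓝 0) (𝓝 (s₀, 0)) := by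
    have := nf.smooth.continuousAt
    rw [ContinuousAt, hφ0] at this
    exact this.comp hlt
  have hpath : ∀ᶠ w in 𝓝 (0 : ℝ), f (φ (s₀, w)) = p + w ^ 2 • V w := by
    filter_upwards [hlt.eventually nf.eq] with w hw
    rw [hw]
    simp only [V, frame_smul, hXe, hYe, p, edgeCurve]
    congr 2 <;> ring
  have hpt : Tendsto (fun w : ℝ => p + w ^ 2 • V w) (𝓝 0) (𝓝 p) := by
    have hVc := hV.continuous
    have : Continuous fun w : ℝ => p + w ^ 2 • V w := by fun_prop
    simpa using this.tendsto 0
  -- The parameter `w` in `V` and the factor `w²` are made independent variables, so that one factor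
  -- `w²` can be split off by Hadamard's lemma.
  let F : Fin 3 → ℝ × ℝ → ℝ := fun i q => Ψ' (p + q.2 • V q.1) i
  have hF : ∀ i, ContDiff ℝ ∞ (F i) := fun i => by
    have h1 : ContDiff ℝ ∞ fun q : ℝ × ℝ => p + q.2 • V q.1 :=
      contDiff_const.add (contDiff_snd.smul (hV.comp contDiff_fst))
    exact contDiff_pi.1 (hΨ'.comp h1) i
  have hcF : ∀ᶠ w in 𝓝 (0 : ℝ), (c (φ (s₀, w))).1 = F 0 (w, w ^ 2) ∧
      (c (φ (s₀, w))).2 ^ 3 = F 2 (w, w ^ 2) := by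
    filter_upwards [hpath, hφt.eventually (c.open_source.mem_nhds hc1), hpt.eventually hΨe]
      with w h1 h2 h3
    have h4 := (hev _ h2).2
    rw [h1, h3] at h4
    exact ⟨by simp only [F, h4, Matrix.cons_val], by simp only [F, h4, Matrix.cons_val]⟩
  have hΨ'0 : ∀ i u, F i (u, 0) = 0 := fun i u => by
    simp only [F, zero_smul, add_zero]
    rw [← hΨe.self_of_nhds, hΨ0]; rfl
  have hsq : HasDerivAt (fun w : ℝ => (w, w ^ 2)) ((1 : ℝ), (0 : ℝ)) 0 := by
    refine ((hasDerivAt_id (0 : ℝ)).prodMk (hasDerivAt_pow 2 (0 : ℝ))).congr_deriv ?_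
    simp
  have hchain : ∀ {G : ℝ × ℝ → ℝ}, ContDiff ℝ ∞ G →
      HasDerivAt (fun w : ℝ => G (w, w ^ 2)) (pdx G (0, 0)) 0 := fun {G} hG => by
    have h1 : HasFDerivAt G (fderiv ℝ G (0, 0)) ((0 : ℝ), (0 : ℝ) ^ 2) := by
      simpa using (hG.differentiable (by simp) (0, 0)).hasFDerivAt
    exact h1.comp_hasDerivAt 0 hsq
  -- the derivative of the coordinates along the section curve
  have hφd := hasDerivAt_snd nf.smooth.differentiableAt
  have hcd : HasFDerivAt c (fderiv ℝ c (s₀, 0)) (φ (s₀, 0)) := by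
    rw [hφ0]
    exact (SmoothNear.of_contDiffOn hcs
      (c.open_source.mem_nhds hc1)).differentiableAt.hasFDerivAt
  have hcφ := hcd.comp_hasDerivAt 0 hφd
  set ξ := fderiv ℝ c (s₀, 0) (pdy φ (s₀, 0)) with hξ
  -- The derivative of the source chart is injective, and the section direction has positive second
  -- component in the original coordinates.
  have hξ0 : ξ ≠ 0 := by
    intro h0
    have hct : c (s₀, 0) ∈ c.target := c.map_source hc1
    have hsd : HasFDerivAt c.symm (fderiv ℝ c.symm (c (s₀, 0))) (c (s₀, 0)) :=
      (SmoothNear.of_contDiffOn hcs' (c.open_target.mem_nhds hct)).differentiableAt.hasFDerivAt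
    have h1 := hsd.comp (s₀, (0 : ℝ)) (by rw [hφ0] at hcd; exact hcd)
    have h2 : HasFDerivAt (fun x : ℝ × ℝ => x) _ (s₀, (0 : ℝ)) :=
      h1.congr_of_eventuallyEq (by
        filter_upwards [c.open_source.mem_nhds hc1] with x hx using (c.left_inv hx).symm)
    have h3 := h2.unique (hasFDerivAt_id _)
    have h4 := congrArg (fun L : (ℝ × ℝ) →L[ℝ] (ℝ × ℝ) => L (pdy φ (s₀, 0))) h3
    simp only [ContinuousLinearMap.comp_apply, ContinuousLinearMap.id_apply] at h4
    rw [← hξ, h0, map_zero] at h4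
    have h5 := nf.jac_axis.2.2
    rw [← h4] at h5
    exact lt_irrefl _ h5
  have hd1 : HasDerivAt (fun w => (c (φ (s₀, w))).1) ξ.1 0 := hcφ.fst
  have hd2 : HasDerivAt (fun w => (c (φ (s₀, w))).2) ξ.2 0 := hcφ.snd
  have hz1 : ξ.1 = 0 := by
    have h1 := (hchain (hF 0)).congr_of_eventuallyEq (hcF.mono fun w hw => hw.1)
    rw [hd1.unique h1]
    refine pdx_eq ((hF 0).differentiable (by simp) _) ?_
    simp only [hΨ'0]
    exact hasDerivAt_const _ _
  obtain ⟨G, hG, hGe, hG0⟩ := exists_eq_axis_add_mul (hF 2)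
  have hGV : ∀ u, G (u, 0) = fderiv ℝ Ψ' p (V u) 2 := fun u => by
    rw [hG0]
    refine pdy_eq ((hF 2).differentiable (by simp) _) ?_
    have h1 : HasDerivAt (fun t : ℝ => p + t • V u) (V u) 0 := by
      simpa using ((hasDerivAt_id (0 : ℝ)).smul_const (V u)).const_add p
    have h2 : HasFDerivAt Ψ' (fderiv ℝ Ψ' p) (p + (0 : ℝ) • V u) := by
      simpa using (hΨ'.differentiable (by simp) p).hasFDerivAt
    exact hasDerivAt_pi.1 (h2.comp_hasDerivAt 0 h1) 2
  have hGx : pdx G (0, 0) = 0 := by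
    refine pdx_eq (hG.differentiable (by simp) _) ?_
    simp only [hGV]
    have := hasDerivAt_pi.1 ((fderiv ℝ Ψ' p).hasFDerivAt.comp_hasDerivAt 0 hV0) 2
    simpa using this
  have hk := hchain hG
  rw [hGx] at hk
  have hb0 : (c (φ (s₀, 0))).2 = 0 := by rw [hφ0, hc0]
  have hslope := (hasDerivAt_iff_tendsto_slope_zero.1 hd2).pow 3
  -- From `b³ = w²G(w, w²)`, the cube of the difference quotient of `b` is `G(w, w²)/w`.
  have hbk : ∀ᶠ w in 𝓝[≠] (0 : ℝ), (w⁻¹ • ((c (φ (s₀, 0 + w))).2 - (c (φ (s₀, 0))).2)) ^ 3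
      = w⁻¹ * G (w, w ^ 2) := by
    filter_upwards [hcF.filter_mono nhdsWithin_le_nhds, self_mem_nhdsWithin] with w hw hw0
    rw [hb0, zero_add, sub_zero, smul_eq_mul, mul_pow, hw.2, hGe, hΨ'0]
    have : w ≠ 0 := hw0
    field_simp
    ring
  have hlim : Tendsto (fun w => w⁻¹ * G (w, w ^ 2)) (𝓝[≠] 0) (𝓝 (ξ.2 ^ 3)) :=
    hslope.congr' hbk
  -- The quotient `G(w, w²)/w` converges, which forces `G(0, 0) = 0`; its limit is then the
  -- derivative of `w ↦ G(w, w²)` at zero, known to vanish.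
  have hG00 : G (0, 0) = 0 := by
    have h1 : Tendsto (fun w : ℝ => w) (𝓝[≠] 0) (𝓝 0) := tendsto_id.mono_left nhdsWithin_le_nhds
    have h2 := h1.mul hlim
    rw [zero_mul] at h2
    have h3 : Tendsto (fun w => G (w, w ^ 2)) (𝓝[≠] 0) (𝓝 (G (0, 0))) := by
      have := hk.continuousAt.tendsto
      simp only [ne_eq, OfNat.ofNat_ne_zero, not_false_eq_true, zero_pow] at this
      exact this.mono_left nhdsWithin_le_nhds
    refine tendsto_nhds_unique (h3.congr' ?_) h2
    filter_upwards [self_mem_nhdsWithin] with w hw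
    rw [mul_inv_cancel_left₀ hw]
  have hlim' : Tendsto (fun w => w⁻¹ * G (w, w ^ 2)) (𝓝[≠] 0) (𝓝 0) := by
    refine (hasDerivAt_iff_tendsto_slope_zero.1 hk).congr fun w => ?_
    simp [hG00]
  have hz2 : ξ.2 = 0 := pow_eq_zero_iff three_ne_zero |>.1 (tendsto_nhds_unique hlim hlim')
  exact hξ0 (Prod.ext hz1 hz2)

theorem NormalForm.isCuspidalEdgePoint_iff (hI : IsOpen I) (hδ : 0 < δ)
    (hf : IsOrderFourEdge I δ f) (harc : IsArcLengthProjection I f) (hs₀ : s₀ ∈ I)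
    (nf : NormalForm I δ f s₀ σ m φ) : IsCuspidalEdgePoint f (s₀, 0) ↔ m (s₀, 0) ≠ 0 :=
  ⟨nf.ne_zero_of_isCuspidalEdgePoint, nf.isCuspidalEdgePoint hI hδ hf harc hs₀⟩

end Cuspidal

/-! ### Sections of the surface by the planes spanned by the normal and vertical vectors. -/

section SectionChart

variable {I : Set ℝ} {δ : ℝ} {f : ℝ × ℝ → Vec3} {s₀ : ℝ} {θ : ℝ × ℝ → ℝ × ℝ} {A B : ℝ × ℝ → ℝ}

/-- In the coordinates given by `θ`, the first coordinate lines of `f` are its sections by the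
planes spanned by the normal and the vertical vector. -/
structure SectionChart (f : ℝ × ℝ → Vec3) (s₀ : ℝ) (θ : ℝ × ℝ → ℝ × ℝ)
    (A B : ℝ × ℝ → ℝ) : Prop where
  smooth : SmoothNear θ (s₀, 0)
  smooth_fst : ContDiff ℝ ∞ A
  smooth_snd : ContDiff ℝ ∞ B
  fix_axis : ∀ᶠ u in 𝓝 s₀, θ (u, 0) = (u, 0)
  snd_eq : ∀ᶠ q in 𝓝 (s₀, (0 : ℝ)), (θ q).2 = q.2
  eq : ∀ᶠ q in 𝓝 (s₀, (0 : ℝ)), f (θ q) = edgeCurve f q.1 + frame f q.1 0 (A q) (B q)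

/-- In tubular coordinates of the target the first coordinate of `f` has derivative one along the
axis. It can therefore replace `s`, and its level lines are the plane sections. -/
theorem exists_sectionChart (hI : IsOpen I) (hδ : 0 < δ) (hf : IsOrderFourEdge I δ f)
    (harc : IsArcLengthProjection I f) (hs₀ : s₀ ∈ I) : ∃ θ A B, SectionChart f s₀ θ A B := by
  have hfs := smoothNear_edge hI hf (axis_mem hδ hs₀)
  have hpr : ∀ i : Fin 3, HasFDerivAt (fun z : Vec3 => z i)
      (ContinuousLinearMap.proj (R := ℝ) (φ := fun _ : Fin 3 => ℝ) i) 0 := fun i =>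
    (ContinuousLinearMap.proj (R := ℝ) (φ := fun _ : Fin 3 => ℝ) i).hasFDerivAt
  have hsm : ∀ i : Fin 3, SmoothNear (fun z : Vec3 => z i) 0 := fun i =>
    ContDiff.smoothNear (by fun_prop) 0
  obtain ⟨g, hg0, hg, hgs, hgs'⟩ := exists_tube_chart hI hδ hf harc hs₀ (hsm 1) (hsm 2) rfl rfl
    (fun v h0 h1 h2 => by
      rw [(hpr 1).fderiv] at h1
      rw [(hpr 2).fderiv] at h2
      ext i; fin_cases i
      · exact h0
      · exact h1
      · exact h2)
  have htube : ∀ u : ℝ, tube f s₀ (fun z => z 1) (fun z => z 2) ![u - s₀, 0, 0] = f (u, 0) :=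
    fun u => by
      simp only [tube, Matrix.cons_val, add_sub_cancel, edgeCurve]
      rw [frame_eq]; simp
  have hz0 : (![s₀ - s₀, 0, 0] : Vec3) = 0 := by ext i; fin_cases i <;> simp
  have hf0 : f (s₀, 0) = g 0 := by rw [hg, ← hz0, htube]
  have hgt : f (s₀, 0) ∈ g.target := by rw [hf0]; exact g.map_source hg0
  let P : ℝ × ℝ → Vec3 := fun q => g.symm (f q)
  have hP : SmoothNear P (s₀, 0) := SmoothNear.comp (g := g.symm)
    (SmoothNear.of_contDiffOn hgs' (g.open_target.mem_nhds hgt)) hfs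
  have hPax : ∀ᶠ u in 𝓝 s₀, P (u, 0) = ![u - s₀, 0, 0] := by
    have hc : Continuous fun u : ℝ => (![u - s₀, 0, 0] : Vec3) := by
      refine continuous_pi fun i => ?_
      fin_cases i
      · exact continuous_id.sub continuous_const
      · exact continuous_const
      · exact continuous_const
    have ht := hc.tendsto s₀
    rw [hz0] at ht
    filter_upwards [ht.eventually (g.open_source.mem_nhds hg0)] with u hu
    show g.symm (f (u, 0)) = _
    rw [← htube, ← hg, g.left_inv hu]
  have hPf : ∀ᶠ q in 𝓝 (s₀, (0 : ℝ)),
      f q = edgeCurve f (s₀ + P q 0) + frame f (s₀ + P q 0) 0 (P q 1) (P q 2) := by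
    filter_upwards [hfs.continuousAt.eventually (g.open_target.mem_nhds hgt)] with q hq
    have : g (P q) = f q := g.right_inv hq
    rw [← this, hg]; rfl
  -- The point is sent to the foot of its plane on `Γ`, with `t` unchanged. On the axis this is the
  -- identity, hence the inverse `θ` fixes the axis.
  let M : ℝ × ℝ → ℝ × ℝ := fun q => (s₀ + P q 0, q.2)
  have hM : SmoothNear M (s₀, 0) := by
    filter_upwards [hP] with q hq
    exact (contDiffAt_const.add (contDiffAt_pi.1 hq 0)).prodMk contDiffAt_snd
  have hMax : ∀ᶠ u in 𝓝 s₀, M (u, 0) = (u, 0) := by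
    filter_upwards [hPax] with u hu
    simp [M, hu]
  have hMx : pdx M (s₀, 0) = (1, 0) := by
    refine (hasDerivAt_fst hM.differentiableAt).unique ?_
    exact ((hasDerivAt_id s₀).prodMk (hasDerivAt_const s₀ (0 : ℝ))).congr_of_eventuallyEq hMax
  have hMy : (pdy M (s₀, 0)).2 = 1 := by
    have h : HasDerivAt (fun t => (M (s₀, t)).2) (pdy M (s₀, 0)).2 0 :=
      (hasDerivAt_snd hM.differentiableAt).snd
    exact h.unique (hasDerivAt_id (0 : ℝ))
  obtain ⟨e, he, -, heM, hes, hes'⟩ := hM.exists_openPartialHomeomorph rfl (fun v hv => by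
    rw [fderiv_apply_eq, hMx] at hv
    have hv1 := congrArg Prod.fst hv
    have hv2 := congrArg Prod.snd hv
    simp [hMy] at hv1 hv2
    rw [hv2] at hv1
    simp at hv1
    ext <;> simp [hv1, hv2]) univ_mem
  have heM0 : e (s₀, 0) = (s₀, 0) := by rw [heM]; exact hMax.self_of_nhds
  have het : (s₀, (0 : ℝ)) ∈ e.target := by
    have := e.map_source he
    rwa [heM0] at this
  have he0 : e.symm (s₀, 0) = (s₀, 0) := by
    conv_lhs => rw [← heM0]
    exact e.left_inv he
  have hθ : SmoothNear e.symm (s₀, 0) :=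
    SmoothNear.of_contDiffOn hes' (e.open_target.mem_nhds het)
  have hθt : Tendsto e.symm (𝓝 (s₀, 0)) (𝓝 (s₀, 0)) := by
    have := hθ.continuousAt
    rwa [ContinuousAt, he0] at this
  have hPθ : SmoothNear (fun q => P (e.symm q)) (s₀, 0) :=
    SmoothNear.comp (g := P) (by rw [he0]; exact hP) hθ
  obtain ⟨A, hA, hAe⟩ := (hPθ.apply 1).exists_contDiff
  obtain ⟨B, hB, hBe⟩ := (hPθ.apply 2).exists_contDiff
  refine ⟨e.symm, A, B, hθ, hA, hB, ?_, ?_, ?_⟩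
  · filter_upwards [hMax, (tendsto_axis s₀).eventually (e.open_source.mem_nhds he)] with u h1 h2
    conv_lhs => rw [← h1, ← heM]
    exact e.left_inv h2
  · filter_upwards [e.open_target.mem_nhds het] with q hq
    have h1 := e.right_inv hq
    rw [heM] at h1
    simpa [M] using congrArg Prod.snd h1
  · filter_upwards [e.open_target.mem_nhds het, hAe, hBe, hθt.eventually hPf] with q h1 h2 h3 h4
    have h5 := e.right_inv h1
    rw [heM] at h5
    have h6 : s₀ + P (e.symm q) 0 = q.1 := congrArg Prod.fst h5
    rw [h4, h6, ← h2, ← h3]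

namespace SectionChart

theorem tendsto (sc : SectionChart f s₀ θ A B) : Tendsto θ (𝓝 (s₀, 0)) (𝓝 (s₀, 0)) := by
  have := sc.smooth.continuousAt
  rwa [ContinuousAt, sc.fix_axis.self_of_nhds] at this

theorem axis_eq_zero (hI : IsOpen I) (hf : IsOrderFourEdge I δ f)
    (harc : IsArcLengthProjection I f) (hs₀ : s₀ ∈ I) (sc : SectionChart f s₀ θ A B) :
    ∀ᶠ u in 𝓝 s₀, A (u, 0) = 0 ∧ B (u, 0) = 0 := by
  filter_upwards [sc.fix_axis, (tendsto_axis s₀).eventually sc.eq, hI.mem_nhds hs₀] with u h1 h2 hu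
  rw [h1] at h2
  have h3 : frame f u 0 (A (u, 0)) (B (u, 0)) = 0 := by
    have : f (u, 0) = edgeCurve f u := rfl
    rw [this] at h2
    simpa using h2.symm
  exact (frame_eq_zero (harc u hu) (vel_vertical_sq hf harc hu) h3).2

theorem dT_eq (hI : IsOpen I) (hδ : 0 < δ) (hf : IsOrderFourEdge I δ f) (hs₀ : s₀ ∈ I)
    (sc : SectionChart f s₀ θ A B) : ∀ᶠ q in 𝓝 (s₀, (0 : ℝ)),
      dT (fun x => f (θ x)) q = frame f q.1 0 (pdy A q) (pdy B q) := by
  filter_upwards [pdy_congr sc.eq, (continuous_fst.tendsto (s₀, (0 : ℝ))).eventually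
    (hI.mem_nhds hs₀)] with q h1 h2
  exact h1.trans (pdy_curve_add_frame hI hδ hf h2 sc.smooth_fst sc.smooth_snd)

/-- On the axis `f_t = 0`, so the derivative of the section is a multiple of `Γ'`. It lies in the
plane of `n` and `v`, which does not contain `Γ'`; hence it vanishes. -/
theorem pdy_axis (hI : IsOpen I) (hδ : 0 < δ) (hf : IsOrderFourEdge I δ f)
    (harc : IsArcLengthProjection I f) (hs₀ : s₀ ∈ I) (sc : SectionChart f s₀ θ A B) :
    ∀ᶠ u in 𝓝 s₀, pdy θ (u, 0) = (0, 1) ∧ pdy A (u, 0) = 0 ∧ pdy B (u, 0) = 0 := by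
  filter_upwards [(tendsto_axis s₀).eventually (sc.dT_eq hI hδ hf hs₀),
    (tendsto_axis s₀).eventually sc.smooth.eventually, sc.fix_axis, hI.mem_nhds hs₀,
    (tendsto_axis s₀).eventually sc.snd_eq.eventually_nhds] with u h1 h2 h3 hu h4
  rw [dT_comp (by rw [h3]; exact (smoothNear_edge hI hf (axis_mem hδ hu)).differentiableAt)
    h2.differentiableAt, h3, dT_axis hf hu, dS_axis hI hδ hf hu, smul_zero, add_zero, vel_eq_frame,
    frame_smul, ← sub_eq_zero, sub_eq_add_neg, ← neg_one_smul ℝ, frame_smul, frame_add] at h1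
  obtain ⟨e1, e2, e3⟩ := frame_eq_zero (harc u hu) (vel_vertical_sq hf harc hu) h1
  have e4 : (pdy θ (u, 0)).1 = 0 := by linarith
  have e5 : (pdy θ (u, 0)).2 = 1 := by
    have h5 : (fun t => (θ (u, t)).2) =ᶠ[𝓝 0] fun t => t :=
      ((by fun_prop : Continuous fun t : ℝ => (u, t)).tendsto 0).eventually h4
    have h6 : HasDerivAt (fun t => (θ (u, t)).2) (pdy θ (u, 0)).2 0 :=
      (hasDerivAt_snd h2.differentiableAt).snd
    exact h6.unique ((hasDerivAt_id (0 : ℝ)).congr_of_eventuallyEq h5)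
  refine ⟨Prod.ext e4 e5, by linarith, by rw [e4] at e3; linarith⟩

/-- On the axis `E = 0`, so the `t²` coefficient of `Δ` is minus the square of the `t` coefficient
of `F`, that is `-B_tt²`. Divisibility of `Δ` by `t⁴` makes it vanish. -/
theorem pdy_pdy_snd_axis (hI : IsOpen I) (hδ : 0 < δ) (hf : IsOrderFourEdge I δ f)
    (harc : IsArcLengthProjection I f) (hs₀ : s₀ ∈ I) (sc : SectionChart f s₀ θ A B) :
    ∀ᶠ u in 𝓝 s₀, pdy (pdy B) (u, 0) = 0 := by
  have hA := sc.smooth_fst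
  have hB := sc.smooth_snd
  obtain ⟨k, hk, hkκ⟩ := (smoothNear_planeCurvature hI hδ hf hs₀).exists_contDiff
  obtain ⟨D, hD, hDe, -⟩ := exists_deltaL_eq hI hδ hf hs₀
  obtain ⟨α, hα, hαe, -⟩ := exists_eq_axis_add_mul (contDiff_pdy hA)
  obtain ⟨β, hβ, hβe, hβ0⟩ := exists_eq_axis_add_mul (contDiff_pdy hB)
  have hfst : Tendsto Prod.fst (𝓝 (s₀, (0 : ℝ))) (𝓝 s₀) := continuous_fst.tendsto _
  have hAx := contDiff_pdx hA
  have hBx := contDiff_pdx hB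
  -- This is `Δ / t²` after the factorisations `A_t = tα` and `B_t = tβ`.
  let Q : ℝ × ℝ → ℝ := fun q =>
    ((1 - k q.1 * A q) ^ 2 + pdx A q ^ 2 - (1 + pdx B q) ^ 2) * (α q ^ 2 - β q ^ 2) -
      (pdx A q * α q - (1 + pdx B q) * β q) ^ 2
  have hQ : Continuous Q := by
    have h1 := hk.continuous
    have h2 := hA.continuous
    have h3 := hAx.continuous
    have h4 := hBx.continuous
    have h5 := hα.continuous
    have h6 := hβ.continuous
    dsimp only [Q]; fun_prop
  have hΔ : ∀ᶠ q in 𝓝 (s₀, (0 : ℝ)), q.2 ^ 2 * Q q = q.2 ^ 2 * (q.2 ^ 2 * (jac θ q ^ 2 *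
      D (θ q))) := by
    filter_upwards [pdx_congr sc.eq, sc.dT_eq hI hδ hf hs₀, hfst.eventually (hI.mem_nhds hs₀),
      hfst.eventually hkκ, hfst.eventually (sc.pdy_axis hI hδ hf harc hs₀),
      sc.tendsto.eventually hDe, sc.smooth.eventually, sc.snd_eq, sc.tendsto.eventually
      (edgeDomain_mem_nhds hI (axis_mem hδ hs₀))] with q h1 h2 hu h3 h4 h5 h6 h7 h8
    have e1 := harc q.1 hu
    have e2 := vel_vertical_sq hf harc hu
    have h9 := deltaL_comp (smoothNear_edge hI hf h8) h6
    rw [pdx_curve_add_frame hI hδ hf harc hu hA hB] at h1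
    rw [h5, h7, deltaL, coeffE, coeffF, coeffG, show dS (fun x => f (θ x)) q = _ from h1, h2,
      linner_frame e1 e2, linner_frame e1 e2, linner_frame e1 e2, h3] at h9
    have h10 : pdy A q = q.2 * α q := by
      have := hαe q.1 q.2
      rw [h4.2.1, zero_add] at this
      exact this
    have h11 : pdy B q = q.2 * β q := by
      have := hβe q.1 q.2
      rw [h4.2.2, zero_add] at this
      exact this
    rw [h10, h11] at h9
    simp only [Q]
    linear_combination h9
  have hAax := sc.axis_eq_zero hI hf harc hs₀
  filter_upwards [(tendsto_axis s₀).eventually hΔ.eventually_nhds, hAax.eventually_nhds,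
    (tendsto_axis s₀).eventually sc.smooth.eventually] with u h1 h2 h3
  have hjc : ContinuousAt (jac θ) (u, 0) := by
    have h4 := h3.pdx.continuousAt
    have h5 := h3.pdy.continuousAt
    exact (h4.fst.mul h5.snd).sub (h4.snd.mul h5.fst)
  have h4 := eq_of_pow_mul_eq 2 hQ.continuousAt ((continuousAt_snd.pow 2).mul ((hjc.pow 2).mul
    (hD.continuous.continuousAt.comp h3.continuousAt))) h1
  have h5 : A (u, 0) = 0 := h2.self_of_nhds.1
  have h6 : pdx A (u, 0) = 0 := pdx_eq (hA.differentiable (by simp) _)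
    ((hasDerivAt_const u (0 : ℝ)).congr_of_eventuallyEq (h2.mono fun u hu => hu.1))
  have h7 : pdx B (u, 0) = 0 := pdx_eq (hB.differentiable (by simp) _)
    ((hasDerivAt_const u (0 : ℝ)).congr_of_eventuallyEq (h2.mono fun u hu => hu.2))
  simp only [Q, h5, h6, h7] at h4
  rw [← hβ0]
  simpa using h4

/-- Otherwise, as `B_tt` vanishes too, the second derivative of the section is zero and `f_tt` is a
multiple of `Γ'`, against the independence required of a generalized cuspidal edge. -/
theorem pdy_pdy_fst_ne_zero (hI : IsOpen I) (hδ : 0 < δ) (hf : IsOrderFourEdge I δ f)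
    (harc : IsArcLengthProjection I f) (hs₀ : s₀ ∈ I) (sc : SectionChart f s₀ θ A B) :
    pdy (pdy A) (s₀, 0) ≠ 0 := by
  intro h0
  have hB0 := (sc.pdy_pdy_snd_axis hI hδ hf harc hs₀).self_of_nhds
  have hax := (sc.pdy_axis hI hδ hf harc hs₀).self_of_nhds.1
  have hθ0 := sc.fix_axis.self_of_nhds
  have h1 : dT (dT fun x => f (θ x)) (s₀, 0) = 0 := by
    have h2 := (pdy_congr (sc.dT_eq hI hδ hf hs₀)).eq_of_nhds
    refine h2.trans ?_
    rw [pdy_frame hI hδ hf hs₀ (ContDiff.smoothNear contDiff_const _)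
      (ContDiff.smoothNear (contDiff_pdy sc.smooth_fst) _)
      (ContDiff.smoothNear (contDiff_pdy sc.smooth_snd) _), h0, hB0]
    simp [pdy, frame_eq]
  rw [dT_dT_comp (by rw [hθ0]; exact smoothNear_edge hI hf (axis_mem hδ hs₀)) sc.smooth, hax, hθ0,
    dT_axis hf hs₀, dS_axis hI hδ hf hs₀] at h1
  have h2 := LinearIndependent.pair_iff.1 (hf.edge.independent s₀ hs₀) 1
    (pdy (fun x => (pdy θ x).1) (s₀, 0)) (by
      rw [← h1]; simp [add_comm])
  exact one_ne_zero h2.1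

end SectionChart

end SectionChart

/-! ### Half-arc-length parameter and existence of the `μ`-function. -/

section Existence

variable {I : Set ℝ} {δ : ℝ} {f : ℝ × ℝ → Vec3} {s₀ σ : ℝ} {θ : ℝ × ℝ → ℝ × ℝ} {A B : ℝ × ℝ → ℝ}

/-- The arctangent yields an angle of positive cosine; the sign `σ` of `a` is carried by the radius.
This keeps the angle smooth and equal to zero where `b` vanishes. -/
theorem mul_cos_arctan_div {a b : ℝ} (hσ : σ = 1 ∨ σ = -1) (h : 0 < σ * a) :
    σ * √(a ^ 2 + b ^ 2) * Real.cos (Real.arctan (b / a)) = a ∧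
      σ * √(a ^ 2 + b ^ 2) * Real.sin (Real.arctan (b / a)) = b := by
  have ha : a ≠ 0 := right_ne_zero_of_mul h.ne'
  have hσ2 : σ * σ = 1 := by rcases hσ with h | h <;> simp [h]
  have hpos : 0 < √(a ^ 2 + b ^ 2) := Real.sqrt_pos.2 (by positivity)
  have h1 : √(1 + (b / a) ^ 2) = √(a ^ 2 + b ^ 2) / (σ * a) := by
    have h2 : 1 + (b / a) ^ 2 = (a ^ 2 + b ^ 2) / (σ * a) ^ 2 := by
      rw [show (σ * a) ^ 2 = (σ * σ) * a ^ 2 by ring, hσ2]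
      field_simp
    rw [h2, Real.sqrt_div' _ (sq_nonneg _), Real.sqrt_sq h.le]
  rw [Real.cos_arctan, Real.sin_arctan, h1]
  constructor
  · field_simp
    linear_combination hσ2
  · field_simp
    linear_combination b * hσ2

theorem eventually_eq_zero_of_pdy {g : ℝ × ℝ → ℝ} (hg : SmoothNear g (s₀, 0))
    (h : ∀ᶠ q in 𝓝 (s₀, (0 : ℝ)), pdy g q = 0) (h0 : ∀ᶠ u in 𝓝 s₀, g (u, 0) = 0) :
    ∀ᶠ q in 𝓝 (s₀, (0 : ℝ)), g q = 0 := by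
  obtain ⟨r, hr, hb⟩ := exists_box_subset (hg.and (h.and
    ((continuous_fst.tendsto (s₀, (0 : ℝ))).eventually h0)))
  filter_upwards [box_mem_nhds hr] with q hq
  obtain ⟨u, w⟩ := q
  have hd : ∀ t ∈ Ioo (-r) r, HasDerivAt (fun t => g (u, t)) 0 t := fun t ht => by
    have h1 := hb (a := (u, t)) ⟨hq.1, ht⟩
    have h2 := hasDerivAt_snd (h1.1.differentiableAt (by simp))
    rwa [h1.2.1] at h2
  have h1 := isOpen_Ioo.is_const_of_deriv_eq_zero isPreconnected_Ioo
    (fun t ht => (hd t ht).differentiableAt.differentiableWithinAt)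
    (fun t ht => (hd t ht).deriv) hq.2 (show (0 : ℝ) ∈ Ioo (-r) r by simp [hr])
  simp only at h1
  rw [h1]
  exact (hb hq).2.2

/-- The coordinates in which all section curves are parametrized by the square root of twice the
arc length, the speed of the section curves being `|t| ρ`. -/
theorem exists_halfArcLength_chart {ρ : ℝ × ℝ → ℝ} (hρ : ContDiff ℝ ∞ ρ) (hρ0 : 0 < ρ (s₀, 0)) :
    ∃ ψ : ℝ × ℝ → ℝ × ℝ, SmoothNear ψ (s₀, 0) ∧ (∀ᶠ q in 𝓝 (s₀, (0 : ℝ)), (ψ q).1 = q.1) ∧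
      (∀ᶠ u in 𝓝 s₀, ψ (u, 0) = (u, 0)) ∧ (∀ᶠ q in 𝓝 (s₀, (0 : ℝ)), (pdy ψ q).1 = 0) ∧
      (∀ᶠ u in 𝓝 s₀, 0 < (pdy ψ (u, 0)).2) ∧
      ∀ᶠ q in 𝓝 (s₀, (0 : ℝ)), (pdy ψ q).2 * ((ψ q).2 * ρ (ψ q)) = q.2 := by
  have hZ : ContDiff ℝ ∞ (avg 1 ρ) := contDiff_avg 1 hρ
  have hpos : ∀ᶠ q in 𝓝 (s₀, (0 : ℝ)), 0 < 2 * avg 1 ρ q :=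
    (continuousAt_const.mul hZ.continuous.continuousAt).eventually_const_lt (by
      rw [Pi.mul_apply, avg_axis]; positivity)
  have hr : SmoothNear (fun q => √(2 * avg 1 ρ q)) (s₀, 0) := by
    filter_upwards [hpos] with q hq using (contDiffAt_const.mul hZ.contDiffAt).sqrt hq.ne'
  set r : ℝ × ℝ → ℝ := fun q => √(2 * avg 1 ρ q) with hr_def
  have hr0 : ∀ᶠ q in 𝓝 (s₀, (0 : ℝ)), 0 < r q := hpos.mono fun q hq => Real.sqrt_pos.2 hq
  -- The required parameter satisfies `w²/2 = ∫₀ᵗ r ρ dr`, and the integral is `t²` times the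
  -- average. Hence `w = t√(2 avg)`, a smooth function of `t`.
  let M : ℝ × ℝ → ℝ × ℝ := fun q => (q.1, q.2 * r q)
  have hM : SmoothNear M (s₀, 0) := by
    filter_upwards [hr] with q hq using contDiffAt_fst.prodMk (contDiffAt_snd.mul hq)
  have hMax : ∀ u, M (u, 0) = (u, 0) := fun u => by simp [M]
  have hMx : pdx M (s₀, 0) = (1, 0) := by
    refine pdx_eq hM.differentiableAt ?_
    simp only [hMax]
    exact (hasDerivAt_id s₀).prodMk (hasDerivAt_const _ _)
  have hMy : pdy M (s₀, 0) = (0, r (s₀, 0)) := by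
    refine pdy_eq hM.differentiableAt ?_
    have h2 := (hasDerivAt_id (0 : ℝ)).mul (hasDerivAt_snd hr.differentiableAt)
    refine ((hasDerivAt_const (0 : ℝ) s₀).prodMk h2).congr_deriv ?_
    simp
  obtain ⟨e, he, hse, heM, -, hes'⟩ := hM.exists_openPartialHomeomorph rfl (fun v hv => by
    rw [fderiv_apply_eq, hMx, hMy] at hv
    have hv1 := congrArg Prod.fst hv
    have hv2 := congrArg Prod.snd hv
    simp [hr0.self_of_nhds.ne'] at hv1 hv2
    ext <;> simp [hv1, hv2]) (inter_mem hpos hr.eventually)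
  have het : (s₀, (0 : ℝ)) ∈ e.target := by
    have := e.map_source he
    rwa [heM, hMax] at this
  have hψ : SmoothNear e.symm (s₀, 0) :=
    SmoothNear.of_contDiffOn hes' (e.open_target.mem_nhds het)
  have hinv : ∀ᶠ q in 𝓝 (s₀, (0 : ℝ)), (e.symm q).1 = q.1 ∧
      (e.symm q).2 * r (e.symm q) = q.2 := by
    filter_upwards [e.open_target.mem_nhds het] with q hq
    have h1 := e.right_inv hq
    rw [heM] at h1
    exact ⟨by simpa [M] using congrArg Prod.fst h1, by simpa [M] using congrArg Prod.snd h1⟩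
  have hfix : ∀ᶠ u in 𝓝 s₀, e.symm (u, 0) = (u, 0) := by
    filter_upwards [(tendsto_axis s₀).eventually (e.open_source.mem_nhds he)] with u hu
    have h1 := e.left_inv hu
    rwa [heM, hMax] at h1
  have hy1 : ∀ᶠ q in 𝓝 (s₀, (0 : ℝ)), (pdy e.symm q).1 = 0 := by
    filter_upwards [hψ, hinv.eventually_nhds] with q h1 h2
    have h3 : HasDerivAt (fun t => (e.symm (q.1, t)).1) (pdy e.symm (q.1, q.2)).1 q.2 :=
      (hasDerivAt_snd (h1.differentiableAt (by simp))).fst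
    have h4 : (fun t => (e.symm (q.1, t)).1) =ᶠ[𝓝 q.2] fun _ => q.1 :=
      ((by fun_prop : Continuous fun t : ℝ => (q.1, t)).tendsto q.2).eventually
        (h2.mono fun _ h => h.1)
    exact h3.unique ((hasDerivAt_const q.2 q.1).congr_of_eventuallyEq h4)
  refine ⟨e.symm, hψ, hinv.mono fun q hq => hq.1, hfix, hy1, ?_, ?_⟩
  · filter_upwards [hfix, (tendsto_axis s₀).eventually hψ.eventually,
      (tendsto_axis s₀).eventually hinv.eventually_nhds, (tendsto_axis s₀).eventually hr0,
      (tendsto_axis s₀).eventually hr.eventually] with u h1 h2 h3 h4 h5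
    have h6 : HasDerivAt (fun t => (e.symm (u, t)).2) (pdy e.symm (u, 0)).2 0 :=
      (hasDerivAt_snd h2.differentiableAt).snd
    have h7 : SmoothNear (fun q => r (e.symm q)) (u, 0) :=
      SmoothNear.comp (by rw [h1]; exact h5) h2
    have h8 := h6.mul (hasDerivAt_snd h7.differentiableAt)
    have h9 : (fun t => (e.symm (u, t)).2 * r (e.symm (u, t))) =ᶠ[𝓝 0] fun t => t :=
      ((by fun_prop : Continuous fun t : ℝ => (u, t)).tendsto 0).eventually
        (h3.mono fun _ h => h.2)
    have h10 := h8.unique ((hasDerivAt_id (0 : ℝ)).congr_of_eventuallyEq h9)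
    simp only [h1, zero_mul, add_zero] at h10
    exact pos_of_mul_pos_left (h10 ▸ one_pos) h4.le
  · have hZ2 : ContDiff ℝ ∞ fun q : ℝ × ℝ => q.2 ^ 2 * avg 1 ρ q := (contDiff_snd.pow 2).mul hZ
    filter_upwards [hψ, hy1, hinv.eventually_nhds, e.open_target.mem_nhds het]
      with q h1 h2 h3 h4
    have h5 := pdy_comp (h := fun q : ℝ × ℝ => q.2 ^ 2 * avg 1 ρ q) (φ := e.symm) (q := q)
      (hZ2.differentiable (by simp) _) (h1.differentiableAt (by simp))
    -- Differentiating this identity in `w` gives the asserted relation between the speed and the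
    -- derivative of the parameter.
    have h7 : (fun x => (e.symm x).2 ^ 2 * avg 1 ρ (e.symm x)) =ᶠ[𝓝 q] fun x => x.2 ^ 2 / 2 := by
      filter_upwards [h3, e.open_target.mem_nhds h4] with x hx hx4
      have hp := (hse (e.map_target hx4)).1
      have h8 : r (e.symm x) ^ 2 = 2 * avg 1 ρ (e.symm x) := Real.sq_sqrt (le_of_lt hp)
      rw [← hx.2, mul_pow, h8]; ring
    rw [(pdy_congr h7).eq_of_nhds, h2, zero_smul, zero_add, smul_eq_mul] at h5
    have h8 := pdy_pow_mul_avg 1 hρ (e.symm q)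
    simp only [Nat.reduceAdd, pow_one] at h8
    rw [h8] at h5
    rw [← h5]
    refine pdy_eq (u := q.1) (w := q.2) (by fun_prop) ?_
    exact ((hasDerivAt_pow 2 q.2).div_const 2).congr_deriv (by simp)

/-- Write the velocity of a section as `t(α, β)`. Since `α ≠ 0` near `p`, the angle `arctan(β/α)`
and the speed factor `ρ` are smooth. In the half-arc-length parameter the velocity is `σw(cos Λ, sin
Λ)`, so `μ` has to be `Λ_w`. -/
theorem SectionChart.exists_normalForm (hI : IsOpen I) (hδ : 0 < δ) (hf : IsOrderFourEdge I δ f)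
    (harc : IsArcLengthProjection I f) (hs₀ : s₀ ∈ I) (sc : SectionChart f s₀ θ A B) :
    ∃ σ m φ, NormalForm I δ f s₀ σ m φ := by
  obtain ⟨α, hα, hαe, hα0⟩ := exists_eq_axis_add_mul (contDiff_pdy sc.smooth_fst)
  obtain ⟨β, hβ, hβe, hβ0⟩ := exists_eq_axis_add_mul (contDiff_pdy sc.smooth_snd)
  have hα1 : α (s₀, 0) ≠ 0 := by
    rw [hα0]; exact sc.pdy_pdy_fst_ne_zero hI hδ hf harc hs₀
  have hβ1 : ∀ᶠ u in 𝓝 s₀, β (u, 0) = 0 := by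
    filter_upwards [sc.pdy_pdy_snd_axis hI hδ hf harc hs₀] with u hu
    rw [hβ0, hu]
  obtain ⟨σ, hσ, hσα⟩ : ∃ σ : ℝ, (σ = 1 ∨ σ = -1) ∧ 0 < σ * α (s₀, 0) := by
    rcases lt_or_gt_of_ne hα1 with h | h
    · exact ⟨-1, Or.inr rfl, by linarith⟩
    · exact ⟨1, Or.inl rfl, by linarith⟩
  have hαpos : ∀ᶠ q in 𝓝 (s₀, (0 : ℝ)), 0 < σ * α q :=
    (continuousAt_const.mul hα.continuous.continuousAt).eventually_const_lt hσα
  have hρs : SmoothNear (fun q => √(α q ^ 2 + β q ^ 2)) (s₀, 0) := by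
    filter_upwards [hαpos] with q hq
    have : α q ≠ 0 := right_ne_zero_of_mul hq.ne'
    exact ((hα.contDiffAt.pow 2).add (hβ.contDiffAt.pow 2)).sqrt (by positivity)
  obtain ⟨ρ, hρ, hρe⟩ := hρs.exists_contDiff
  have hρ0 : 0 < ρ (s₀, 0) := by
    rw [← hρe.self_of_nhds]
    exact Real.sqrt_pos.2 (by positivity)
  obtain ⟨ψ, hψ, hψ1, hψax, hψy1, hψy2, hψρ⟩ := exists_halfArcLength_chart hρ hρ0
  have hψ0 : ψ (s₀, 0) = (s₀, 0) := hψax.self_of_nhds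
  have hψt : Tendsto ψ (𝓝 (s₀, 0)) (𝓝 (s₀, 0)) := by
    have := hψ.continuousAt
    rwa [ContinuousAt, hψ0] at this
  have hΛs : SmoothNear (fun q => Real.arctan (β (ψ q) / α (ψ q))) (s₀, 0) := by
    refine SmoothNear.comp (g := fun q => Real.arctan (β q / α q)) ?_ hψ
    rw [hψ0]
    filter_upwards [hαpos] with q hq
    exact (hβ.contDiffAt.div hα.contDiffAt (right_ne_zero_of_mul hq.ne')).arctan
  obtain ⟨Λ, hΛ, hΛe⟩ := hΛs.exists_contDiff
  have hfst : Tendsto Prod.fst (𝓝 (s₀, (0 : ℝ))) (𝓝 s₀) := continuous_fst.tendsto _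
  -- Integrating `Λ_w` from the axis recovers `Λ` only because `Λ` vanishes there, which is where
  -- `B_tt = 0` is used.
  have hang : ∀ᶠ q in 𝓝 (s₀, (0 : ℝ)), angle (pdy Λ) q = Real.arctan (β (ψ q) / α (ψ q)) := by
    have h1 : ∀ᶠ u in 𝓝 s₀, Λ (u, 0) = 0 := by
      filter_upwards [(tendsto_axis s₀).eventually hΛe, hψax, hβ1] with u h1 h2 h3
      rw [← h1, h2, h3]; simp
    filter_upwards [hΛe, hfst.eventually h1] with q h2 h3
    rw [h2]
    have h4 := eq_axis_add_mul_avg hΛ q.1 q.2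
    rw [h3, zero_add] at h4
    exact h4.symm
  have hm : ContDiff ℝ ∞ (pdy Λ) := contDiff_pdy hΛ
  have hax := sc.axis_eq_zero hI hf harc hs₀
  have hyax := sc.pdy_axis hI hδ hf harc hs₀
  -- Both sides vanish on the axis and have equal `w`-derivatives, so they agree. The derivatives
  -- are compared after multiplication by the positive speed factor, since the half-arc-length
  -- relation is stated as a product.
  have key : ∀ {C c S : ℝ × ℝ → ℝ}, ContDiff ℝ ∞ C → ContDiff ℝ ∞ S →
      (∀ᶠ u in 𝓝 s₀, C (u, 0) = 0) → (∀ u, S (u, 0) = 0) →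
      (∀ᶠ q in 𝓝 (s₀, (0 : ℝ)), pdy C q = q.2 * c q) →
      (∀ᶠ q in 𝓝 (s₀, (0 : ℝ)), σ * pdy S q * ρ (ψ q) = q.2 * c (ψ q)) →
      ∀ᶠ q in 𝓝 (s₀, (0 : ℝ)), C (ψ q) = σ * S q := by
    intro C c S hC hS hC0 hS0 hCy hSy
    have hCs : SmoothNear (fun q => C (ψ q)) (s₀, 0) :=
      SmoothNear.comp (ContDiff.smoothNear hC _) hψ
    have hg : SmoothNear (fun q => C (ψ q) - σ * S q) (s₀, 0) := by
      filter_upwards [hCs] with q hq using hq.sub (contDiffAt_const.mul hS.contDiffAt)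
    have hρpos : ∀ᶠ q in 𝓝 (s₀, (0 : ℝ)), 0 < ρ (ψ q) :=
      hψt.eventually (hρ.continuous.continuousAt.eventually_const_lt hρ0)
    have h1 := eventually_eq_zero_of_pdy hg (by
      filter_upwards [hψ, hCs, hψy1, hψρ, hψt.eventually hCy, hSy, hρpos]
        with q h1 h2 h3 h4 h5 h6 h7
      have h8 : pdy (fun q => C (ψ q)) q = (pdy ψ q).2 * ((ψ q).2 * c (ψ q)) := by
        rw [pdy_comp (hC.differentiable (by simp) _) (h1.differentiableAt (by simp)), h3, h5]
        simp
      have h9 : pdy (fun q => C (ψ q) - σ * S q) q =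
          pdy (fun q => C (ψ q)) q - σ * pdy S q := by
        refine pdy_eq (u := q.1) (w := q.2) ((h2.differentiableAt (by simp)).sub
          ((hS.differentiable (by simp) _).const_mul σ)) ?_
        exact (hasDerivAt_snd (h2.differentiableAt (by simp))).sub
          ((hasDerivAt_snd (hS.differentiable (by simp) _)).const_mul σ)
      rw [h9, h8]
      have h10 : ((pdy ψ q).2 * ((ψ q).2 * c (ψ q)) - σ * pdy S q) * ρ (ψ q) = 0 := by
        linear_combination c (ψ q) * h4 - h6
      exact (mul_eq_zero.1 h10).resolve_right h7.ne') (by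
      filter_upwards [hψax, hC0] with u h1 h2
      rw [h1, h2, hS0]; ring)
    filter_upwards [h1] with q hq using sub_eq_zero.1 hq
  have hA := key (c := α) sc.smooth_fst (contDiff_secX hm) (hax.mono fun u hu => hu.1)
    (fun u => by simp [secX]) (by
      filter_upwards [hfst.eventually hyax] with q hq
      have := hαe q.1 q.2
      rwa [hq.2.1, zero_add] at this) (by
      filter_upwards [hang, hψt.eventually hρe, hψt.eventually hαpos] with q h1 h2 h3
      rw [pdy_secX hm, h1, ← h2]
      linear_combination q.2 * (mul_cos_arctan_div (b := β (ψ q)) hσ h3).1)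
  have hB := key (c := β) sc.smooth_snd (contDiff_secY hm) (hax.mono fun u hu => hu.2)
    (fun u => by simp [secY]) (by
      filter_upwards [hfst.eventually hyax] with q hq
      have := hβe q.1 q.2
      rwa [hq.2.2, zero_add] at this) (by
      filter_upwards [hang, hψt.eventually hρe, hψt.eventually hαpos] with q h1 h2 h3
      rw [pdy_secY hm, h1, ← h2]
      linear_combination q.2 * (mul_cos_arctan_div (b := β (ψ q)) hσ h3).2)
  have hφs : SmoothNear (fun q => θ (ψ q)) (s₀, 0) :=
    SmoothNear.comp (by rw [hψ0]; exact sc.smooth) hψ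
  have hφax : ∀ᶠ u in 𝓝 s₀, θ (ψ (u, 0)) = (u, 0) := by
    filter_upwards [hψax, sc.fix_axis] with u h1 h2
    rw [h1, h2]
  have hφy : ∀ᶠ u in 𝓝 s₀, pdy (fun q => θ (ψ q)) (u, 0) = (0, (pdy ψ (u, 0)).2) := by
    filter_upwards [hψax, (tendsto_axis s₀).eventually hψ.eventually,
      (tendsto_axis s₀).eventually sc.smooth.eventually, (tendsto_axis s₀).eventually hψy1,
      hyax] with u h1 h2 h3 h4 h5
    rw [pdy_comp (by rw [h1]; exact h3.differentiableAt) h2.differentiableAt, h4, h1, h5.1]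
    simp
  refine ⟨σ, pdy Λ, fun q => θ (ψ q), hσ, hm, hφs, hφax, hφy.mono fun u hu => by rw [hu], ?_, ?_, ?_⟩
  · filter_upwards [hφy, hψy2] with u h1 h2
    rw [h1]; exact h2
  · have h1 := hφs.continuousAt
    rw [ContinuousAt, hφax.self_of_nhds] at h1
    exact h1.eventually (edgeDomain_mem_nhds hI (axis_mem hδ hs₀))
  · filter_upwards [hψt.eventually sc.eq, hψ1, hA, hB] with q h1 h2 h3 h4
    rw [h1, h2, h3, h4]

theorem NormalForm.isMuFunctionAt {m : ℝ × ℝ → ℝ} {φ : ℝ × ℝ → ℝ × ℝ}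
    (nf : NormalForm I δ f s₀ σ m φ) : IsMuFunctionAt I δ f s₀ σ m := by
  have hfst : Tendsto Prod.fst (𝓝 (s₀, (0 : ℝ))) (𝓝 s₀) := continuous_fst.tendsto _
  obtain ⟨r, hr, hb⟩ := exists_box_subset (nf.smooth.and (nf.mem.and (nf.eq.and
    (hfst.eventually (nf.fix_axis.and (nf.s_v.and nf.t_v))))))
  have hax : ∀ u ∈ Ioo (s₀ - r) (s₀ + r), (u, (0 : ℝ)) ∈ box s₀ r := fun u hu =>
    ⟨hu, by simp [hr]⟩
  refine ⟨nf.sign, r, φ, hr, ⟨fun q hq => (hb hq).1.contDiffWithinAt,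
    fun u hu => (hb (hax u hu)).2.2.2.1, fun u hu => (hb (hax u hu)).2.2.2.2.1,
    fun u hu => (hb (hax u hu)).2.2.2.2.2⟩, fun q hq => (hb hq).2.1,
    nf.smooth_mu.contDiffOn, fun u v huv => ?_⟩
  rw [(hb huv).2.2.1, frame_eq, cuspX_eq, cuspY_eq, add_assoc]

theorem exists_isMuFunctionAt (hI : IsOpen I) (hδ : 0 < δ) (hf : IsOrderFourEdge I δ f)
    (harc : IsArcLengthProjection I f) (hs₀ : s₀ ∈ I) :
    ∃ (σ : ℝ) (μ : ℝ × ℝ → ℝ), IsMuFunctionAt I δ f s₀ σ μ := by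
  obtain ⟨θ, A, B, sc⟩ := exists_sectionChart hI hδ hf harc hs₀
  obtain ⟨σ, m, φ, nf⟩ := sc.exists_normalForm hI hδ hf harc hs₀
  exact ⟨σ, m, nf.isMuFunctionAt⟩

end Existence

end Minkowski

end

theorem theoremG (I : Set ℝ) (hIopen : IsOpen I) (hIconn : I.OrdConnected)
    (δ : ℝ) (hδ : 0 < δ) (f : ℝ × ℝ → Minkowski.Vec3)
    (hf : Minkowski.IsOrderFourEdge I δ f)
    (harc : Minkowski.IsArcLengthProjection I f)
    (s₀ : ℝ) (hs₀ : s₀ ∈ I) :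
    -- the sign `σ` and the `μ`-function exist
    (∃ (σ : ℝ) (μ : ℝ × ℝ → ℝ), Minkowski.IsMuFunctionAt I δ f s₀ σ μ) ∧
    ∀ (σ : ℝ) (μ : ℝ × ℝ → ℝ), Minkowski.IsMuFunctionAt I δ f s₀ σ μ →
    -- there are arbitrarily small neighbourhoods `V` of `p = (s₀, 0)` such that:
    ∀ W ∈ 𝓝 ((s₀, 0) : ℝ × ℝ), ∃ V : Set (ℝ × ℝ),
      IsOpen V ∧ ((s₀, 0) : ℝ × ℝ) ∈ V ∧ V ⊆ W ∧ V ⊆ Minkowski.edgeDomain I δ ∧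
      -- (a)
      ((∀ q ∈ V \ Minkowski.sAxis, Minkowski.IsSpacelikeAt f q) ∨
        (∀ q ∈ V \ Minkowski.sAxis, Minkowski.IsTimelikeAt f q)) ∧
      -- (b)
      ((∃ C : ℝ, ∀ q ∈ V \ Minkowski.sAxis, |Minkowski.meanL f q| ≤ C) ↔
        ∀ s : ℝ, ((s, 0) : ℝ × ℝ) ∈ V →
          3 * Minkowski.planeCurvature f s * Minkowski.muOne μ s =
            8 * Minkowski.muZero μ s * deriv (Minkowski.muZero μ) s
              + 3 * σ * deriv (Minkowski.planeCurvature f) s) ∧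
      -- (c)
      (¬ AccPt ((s₀, 0) : ℝ × ℝ)
        (𝓟 {q | q ∈ Minkowski.edgeDomain I δ ∧ Minkowski.IsUmbilic f q})) ∧
      -- (d)
      (Minkowski.IsCuspidalEdgePoint f (s₀, 0) ↔ Minkowski.muZero μ s₀ ≠ 0) ∧
      (Minkowski.acc f s₀ ≠ 0 →
        -- (1)
        ((∀ q ∈ V \ Minkowski.sAxis, Minkowski.IsSpacelikeAt f q) →
          (∀ s : ℝ, ((s, 0) : ℝ × ℝ) ∈ V → Minkowski.IsConcaveAt f s) ∧
          ∀ q ∈ V \ Minkowski.sAxis, 0 < Minkowski.gaussL f q) ∧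
        -- (2)
        ((∀ q ∈ V \ Minkowski.sAxis, Minkowski.IsTimelikeAt f q) →
          ((∀ q ∈ V \ Minkowski.sAxis, 0 < Minkowski.gaussL f q) ↔
            Minkowski.IsConvexAt f s₀) ∧
          ((∀ q ∈ V \ Minkowski.sAxis, Minkowski.gaussL f q < 0) ↔
            Minkowski.IsConcaveAt f s₀) ∧
          (¬ Minkowski.IsCuspidalEdgePoint f (s₀, 0) →
            (∀ q ∈ V \ Minkowski.sAxis, 0 < Minkowski.gaussL f q) ∧
            Minkowski.IsConvexAt f s₀)) ∧
        -- (3) divergence and sign of the Gaussian curvature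
        Tendsto (fun q => |Minkowski.gaussL f q|)
          (𝓝[Minkowski.sAxisᶜ] ((s₀, 0) : ℝ × ℝ)) atTop ∧
        ((∀ q ∈ V \ Minkowski.sAxis, 0 < Minkowski.gaussL f q) ∨
          (∀ q ∈ V \ Minkowski.sAxis, Minkowski.gaussL f q < 0)) ∧
        -- (3) both principal curvatures are unbounded
        (∀ k₁ k₂ : ℝ × ℝ → ℂ,
          (∀ q ∈ V \ Minkowski.sAxis, Minkowski.principalCurvatures f q = {k₁ q, k₂ q}) →
          (¬ ∃ C : ℝ, ∀ q ∈ V \ Minkowski.sAxis, ‖k₁ q‖ ≤ C) ∧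
          (¬ ∃ C : ℝ, ∀ q ∈ V \ Minkowski.sAxis, ‖k₂ q‖ ≤ C)) ∧
        -- (3) reality of the principal curvatures
        ((∀ q ∈ V \ Minkowski.sAxis, Minkowski.IsSpacelikeAt f q) →
          ∀ q ∈ V \ Minkowski.sAxis, ∀ k ∈ Minkowski.principalCurvatures f q, k.im = 0) ∧
        ((∀ q ∈ V \ Minkowski.sAxis, Minkowski.IsTimelikeAt f q) →
          ((∀ q ∈ V \ Minkowski.sAxis, Minkowski.gaussL f q < 0) →
            ∀ q ∈ V \ Minkowski.sAxis, ∀ k ∈ Minkowski.principalCurvatures f q, k.im = 0) ∧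
          ((∀ q ∈ V \ Minkowski.sAxis, 0 < Minkowski.gaussL f q) →
            ∀ q ∈ V \ Minkowski.sAxis, ∀ k ∈ Minkowski.principalCurvatures f q, k.im ≠ 0)) ∧
        -- (4)
        (¬ AccPt ((s₀, 0) : ℝ × ℝ)
          (𝓟 {q | q ∈ Minkowski.edgeDomain I δ ∧ Minkowski.IsQuasiUmbilic f q}))) := by
  refine ⟨Minkowski.exists_isMuFunctionAt hIopen hδ hf harc hs₀, fun σ μ hμ W hW => ?_⟩
  obtain ⟨m, φ, nf, hm⟩ := hμ.exists_normalForm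
  exact nf.main hIopen hδ hf harc hs₀ hm
    (nf.isCuspidalEdgePoint_iff hIopen hδ hf harc hs₀) hW
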